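/- For a fundamental discriminant $d$ (that is, $d\equiv 1 \pmod 4$ square-free, including $d=1$, or $d=4m$ with $m\equiv 2,3\pmod 4$ square-free) let $\chi_d(n)=\left(\frac{d}{n}\right)$ (Kronecker symbol) be the corresponding real primitive character of conductor $|d|$, and let $L(s,\chi_d)$ be its Dirichlet $L$-function, continued analytically; the central value $L(\tfrac12,\chi_d)$ is real. Then for every even natural number $k$ $$\sum_{\substack{|d|\le X\\ d\ \text{fundamental discriminant}}} L(\tfrac12,\chi_d)^k \gg_k X(\log X)^{k(k+1)/2}\qquad (X\to\infty),$$ that is, there are a constant $c>0$ and an $X_0$, both depending only on $k$, such that for all real $X\ge X_0$ the sum is at least $c\,X(\log X)^{k(k+1)/2}$. -/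

import Mathlib

/-- `d` is a fundamental discriminant: either `d ≡ 1 (mod 4)` is square-free, or `d = 4 m` with
`m ≡ 2, 3 (mod 4)` square-free.  (So `d = 1` is a fundamental discriminant.) -/
def IsFundamentalDiscriminant (d : ℤ) : Prop :=
  (d % 4 = 1 ∧ Squarefree d) ∨
    ∃ m : ℤ, d = 4 * m ∧ (m % 4 = 2 ∨ m % 4 = 3) ∧ Squarefree m

/-- The Kronecker symbol `(d / n)` for an integer `d` and a natural number `n`: completely
multiplicative in `n ≥ 1`, equal to the Jacobi symbol for odd `n`, with
`(d / 2) = 0, 1, -1` according as `d` is even, `d ≡ ±1 (mod 8)`, `d ≡ ±3 (mod 8)`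
(this is `ZMod.χ₈ d`), and with `(d / 0) = 1` if `d = ±1` and `0` otherwise. -/
def kroneckerSym (d : ℤ) (n : ℕ) : ℤ :=
  if n = 0 then (if d.natAbs = 1 then 1 else 0)
  else ZMod.χ₈ (d : ZMod 8) ^ n.factorization 2 * jacobiSym d (ordCompl[2] n)

theorem IsFundamentalDiscriminant.ne_zero {d : ℤ} (h : IsFundamentalDiscriminant d) : d ≠ 0 := by
  rcases h with ⟨h, -⟩ | ⟨m, rfl, h, -⟩ <;> omega

theorem kroneckerSym_of_odd (d : ℤ) {n : ℕ} (hn : Odd n) : kroneckerSym d n = jacobiSym d n := by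
  have h2 : ¬ 2 ∣ n := by rw [← even_iff_two_dvd]; exact Nat.not_even_iff_odd.2 hn
  have h0 : n ≠ 0 := by rintro rfl; simp at hn
  simp [kroneckerSym, h0, Nat.factorization_eq_zero_of_not_dvd h2]

theorem jacobiSym_recip_of_one_mod_four {d : ℤ} (hd : d % 4 = 1) {n : ℕ} (hn : Odd n) :
    jacobiSym d n = jacobiSym n d.natAbs := by
  rcases le_or_gt 0 d with h | h
  · obtain ⟨a, rfl⟩ := Int.eq_ofNat_of_zero_le h
    simpa using jacobiSym.quadratic_reciprocity_one_mod_four (by omega) hn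
  · obtain ⟨a, rfl⟩ : ∃ a : ℕ, d = -(a : ℤ) := ⟨d.natAbs, by omega⟩
    have ha : a % 4 = 3 := by omega
    rw [jacobiSym.neg _ hn, Int.natAbs_neg, Int.natAbs_natCast]
    rcases Nat.odd_mod_four_iff.1 (Nat.odd_iff.1 hn) with h1 | h3
    · rw [ZMod.χ₄_nat_one_mod_four h1, one_mul,
        jacobiSym.quadratic_reciprocity_one_mod_four h1 (Nat.odd_iff.2 (by omega))]
    · rw [ZMod.χ₄_nat_three_mod_four h3, jacobiSym.quadratic_reciprocity_three_mod_four ha h3]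
      ring

theorem kroneckerSym_of_one_mod_four {d : ℤ} (hd : d % 4 = 1) (n : ℕ) :
    kroneckerSym d n = jacobiSym n d.natAbs := by
  by_cases h0 : n = 0
  · subst h0
    by_cases h1 : d.natAbs = 1
    · simp [kroneckerSym, h1]
    · have : 1 < d.natAbs := by omega
      simp [kroneckerSym, h1, jacobiSym.zero_left this]
  · have hodd : Odd (ordCompl[2] n) := by
      rw [← Nat.not_even_iff_odd, even_iff_two_dvd]
      exact Nat.not_dvd_ordCompl Nat.prime_two h0
    have hN : Odd d.natAbs := Nat.odd_iff.2 (by omega)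
    have h8 : ZMod.χ₈ (d : ZMod 8) = jacobiSym 2 d.natAbs := by
      rw [jacobiSym.at_two hN]
      rcases Int.natAbs_eq d with h | h
      · conv_lhs => rw [h]
        simp
      · conv_lhs => rw [h]
        have key : ∀ x : ZMod 8, ZMod.χ₈ (-x) = ZMod.χ₈ x := by decide
        rw [Int.cast_neg, Int.cast_natCast, key]
    rw [kroneckerSym, if_neg h0, jacobiSym_recip_of_one_mod_four hd hodd, h8]
    conv_rhs => rw [← Nat.ordProj_mul_ordCompl_eq_self n 2]
    push_cast [jacobiSym.mul_left, jacobiSym.pow_left]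
    rfl

theorem kroneckerSym_four_mul (m : ℤ) (n : ℕ) :
    kroneckerSym (4 * m) n = if Odd n then jacobiSym m n else 0 := by
  split_ifs with hn
  · rw [kroneckerSym_of_odd _ hn, jacobiSym.mul_left, show (4 : ℤ) = 2 ^ 2 by norm_num,
      jacobiSym.sq_one' , one_mul]
    rw [Int.gcd_comm]
    simpa [Int.gcd] using hn
  · rw [Nat.not_odd_iff_even, even_iff_two_dvd] at hn
    by_cases h0 : n = 0
    · subst h0
      have : (4 * m).natAbs ≠ 1 := by omega
      simp [kroneckerSym, this]
    · have h8 : ZMod.χ₈ ((4 * m : ℤ) : ZMod 8) = 0 := by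
        have key : ∀ x : ZMod 8, ZMod.χ₈ (4 * x) = 0 := by decide
        push_cast
        exact key _
      have hf : n.factorization 2 ≠ 0 :=
        (Nat.prime_two.factorization_pos_of_dvd h0 hn).ne'
      rw [kroneckerSym, if_neg h0, h8, zero_pow hf, zero_mul]

theorem IsFundamentalDiscriminant.kroneckerSym_mod {d : ℤ} (h : IsFundamentalDiscriminant d)
    (n : ℕ) : kroneckerSym d (n % d.natAbs) = kroneckerSym d n := by
  rcases h with ⟨h, -⟩ | ⟨m, rfl, h, -⟩
  · rw [kroneckerSym_of_one_mod_four h, kroneckerSym_of_one_mod_four h, jacobiSym.mod_left ↑n]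
    simp
  · have hN : (4 * m).natAbs = 4 * m.natAbs := by simp [Int.natAbs_mul]
    have hodd : Odd (n % (4 * m.natAbs)) ↔ Odd n := by
      rw [Nat.odd_iff, Nat.odd_iff, Nat.mod_mod_of_dvd _ ⟨2 * m.natAbs, by ring⟩]
    rw [kroneckerSym_four_mul, kroneckerSym_four_mul, hN]
    simp only [hodd]
    split_ifs with ho
    · exact (jacobiSym.mod_right m ho).symm
    · rfl

theorem IsFundamentalDiscriminant.kroneckerSym_mul {d : ℤ} (h : IsFundamentalDiscriminant d)
    (a b : ℕ) : kroneckerSym d (a * b) = kroneckerSym d a * kroneckerSym d b := by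
  rcases h with ⟨h, -⟩ | ⟨m, rfl, h, -⟩
  · simp only [kroneckerSym_of_one_mod_four h]
    push_cast
    exact jacobiSym.mul_left _ _ _
  · simp only [kroneckerSym_four_mul, Nat.odd_mul]
    by_cases ha : Odd a <;> by_cases hb : Odd b <;> simp [ha, hb]
    exact jacobiSym.mul_right' _ (by rintro rfl; simp at ha) (by rintro rfl; simp at hb)

theorem IsFundamentalDiscriminant.kroneckerSym_one {d : ℤ} : kroneckerSym d 1 = 1 := by
  simp [kroneckerSym]

theorem IsFundamentalDiscriminant.kroneckerSym_eq_zero {d : ℤ} (h : IsFundamentalDiscriminant d)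
    {n : ℕ} (hn : ¬ n.Coprime d.natAbs) : kroneckerSym d n = 0 := by
  rcases h with ⟨h, -⟩ | ⟨m, rfl, h, -⟩
  · rw [kroneckerSym_of_one_mod_four h]
    have : NeZero d.natAbs := ⟨by omega⟩
    refine jacobiSym.eq_zero_iff_not_coprime.2 fun hc => hn ?_
    rwa [Int.gcd_natCast_natCast] at hc
  · rw [kroneckerSym_four_mul]
    split_ifs with ho
    · have : NeZero n := ⟨by rintro rfl; simp at ho⟩
      refine jacobiSym.eq_zero_iff_not_coprime.2 fun hc => hn ?_
      rw [Int.natAbs_mul]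
      refine Nat.Coprime.mul_right ?_ ?_
      · exact Nat.Coprime.pow_right 2 (Nat.coprime_two_right.2 ho)
      · simpa [Int.gcd, Nat.Coprime, Nat.gcd_comm] using hc
    · rfl

/-- The real primitive character `χ_d` of conductor `|d|` attached to a fundamental discriminant
`d`, given by the Kronecker symbol: `χ_d(n) = (d / n)`. -/
noncomputable def quadraticCharacter (d : ℤ) (h : IsFundamentalDiscriminant d) :
    DirichletCharacter ℂ d.natAbs where
  toFun a := (kroneckerSym d a.val : ℂ)
  map_one' := by
    have h0 := h.ne_zero
    have : NeZero d.natAbs := ⟨by omega⟩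
    have h1 : ((1 : ℕ) : ZMod d.natAbs) = 1 := Nat.cast_one
    rw [← h1, ZMod.val_natCast, h.kroneckerSym_mod, IsFundamentalDiscriminant.kroneckerSym_one]
    simp
  map_mul' a b := by
    rw [ZMod.val_mul, h.kroneckerSym_mod, h.kroneckerSym_mul]
    push_cast
    rfl
  map_nonunit' a ha := by
    have h0 := h.ne_zero
    have : NeZero d.natAbs := ⟨by omega⟩
    have hc : ¬ a.val.Coprime d.natAbs := by
      rw [← ZMod.isUnit_iff_coprime, ZMod.natCast_zmod_val]
      exact ha
    simp [h.kroneckerSym_eq_zero hc]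

theorem quadraticCharacter_natCast {d : ℤ} (h : IsFundamentalDiscriminant d) (n : ℕ) :
    quadraticCharacter d h (n : ZMod d.natAbs) = (kroneckerSym d n : ℂ) := by
  change ((kroneckerSym d (n : ZMod d.natAbs).val : ℤ) : ℂ) = _
  rw [ZMod.val_natCast, h.kroneckerSym_mod]

/-- `L(s, χ_d)`, the meromorphic continuation to `ℂ` of `∑ χ_d(n) n⁻ˢ`. -/
noncomputable def quadraticLFunction (d : ℤ) (h : IsFundamentalDiscriminant d) (s : ℂ) : ℂ :=
  haveI : NeZero d.natAbs := ⟨Int.natAbs_ne_zero.2 h.ne_zero⟩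
  DirichletCharacter.LFunction (quadraticCharacter d h) s

open Classical in
/-- The central value `L(1/2, χ_d)` as a real number (set to `0` if `d` is not a fundamental
discriminant).  That `L(1/2, χ_d)` is real is `ofReal_centralValue`. -/
noncomputable def centralValue (d : ℤ) : ℝ :=
  if h : IsFundamentalDiscriminant d then (quadraticLFunction d h (1 / 2)).re else 0

theorem quadraticLFunction_conj {d : ℤ} (h : IsFundamentalDiscriminant d) {s : ℂ} (hs : s ≠ 1) :
    (starRingEnd ℂ) (quadraticLFunction d h ((starRingEnd ℂ) s)) = quadraticLFunction d h s := by
  have : NeZero d.natAbs := ⟨Int.natAbs_ne_zero.2 h.ne_zero⟩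
  have hU : IsOpen ({1}ᶜ : Set ℂ) := isOpen_compl_singleton
  have hdiff : ∀ z : ℂ, z ≠ 1 → DifferentiableAt ℂ (quadraticLFunction d h) z := fun z hz =>
    DirichletCharacter.differentiableAt_LFunction _ z (Or.inl hz)
  have hf : AnalyticOnNhd ℂ (quadraticLFunction d h) {1}ᶜ :=
    DifferentiableOn.analyticOnNhd (fun z hz => (hdiff z hz).differentiableWithinAt) hU
  have hg : AnalyticOnNhd ℂ
      ((starRingEnd ℂ) ∘ quadraticLFunction d h ∘ (starRingEnd ℂ)) {1}ᶜ := by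
    refine DifferentiableOn.analyticOnNhd (fun z hz => ?_) hU
    refine DifferentiableAt.differentiableWithinAt ?_
    rw [differentiableAt_conj_conj_iff]
    refine hdiff _ fun hz' => hz ?_
    simpa using congrArg (starRingEnd ℂ) hz'
  have hpre : IsPreconnected ({1}ᶜ : Set ℂ) :=
    (isConnected_compl_singleton_of_one_lt_rank (by simp) 1).isPreconnected
  have hev : ((starRingEnd ℂ) ∘ quadraticLFunction d h ∘ (starRingEnd ℂ))
      =ᶠ[nhds (2 : ℂ)] quadraticLFunction d h := by
    have ho : IsOpen {z : ℂ | 1 < z.re} := isOpen_lt continuous_const Complex.continuous_re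
    filter_upwards [ho.mem_nhds (show (2 : ℂ) ∈ {z : ℂ | 1 < z.re} by simp)] with z hz
    have hz1 : 1 < z.re := hz
    have hz2 : 1 < ((starRingEnd ℂ) z).re := by simpa using hz1
    simp only [Function.comp_apply, quadraticLFunction]
    rw [DirichletCharacter.LFunction_eq_LSeries _ hz1,
      DirichletCharacter.LFunction_eq_LSeries _ hz2, LSeries, LSeries, Complex.conj_tsum]
    refine tsum_congr fun n => ?_
    by_cases hn : n = 0
    · simp [hn]
    · rw [LSeries.term_of_ne_zero hn, LSeries.term_of_ne_zero hn, map_div₀,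
        quadraticCharacter_natCast]
      congr 1
      · simp
      · rw [Complex.cpow_conj _ _ (by rw [Complex.natCast_arg]; exact Real.pi_ne_zero.symm)]
        simp
  exact hg.eqOn_of_preconnected_of_eventuallyEq hf hpre (by simp) hev hs

theorem ofReal_centralValue {d : ℤ} (h : IsFundamentalDiscriminant d) :
    (centralValue d : ℂ) = quadraticLFunction d h (1 / 2) := by
  rw [centralValue, dif_pos h]
  refine Complex.conj_eq_iff_re.1 ?_
  have := quadraticLFunction_conj h (s := 1 / 2) (by norm_num)
  rwa [show (starRingEnd ℂ) (1 / 2 : ℂ) = 1 / 2 by simp [map_ofNat]] at this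

open Classical in
/-- The finite set of fundamental discriminants `d` with `|d| ≤ X`. -/
noncomputable def fundamentalDiscriminants (X : ℝ) : Finset ℤ :=
  (Finset.Icc (-⌊X⌋) ⌊X⌋).filter IsFundamentalDiscriminant

theorem mem_fundamentalDiscriminants {X : ℝ} {d : ℤ} :
    d ∈ fundamentalDiscriminants X ↔ IsFundamentalDiscriminant d ∧ |(d : ℝ)| ≤ X := by
  classical
  rw [fundamentalDiscriminants, Finset.mem_filter, Finset.mem_Icc, ← abs_le, Int.le_floor,
    Int.cast_abs, and_comm]

/-! ### Poisson summation for Gaussians with periodic coefficients -/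

section Theta

open Complex Filter Topology

/-! Since `k` is even every term is nonnegative, so only the squarefree `d ≡ 1 (mod 8)` with `1 < d
≤ N` are kept. For them `(n/d) = (d/n')` with `n'` the odd part of `n`, and the root number is 1.

Following the lower-bound method of Rudnick and Soundararajan, `L(1/2, χ_d)` is compared with a
short Dirichlet polynomial `A(d) = ∑ (n/d) / √n` over odd `n ≤ x`, where `x` is a small power of
`N`. Put `S₁ = ∑ d^(1/4) L(1/2, χ_d) A(d)^(k-1)` and `S₂ = ∑ A(d)^k`. Young's inequality `u v^(k-1)
≤ ε^(1-k) u^k + ε v^k` with a small fixed `ε` bounds `∑ L(1/2, χ_d)^k` below by a constant times `N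
(log N)^(k(k+1)/2)`, as soon as `S₁ ≫ N^(5/4) (log N)^(k(k+1)/2)` and `S₂ ≪ N (log N)^(k(k+1)/2)`.

For `S₂`, expand the power. Tuples whose product is not a square cancel by Pólya–Vinogradov; the
others give at most a multiple of `∑ τ_k(m²) / m`. Since `τ_k(p²) = k(k+1)/2` at primes, this sum
has order `(log x)^(k(k+1)/2)` (`exists_sum_piFinset_isSquare_le`).

For `S₁`, the functional equation of a theta series expresses the central value as an integral over
`[1, ∞)` (`centralValue_eq_integral`). The sign in that equation is Gauss's evaluation of the
quadratic Gauss sum, proved here by comparing two asymptotics of a theta series. After twisting by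
`(m/d)`, the terms with the odd part of `n m` a square are nonnegative and can be dropped at will;
those with `n` odd, `n ≤ x` and `n m` a square are kept. The remaining terms cancel: sieving
squarefree `d` by Möbius and interpolating Pólya–Vinogradov with the trivial bound
(`exists_abs_sum_squarefree_jacobiSym_le`) leaves an error `N^(29/24)` against a main term of size
`N^(5/4)`. The surviving `k`-tuples have square product, now with a density `φ(P)/P` from `d`
coprime to `P`, and the weight costs no logarithm (`exists_log_pow_le_sum_piFinset_isSquare`). -/

theorem tsum_int_eq_sum_residues {E : Type*} [NormedAddCommGroup E] [CompleteSpace E]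
    (N : ℕ) [NeZero N] {F : ℤ → E} (hF : Summable F) :
    ∑' n, F n = ∑ r : Fin N, ∑' m : ℤ, F (m * N + r) := by
  have h1 : Summable fun p : ℤ × Fin N => F (p.1 * N + p.2) :=
    ((Int.divModEquiv N).symm.summable_iff (f := F)).2 hF
  have h2 := (Int.divModEquiv N).symm.tsum_eq F
  rw [← h2]
  have h3 : Summable fun p : Fin N × ℤ => F (p.2 * N + p.1) :=
    ((Equiv.prodComm (Fin N) ℤ).summable_iff
      (f := fun p : ℤ × Fin N => F (p.1 * N + p.2))).2 h1
  have h4 : ∑' p : ℤ × Fin N, F (p.1 * N + p.2) = ∑' p : Fin N × ℤ, F (p.2 * N + p.1) :=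
    ((Equiv.prodComm (Fin N) ℤ).tsum_eq (fun p : ℤ × Fin N => F (p.1 * N + p.2))).symm
  refine Eq.trans h4 ?_
  rw [h3.tsum_prod' fun b => h3.prod_factor b, tsum_fintype]

theorem summable_exp_neg_pi_sq {t : ℝ} (ht : 0 < t) :
    Summable fun n : ℤ => Real.exp (-Real.pi * n ^ 2 * t) := by
  have := summable_pow_mul_jacobiTheta₂_term_bound 0 ht 0
  refine this.congr fun n => ?_
  simp only [pow_zero, one_mul]
  congr 1
  ring

theorem norm_exp_neg_pi_sq (n : ℤ) (z : ℂ) :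
    ‖cexp (-Real.pi * n ^ 2 * z)‖ = Real.exp (-Real.pi * n ^ 2 * z.re) := by
  rw [Complex.norm_exp, show -(Real.pi : ℂ) * (n : ℂ) ^ 2 * z
    = ((-Real.pi * (n : ℝ) ^ 2 : ℝ) : ℂ) * z by push_cast; ring, Complex.re_ofReal_mul]

theorem summable_mul_exp_neg_pi_sq {z : ℂ} (hz : 0 < z.re) {g : ℤ → ℂ} {C : ℝ}
    (hg : ∀ n, ‖g n‖ ≤ C) : Summable fun n : ℤ => g n * cexp (-Real.pi * n ^ 2 * z) := by
  refine Summable.of_norm_bounded ((summable_exp_neg_pi_sq hz).mul_left C) fun n => ?_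
  rw [norm_mul, norm_exp_neg_pi_sq]
  exact mul_le_mul_of_nonneg_right (hg n) (Real.exp_pos _).le

/-- Expanding the square leaves a Gaussian with a linear term. In its Poisson dual the cross term is
the additive character of `k r`, and the `r²` exponentials cancel. -/
theorem tsum_exp_neg_pi_sq_residue (N : ℕ) [NeZero N] {z : ℂ} (hz : 0 < z.re) (r : ℤ) :
    ∑' m : ℤ, cexp (-Real.pi * ((m * N + r : ℤ) : ℂ) ^ 2 * z) =
      1 / (N ^ 2 * z) ^ (1 / 2 : ℂ) * ∑' k : ℤ, ZMod.stdAddChar ((k * r : ℤ) : ZMod N) *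
        cexp (-Real.pi * k ^ 2 * (1 / (N ^ 2 * z))) := by
  have hN : (N : ℂ) ≠ 0 := NeZero.ne _
  have hz0 : z ≠ 0 := by rintro rfl; simp at hz
  have ha : 0 < ((N : ℂ) ^ 2 * z).re := by
    rw [show (N : ℂ) ^ 2 * z = ((N ^ 2 : ℝ) : ℂ) * z by push_cast; ring, Complex.re_ofReal_mul]
    have : (0 : ℝ) < N := Nat.cast_pos.2 (NeZero.pos N)
    positivity
  have h := Complex.tsum_exp_neg_quadratic ha (-(r * N * z))
  have h1 : ∀ m : ℤ, cexp (-Real.pi * ((m * N + r : ℤ) : ℂ) ^ 2 * z) =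
      cexp (-Real.pi * r ^ 2 * z) *
        cexp (-Real.pi * (N ^ 2 * z) * m ^ 2 + 2 * Real.pi * (-(r * N * z)) * m) := fun m => by
    rw [← Complex.exp_add]
    congr 1
    push_cast
    ring
  simp_rw [h1]
  rw [tsum_mul_left, h, mul_left_comm, ← tsum_mul_left]
  congr 1
  refine tsum_congr fun k => ?_
  rw [ZMod.stdAddChar_coe, ← Complex.exp_add, ← Complex.exp_add]
  congr 1
  have hI : I ^ 2 = -1 := Complex.I_sq
  push_cast
  field_simp
  linear_combination (-(r:ℂ) ^ 2 * N * z ) * hI * N * z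

/-- Poisson summation for a Gaussian weighted by a periodic function. -/
theorem tsum_periodic_mul_exp_neg_pi_sq (N : ℕ) [NeZero N] {z : ℂ} (hz : 0 < z.re)
    (f : ZMod N → ℂ) :
    ∑' n : ℤ, f n * cexp (-Real.pi * n ^ 2 * z) =
      1 / (N ^ 2 * z) ^ (1 / 2 : ℂ) * ∑' k : ℤ, (∑ r : ZMod N, f r * ZMod.stdAddChar ((k : ZMod N) * r)) *
        cexp (-Real.pi * k ^ 2 * (1 / (N ^ 2 * z))) := by
  have hbd : ∀ n : ℤ, ‖f n‖ ≤ ∑ r, ‖f r‖ := fun n =>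
    Finset.single_le_sum (f := fun r => ‖f r‖) (fun _ _ => norm_nonneg _) (Finset.mem_univ _)
  have hw : 0 < (1 / ((N : ℂ) ^ 2 * z)).re := by
    have ha : 0 < ((N : ℂ) ^ 2 * z).re := by
      rw [show (N : ℂ) ^ 2 * z = ((N ^ 2 : ℝ) : ℂ) * z by push_cast; ring, Complex.re_ofReal_mul]
      have : (0 : ℝ) < N := Nat.cast_pos.2 (NeZero.pos N)
      positivity
    rw [one_div, Complex.inv_re]
    exact div_pos ha (Complex.normSq_pos.2 fun h => by simp [h] at ha)
  rw [tsum_int_eq_sum_residues N (summable_mul_exp_neg_pi_sq hz hbd)]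
  have h1 : ∀ r : Fin N, ∑' m : ℤ, f ((m * N + (r : ℕ) : ℤ) : ZMod N) *
      cexp (-Real.pi * ((m * N + (r : ℕ) : ℤ) : ℂ) ^ 2 * z) =
      1 / (N ^ 2 * z) ^ (1 / 2 : ℂ) * ∑' k : ℤ, f (r : ℕ) * ZMod.stdAddChar ((k : ZMod N) * ((r : ℕ) : ZMod N)) *
        cexp (-Real.pi * k ^ 2 * (1 / (N ^ 2 * z))) := fun r => by
    have : ∀ m : ℤ, ((m * N + (r : ℕ) : ℤ) : ZMod N) = (r : ℕ) := fun m => by simp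
    simp_rw [this]
    rw [tsum_mul_left, tsum_exp_neg_pi_sq_residue N hz (r : ℕ), mul_left_comm, ← tsum_mul_left]
    congr 1
    refine tsum_congr fun k => ?_
    push_cast
    ring
  simp_rw [h1]
  rw [← Finset.mul_sum, ← Summable.tsum_finsetSum]
  · congr 1
    refine tsum_congr fun k => ?_
    rw [← Finset.sum_mul]
    congr 1
    obtain ⟨n, rfl⟩ : ∃ n, N = n + 1 := ⟨N - 1, (Nat.succ_pred (NeZero.ne N)).symm⟩
    refine Finset.sum_congr rfl fun r _ => ?_
    have : ((r : ℕ) : ZMod (n + 1)) = r := Fin.cast_val_eq_self r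
    rw [this]
  · intro r _
    refine summable_mul_exp_neg_pi_sq (C := ‖f (r : ℕ)‖) hw fun k => ?_
    rw [norm_mul, AddChar.norm_apply, mul_one]

/-- Dominated convergence, with the Gaussian at real part 1 as majorant. This isolates the zero
frequency, and so a finite sum, from a theta series near a cusp. -/
theorem tendsto_tsum_mul_exp_neg_pi_sq {ι : Type*} {l : Filter ι} {w : ι → ℂ}
    (hw : Tendsto (fun i => (w i).re) l atTop) {g : ℤ → ℂ} {C : ℝ} (hg : ∀ n, ‖g n‖ ≤ C) :
    Tendsto (fun i => ∑' n : ℤ, g n * cexp (-Real.pi * n ^ 2 * w i)) l (𝓝 (g 0)) := by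
  have h0 : ∑' n : ℤ, (if n = 0 then g 0 else 0) = g 0 := by simp
  rw [← h0]
  refine tendsto_tsum_of_dominated_convergence
    (bound := fun n : ℤ => C * Real.exp (-Real.pi * n ^ 2 * 1))
    ((summable_exp_neg_pi_sq one_pos).mul_left C) (fun n => ?_) ?_
  · split_ifs with hn
    · subst hn; simpa using tendsto_const_nhds
    · rw [tendsto_zero_iff_norm_tendsto_zero]
      simp_rw [norm_mul, norm_exp_neg_pi_sq]
      rw [show (0 : ℝ) = ‖g n‖ * 0 by simp]
      refine Tendsto.const_mul _ (Real.tendsto_exp_atBot.comp ?_)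
      have : -Real.pi * (n : ℝ) ^ 2 < 0 := by
        have : (0 : ℝ) < (n : ℝ) ^ 2 := by positivity
        nlinarith [Real.pi_pos]
      exact hw.const_mul_atTop_of_neg this
  · filter_upwards [hw.eventually_ge_atTop 1] with i hi n
    rw [norm_mul, norm_exp_neg_pi_sq]
    refine mul_le_mul (hg n) (Real.exp_le_exp.2 ?_) (Real.exp_pos _).le
      ((norm_nonneg _).trans (hg n))
    have : 0 ≤ Real.pi * (n : ℝ) ^ 2 := by positivity
    nlinarith

end Theta

/-! ### The sign of the quadratic Gauss sum -/

section GaussSign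

open Complex Filter Topology

theorem ofReal_mul_cpow {x : ℝ} (hx : 0 < x) {z : ℂ} (hz : z ≠ 0) (s : ℂ) :
    ((x : ℂ) * z) ^ s = (x : ℂ) ^ s * z ^ s := by
  have hx' : (x : ℂ) ≠ 0 := ofReal_ne_zero.2 hx.ne'
  rw [cpow_def_of_ne_zero (mul_ne_zero hx' hz), cpow_def_of_ne_zero hx', cpow_def_of_ne_zero hz,
    Complex.log_ofReal_mul hx hz, add_mul, Complex.exp_add, Complex.ofReal_log hx.le]

/-- `k²` modulo 4 depends only on the parity of `k`, so the factor is 2-periodic and a second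
Poisson summation, modulo 2, applies to it. -/
theorem exp_neg_pi_mul_sq_mul_I_half (N : ℕ) (k : ℤ) :
    cexp (-Real.pi * k ^ 2 * (I * N / 2)) =
      if (k : ZMod 2) = 0 then 1 else cexp (-Real.pi * (I * N / 2)) := by
  have h2 : (k : ZMod 2) = 0 ↔ Even k := by
    rw [ZMod.intCast_zmod_eq_zero_iff_dvd k 2]
    exact_mod_cast even_iff_two_dvd.symm
  split_ifs with h
  · obtain ⟨j, rfl⟩ := h2.1 h
    refine Complex.exp_eq_one_iff.2 ⟨-(j ^ 2 * N), ?_⟩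
    push_cast
    ring
  · obtain ⟨j, rfl⟩ := Int.not_even_iff_odd.1 (mt h2.2 h)
    refine Complex.exp_eq_exp_iff_exists_int.2 ⟨-((j ^ 2 + j) * N), ?_⟩
    push_cast
    ring

/-- The series `Θ ε = ∑ e(n²/N) exp(-π n² ε)` is evaluated as `ε → 0+` in two ways. Poisson
summation modulo `N` gives the Gauss sum. Theta inversion at `ε - 2i/N`, followed by Poisson
summation modulo 2, gives the closed form. -/
theorem sum_stdAddChar_sq_eq_cpow (N : ℕ) [NeZero N] :
    ∑ r : ZMod N, ZMod.stdAddChar (r ^ 2) =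
      1 / (-2 * I / N) ^ (1 / 2 : ℂ) * (1 + cexp (-Real.pi * (I * N / 2))) := by
  have hNpos : (0 : ℝ) < N := Nat.cast_pos.2 (NeZero.pos N)
  have hN : (N : ℂ) ≠ 0 := NeZero.ne _
  set Θ : ℝ → ℂ := fun ε => ∑' n : ℤ, ZMod.stdAddChar ((n : ZMod N) ^ 2) *
    cexp (-Real.pi * n ^ 2 * (ε : ℂ)) with hΘ
  set c : ℂ := cexp (-Real.pi * (I * N / 2)) with hc
  have hεN : Tendsto (fun ε : ℝ => 1 / ((N : ℝ) ^ 2 * ε)) (𝓝[>] 0) atTop := by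
    have := (tendsto_inv_nhdsGT_zero (𝕜 := ℝ)).const_mul_atTop
      (show (0 : ℝ) < 1 / (N : ℝ) ^ 2 by positivity)
    refine this.congr fun ε => ?_
    rw [one_div, one_div, mul_inv]
  have hsum : ∀ k : ℤ, ‖∑ r : ZMod N, ZMod.stdAddChar (r ^ 2) *
      ZMod.stdAddChar ((k : ZMod N) * r)‖ ≤ N := fun k => by
    refine (norm_sum_le _ _).trans ?_
    simp [AddChar.norm_apply]
  -- First evaluation: modulo `N`, only the zero frequency survives.
  have lim1 : Tendsto (fun ε : ℝ => (((N ^ 2 * ε : ℝ) : ℂ)) ^ (1 / 2 : ℂ) * Θ ε) (𝓝[>] 0)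
      (𝓝 (∑ r : ZMod N, ZMod.stdAddChar (r ^ 2))) := by
    have h1 : Tendsto (fun ε : ℝ => ∑' k : ℤ, (∑ r : ZMod N, ZMod.stdAddChar (r ^ 2) *
        ZMod.stdAddChar ((k : ZMod N) * r)) *
          cexp (-Real.pi * k ^ 2 * (1 / (N ^ 2 * ε)))) (𝓝[>] 0)
        (𝓝 (∑ r : ZMod N, ZMod.stdAddChar (r ^ 2) * ZMod.stdAddChar (((0 : ℤ) : ZMod N) * r))) := by
      refine tendsto_tsum_mul_exp_neg_pi_sq (hεN.congr fun ε => ?_) hsum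
      rw [show (1 : ℂ) / (N ^ 2 * ε) = ((1 / (N ^ 2 * ε) : ℝ) : ℂ) by push_cast; ring,
        Complex.ofReal_re]
    simp only [Int.cast_zero, zero_mul, AddChar.map_zero_eq_one, mul_one] at h1
    refine h1.congr' ?_
    filter_upwards [self_mem_nhdsWithin] with ε hε
    have hε' : (0 : ℝ) < ε := hε
    have := tsum_periodic_mul_exp_neg_pi_sq N (z := (ε : ℂ)) (by simpa using hε')
      (fun r => ZMod.stdAddChar (r ^ 2))
    rw [hΘ]
    simp only [] at this ⊢
    rw [this, ← mul_assoc]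
    have hne : ((N : ℂ) ^ 2 * ε) ^ (1 / 2 : ℂ) ≠ 0 := by
      rw [Ne, Complex.cpow_eq_zero_iff]
      simp [hN, hε'.ne']
    push_cast
    rw [mul_one_div_cancel hne, one_mul]
  set f : ZMod 2 → ℂ := fun r => if r = 0 then 1 else c with hf
  have hfsum : ∑ r : ZMod 2, f r = 1 + c := by
    have : (Finset.univ : Finset (ZMod 2)) = {0, 1} := rfl
    rw [this, Finset.sum_pair (by decide)]
    simp [hf]
  have hfbd : ∀ k : ℤ, ‖∑ r : ZMod 2, f r * ZMod.stdAddChar ((k : ZMod 2) * r)‖ ≤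
      ∑ r : ZMod 2, ‖f r‖ := fun k => by
    refine (norm_sum_le _ _).trans (le_of_eq ?_)
    simp [AddChar.norm_apply]
  -- Second evaluation: `Θ ε` is the plain theta series at `a = ε - 2i/N`.
  have lim2 : Tendsto (fun ε : ℝ => (((N ^ 2 * ε : ℝ) : ℂ)) ^ (1 / 2 : ℂ) * Θ ε) (𝓝[>] 0)
      (𝓝 (1 / (-2 * I / N) ^ (1 / 2 : ℂ) * (1 + c))) := by
    have h1 : Tendsto (fun ε : ℝ => ∑' k : ℤ, (∑ r : ZMod 2, f r *
        ZMod.stdAddChar ((k : ZMod 2) * r)) *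
          cexp (-Real.pi * k ^ 2 * ((1 + I * N * ε / 2) / (N ^ 2 * ε)))) (𝓝[>] 0)
        (𝓝 (∑ r : ZMod 2, f r * ZMod.stdAddChar (((0 : ℤ) : ZMod 2) * r))) := by
      refine tendsto_tsum_mul_exp_neg_pi_sq (hεN.congr fun ε => ?_) hfbd
      rw [show (1 + I * N * ε / 2) / ((N : ℂ) ^ 2 * ε) =
        ((1 / (N ^ 2 * ε) : ℝ) : ℂ) + ((N * ε / 2 / (N ^ 2 * ε) : ℝ) : ℂ) * I by push_cast; ring]
      rw [Complex.add_re, Complex.ofReal_re, Complex.re_ofReal_mul, Complex.I_re, mul_zero, add_zero]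
    simp only [Int.cast_zero, zero_mul, AddChar.map_zero_eq_one, mul_one, hfsum] at h1
    have hlim0 : Tendsto (fun ε : ℝ => (ε : ℂ)) (𝓝[>] 0) (𝓝 0) := by
      have : Continuous fun ε : ℝ => (ε : ℂ) := Complex.continuous_ofReal
      simpa using (this.tendsto 0).mono_left nhdsWithin_le_nhds
    have h2 : Tendsto (fun ε : ℝ => (ε - 2 * I / N : ℂ) ^ (1 / 2 : ℂ)) (𝓝[>] 0)
        (𝓝 ((-2 * I / N) ^ (1 / 2 : ℂ))) := by
      have : Tendsto (fun ε : ℝ => (ε - 2 * I / N : ℂ)) (𝓝[>] 0) (𝓝 (0 - 2 * I / N)) :=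
        hlim0.sub_const _
      rw [show (0 : ℂ) - 2 * I / N = -2 * I / N by ring] at this
      refine Filter.Tendsto.cpow this tendsto_const_nhds (Or.inr ?_)
      rw [show -2 * I / (N : ℂ) = ((-2 / N : ℝ) : ℂ) * I by push_cast; ring]
      simp [hNpos.ne']
    have h3 : Tendsto (fun ε : ℝ => ((1 / (1 + I * N * ε / 2) : ℂ)) ^ (1 / 2 : ℂ)) (𝓝[>] 0)
        (𝓝 1) := by
      have : Tendsto (fun ε : ℝ => (1 / (1 + I * N * ε / 2) : ℂ)) (𝓝[>] 0)
          (𝓝 (1 / (1 + I * N * 0 / 2))) := by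
        refine Tendsto.div tendsto_const_nhds ((((hlim0.const_mul _).div_const _)).const_add _) ?_
        simp
      have := Filter.Tendsto.cpow this (tendsto_const_nhds (x := (1 / 2 : ℂ))) (by simp)
      simpa using this
    have h4 := ((h2.inv₀ (by
      rw [Ne, Complex.cpow_eq_zero_iff]
      simp [hN])).mul (h3.inv₀ one_ne_zero)).mul h1
    rw [inv_one, mul_one, ← one_div] at h4
    refine h4.congr' ?_
    filter_upwards [self_mem_nhdsWithin] with ε hε
    have hε' : (0 : ℝ) < ε := hε
    have hεc : (ε : ℂ) ≠ 0 := ofReal_ne_zero.2 hε'.ne'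
    set a : ℂ := ε - 2 * I / N with ha
    have hare : a.re = ε := by
      rw [ha, show (2 : ℂ) * I / N = ((2 / N : ℝ) : ℂ) * I by push_cast; ring]
      simp
    set u : ℂ := 1 + I * N * ε / 2 with hu
    have hure : u.re = 1 := by
      rw [hu, show I * N * ε / 2 = ((N * ε / 2 : ℝ) : ℂ) * I by push_cast; ring]
      simp
    have hu0 : u ≠ 0 := fun h => by rw [h] at hure; simp at hure
    have ha0 : a ≠ 0 := fun h => by rw [h] at hare; simp at hare; linarith
    -- `z` is defined so that `1 / a = z + i N / 2`: the second summand only produces the 2-periodic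
    -- factor, while `z → 0` with positive real part.
    set z : ℂ := ((N ^ 2 * ε / 4 : ℝ) : ℂ) * (1 / u) with hz
    have hzre : 0 < z.re := by
      rw [hz, Complex.re_ofReal_mul, one_div, Complex.inv_re, hure]
      have := Complex.normSq_pos.2 hu0
      positivity
    have hua : a * (I * N / 2) = u := by
      rw [ha, hu]
      field_simp
      linear_combination (-2 : ℂ) * Complex.I_sq
    have hinv : 1 / a = z + I * N / 2 := by
      have hz' : z * u = N ^ 2 * ε / 4 := by
        rw [hz]; push_cast; field_simp
      rw [div_eq_iff ha0, add_mul, mul_comm _ a, mul_comm _ a, hua]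
      have : u * (a * z) = u * (1 - u) := by
        rw [show u * (a * z) = a * (z * u) by ring, hz', hu, ha]
        field_simp
        linear_combination 4 * (ε : ℂ) ^ 2 * N ^ 2 * Complex.I_sq
      rw [mul_left_cancel₀ hu0 this]
      ring
    have e1 : Θ ε = 1 / a ^ (1 / 2 : ℂ) * ∑' k : ℤ, f k * cexp (-Real.pi * k ^ 2 * z) := by
      have h5 := Complex.tsum_exp_neg_mul_int_sq (a := a) (by rw [hare]; exact hε')
      have h6 : Θ ε = ∑' n : ℤ, cexp (-Real.pi * a * n ^ 2) := by
        refine tsum_congr fun n => ?_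
        rw [show ((n : ZMod N)) ^ 2 = ((n ^ 2 : ℤ) : ZMod N) by push_cast; rfl,
          ZMod.stdAddChar_coe, ← Complex.exp_add, ha]
        congr 1
        push_cast
        ring
      rw [h6, h5]
      congr 1
      refine tsum_congr fun n => ?_
      have := exp_neg_pi_mul_sq_mul_I_half N n
      simp only [hf]
      rw [← hc] at this
      rw [← this, ← Complex.exp_add]
      congr 1
      rw [show -(Real.pi : ℂ) / a = -Real.pi * (1 / a) by ring, hinv]
      ring
    have e2 := tsum_periodic_mul_exp_neg_pi_sq 2 hzre f
    have e3 : (((2 : ℕ) : ℂ)) ^ 2 * z = ((N ^ 2 * ε : ℝ) : ℂ) * (1 / u) := by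
      rw [hz]; push_cast; ring
    have e4 : 1 / ((((2 : ℕ) : ℂ)) ^ 2 * z) = u / (N ^ 2 * ε) := by
      rw [e3]; push_cast; field_simp
    rw [e4, e3, ofReal_mul_cpow (by positivity) (by simp [hu0])] at e2
    rw [e1, e2]
    have hne : (((N ^ 2 * ε : ℝ) : ℂ)) ^ (1 / 2 : ℂ) ≠ 0 := by
      rw [Ne, Complex.cpow_eq_zero_iff, Complex.ofReal_eq_zero]
      have : (N ^ 2 * ε : ℝ) ≠ 0 := by positivity
      simp only [this, false_and, not_false_eq_true]
    have hne2 : (1 / u) ^ (1 / 2 : ℂ) ≠ 0 := by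
      rw [Ne, Complex.cpow_eq_zero_iff]; simp [hu0]
    have hne3 : a ^ (1 / 2 : ℂ) ≠ 0 := by
      rw [Ne, Complex.cpow_eq_zero_iff]; simp [ha0]
    generalize (∑' k : ℤ, (∑ r : ZMod 2, f r * ZMod.stdAddChar ((k : ZMod 2) * r)) *
      cexp (-Real.pi * k ^ 2 * (u / (N ^ 2 * ε)))) = S
    field_simp
  exact tendsto_nhds_unique lim1 lim2

theorem exp_neg_pi_mul_I_half : cexp (-Real.pi * (I / 2)) = -I := by
  rw [show -(Real.pi : ℂ) * (I / 2) = -(Real.pi / 2 * I) by ring, Complex.exp_neg,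
    Complex.exp_pi_div_two_mul_I, Complex.inv_I]

/-- The branch of the square root is read off from the case `N = 1`, where the Gauss sum equals 1.
-/
theorem neg_two_mul_I_cpow_half : (-2 * I : ℂ) ^ (1 / 2 : ℂ) = 1 - I := by
  have h := sum_stdAddChar_sq_eq_cpow 1
  have h1 : (Finset.univ : Finset (ZMod 1)) = {0} := rfl
  rw [h1, Finset.sum_singleton, zero_pow two_ne_zero, AddChar.map_zero_eq_one, Nat.cast_one,
    div_one, mul_one, exp_neg_pi_mul_I_half, ← sub_eq_add_neg, one_div_mul_eq_div] at h
  exact (div_eq_one_iff_eq (by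
    rw [Ne, Complex.cpow_eq_zero_iff]; simp)).1 h.symm |>.symm

/-- The normalised sign of the quadratic Gauss sum modulo an odd number. -/
noncomputable def gaussSign (q : ℕ) : ℂ := if q % 4 = 1 then 1 else I

/-- Gauss's evaluation of the quadratic Gauss sum to an odd modulus. -/
theorem sum_stdAddChar_sq (N : ℕ) [NeZero N] (hN : Odd N) :
    ∑ r : ZMod N, ZMod.stdAddChar (r ^ 2) = gaussSign N * (Real.sqrt N : ℂ) := by
  have hNpos : (0 : ℝ) < N := Nat.cast_pos.2 (NeZero.pos N)
  have h1 : (-2 * I / N : ℂ) ^ (1 / 2 : ℂ) = (1 - I) / (Real.sqrt N : ℂ) := by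
    rw [show (-2 * I / N : ℂ) = ((N⁻¹ : ℝ) : ℂ) * (-2 * I) by push_cast; ring,
      ofReal_mul_cpow (by positivity) (by simp), neg_two_mul_I_cpow_half,
      show (1 / 2 : ℂ) = ((1 / 2 : ℝ) : ℂ) by push_cast; ring,
      ← Complex.ofReal_cpow (by positivity), ← Real.sqrt_eq_rpow, Real.sqrt_inv]
    push_cast
    ring
  have h2 : (1 - I : ℂ) ≠ 0 := fun h => by simpa using congrArg Complex.re h
  have h3 : (Real.sqrt N : ℂ) ≠ 0 := ofReal_ne_zero.2 (Real.sqrt_pos.2 hNpos).ne'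
  rw [sum_stdAddChar_sq_eq_cpow, h1]
  have h4 : 1 + cexp (-Real.pi * (I * N / 2)) = gaussSign N * (1 - I) := by
    have h5 : ∀ j : ℕ, cexp (-Real.pi * (I * ((4 * j + 1 : ℕ) : ℂ) / 2)) = -I := fun j => by
      rw [← exp_neg_pi_mul_I_half]
      refine Complex.exp_eq_exp_iff_exists_int.2 ⟨-j, ?_⟩
      push_cast
      ring
    have h6 : ∀ j : ℕ, cexp (-Real.pi * (I * ((4 * j + 3 : ℕ) : ℂ) / 2)) = I := fun j => by
      have : cexp (Real.pi * (I / 2)) = I := by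
        rw [show (Real.pi : ℂ) * (I / 2) = Real.pi / 2 * I by ring, Complex.exp_pi_div_two_mul_I]
      conv_rhs => rw [← this]
      refine Complex.exp_eq_exp_iff_exists_int.2 ⟨-(j + 1), ?_⟩
      push_cast
      ring
    rcases Nat.odd_mod_four_iff.1 (Nat.odd_iff.1 hN) with h | h
    · obtain ⟨j, rfl⟩ : ∃ j, N = 4 * j + 1 := ⟨N / 4, by omega⟩
      rw [h5, gaussSign, if_pos h]
      ring
    · obtain ⟨j, rfl⟩ : ∃ j, N = 4 * j + 3 := ⟨N / 4, by omega⟩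
      rw [h6, gaussSign, if_neg (by omega)]
      linear_combination Complex.I_sq
  rw [h4]
  field_simp

end GaussSign

/-! ### Gauss sums of Jacobi symbols -/

section JacobiGauss

open Complex

/-- The Jacobi symbol `(· / q)` as a complex-valued function on `ZMod q`. -/
noncomputable def jacobiFun (q : ℕ) (a : ZMod q) : ℂ := (jacobiSym a.val q : ℂ)

theorem jacobiFun_intCast (q : ℕ) [NeZero q] (n : ℤ) : jacobiFun q n = (jacobiSym n q : ℂ) := by
  rw [jacobiFun, ZMod.val_intCast, ← jacobiSym.mod_left]

theorem jacobiFun_natCast (q : ℕ) [NeZero q] (n : ℕ) : jacobiFun q n = (jacobiSym n q : ℂ) := by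
  rw [← jacobiFun_intCast, Int.cast_natCast]

theorem norm_jacobiSym_le_one (a : ℤ) (q : ℕ) : ‖(jacobiSym a q : ℂ)‖ ≤ 1 := by
  rcases jacobiSym.trichotomy a q with h | h | h <;> simp [h]

/-- Chinese remainder theorem, in the parametrisation `x m + y p` that splits `e(ab/(pm))` into
`e(xb/p) e(yb/m)`. -/
theorem sum_zmod_mul {E : Type*} [AddCommMonoid E] {p m : ℕ} [NeZero p] [NeZero m]
    (h : p.Coprime m) (F : ZMod (p * m) → E) :
    ∑ a, F a = ∑ x : ZMod p, ∑ y : ZMod m, F ((x.val * m + y.val * p : ℕ) : ZMod (p * m)) := by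
  rw [← Fintype.sum_prod_type']
  refine (Fintype.sum_bijective
    (fun w : ZMod p × ZMod m => ((w.1.val * m + w.2.val * p : ℕ) : ZMod (p * m))) ?_ _ _
      fun _ => rfl).symm
  rw [Fintype.bijective_iff_injective_and_card]
  constructor
  · rintro ⟨x, y⟩ ⟨x', y'⟩ hxy
    simp only at hxy
    have hp := congrArg (ZMod.castHom (dvd_mul_right p m) (ZMod p)) hxy
    have hm := congrArg (ZMod.castHom (dvd_mul_left m p) (ZMod m)) hxy
    simp only [map_natCast] at hp hm
    push_cast [ZMod.natCast_zmod_val] at hp hm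
    simp only [CharP.cast_eq_zero, mul_zero, add_zero, zero_add] at hp hm
    have um : IsUnit ((m : ℕ) : ZMod p) := (ZMod.isUnit_iff_coprime m p).2 h.symm
    have up : IsUnit ((p : ℕ) : ZMod m) := (ZMod.isUnit_iff_coprime p m).2 h
    exact Prod.ext (um.mul_right_cancel hp) (up.mul_right_cancel hm)
  · simp [ZMod.card]

/-- Quadratic reciprocity: the signs are multiplicative up to exactly the two cross symbols that the
Chinese remainder parametrisation produces. -/
theorem gaussSign_mul {p m : ℕ} (hp : Odd p) (hm : Odd m) (h : p.Coprime m) :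
    (jacobiSym p m : ℂ) * (jacobiSym m p : ℂ) * gaussSign p * gaussSign m =
      gaussSign (p * m) := by
  have hsq : (jacobiSym m p : ℂ) * (jacobiSym m p : ℂ) = 1 := by
    have := jacobiSym.sq_one (a := (m : ℤ)) (b := p) (by simpa [Int.gcd] using h.symm)
    rw [← sq]
    exact_mod_cast this
  simp only [gaussSign, Nat.mul_mod p m 4]
  rcases Nat.odd_mod_four_iff.1 (Nat.odd_iff.1 hp) with h1 | h1 <;>
    rcases Nat.odd_mod_four_iff.1 (Nat.odd_iff.1 hm) with h2 | h2
  · rw [jacobiSym.quadratic_reciprocity_one_mod_four h1 hm, hsq]; simp [h1, h2]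
  · rw [jacobiSym.quadratic_reciprocity_one_mod_four h1 hm, hsq]; simp [h1, h2]
  · rw [← jacobiSym.quadratic_reciprocity_one_mod_four h2 hp, hsq]; simp [h1, h2]
  · rw [jacobiSym.quadratic_reciprocity_three_mod_four h1 h2]
    push_cast
    rw [neg_mul, hsq]; simp [h1, h2]

/-- A residue `a` has `1 + (a/p)` square roots, so the quadratic sum is the Gauss sum of the
character plus a complete additive sum, which vanishes. The shift by `b` then factors out. -/
theorem sum_jacobiFun_mul_stdAddChar_prime {p : ℕ} [hp : Fact p.Prime] (hodd : Odd p)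
    (b : ZMod p) :
    ∑ a : ZMod p, jacobiFun p a * ZMod.stdAddChar (a * b) =
      jacobiFun p b * (gaussSign p * (Real.sqrt p : ℂ)) := by
  have hp2 : p ≠ 2 := by rintro rfl; exact absurd hodd (by decide)
  have hchar : ringChar (ZMod p) ≠ 2 := by rwa [ZMod.ringChar_zmod_n]
  have hJ : ∀ a : ZMod p, jacobiFun p a = (quadraticChar (ZMod p) a : ℂ) := fun a => by
    rw [jacobiFun, ← jacobiSym.legendreSym.to_jacobiSym, legendreSym]
    simp
  set χ : MulChar (ZMod p) ℂ := (quadraticChar (ZMod p)).ringHomComp (Int.castRingHom ℂ) with hχ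
  have hJχ : ∀ a, jacobiFun p a = χ a := fun a => by rw [hJ]; rfl
  have hχ1 : χ ≠ 1 := by
    intro h
    obtain ⟨a, ha⟩ := quadraticChar_exists_neg_one hchar
    have h1 : χ a = -1 := by rw [← hJχ, hJ, ha]; simp
    have ha0 : IsUnit a := by
      by_contra h0
      rw [MulChar.map_nonunit _ h0] at h1
      norm_num at h1
    rw [h, MulChar.one_apply ha0] at h1
    norm_num at h1
  have hprim := ZMod.isPrimitive_stdAddChar p
  have key : ∑ a : ZMod p, χ a * ZMod.stdAddChar a = gaussSign p * (Real.sqrt p : ℂ) := by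
    rw [← sum_stdAddChar_sq p hodd]
    have h1 : ∑ r : ZMod p, ZMod.stdAddChar (r ^ 2) =
        ∑ a : ZMod p, ((quadraticChar (ZMod p) a + 1 : ℤ) : ℂ) * ZMod.stdAddChar a := by
      rw [← Finset.sum_fiberwise Finset.univ (fun r : ZMod p => r ^ 2)]
      refine Finset.sum_congr rfl fun a _ => ?_
      rw [← quadraticChar_card_sqrts hchar a]
      rw [Finset.sum_congr rfl (g := fun _ => ZMod.stdAddChar a)
        fun r hr => by rw [(Finset.mem_filter.1 hr).2], Finset.sum_const, nsmul_eq_mul]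
      congr 2
      congr 1
      ext r
      simp
    rw [h1]
    push_cast
    simp_rw [add_mul, one_mul]
    rw [Finset.sum_add_distrib]
    have h2 := AddChar.sum_mulShift (1 : ZMod p) hprim
    simp only [mul_one, one_ne_zero, if_false, Nat.cast_zero] at h2
    rw [h2, add_zero]
    rfl
  simp_rw [hJχ]
  by_cases hb : b = 0
  · subst hb
    simp only [mul_zero, AddChar.map_zero_eq_one, mul_one]
    rw [MulChar.sum_eq_zero_of_ne_one hχ1, MulChar.map_zero, zero_mul]
  · have h3 := gaussSum_mulShift χ ZMod.stdAddChar (Units.mk0 b hb)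
    simp only [gaussSum, Units.val_mk0, AddChar.mulShift_apply] at h3
    rw [key] at h3
    have h4 : χ b * χ b = 1 := by
      rw [← hJχ, hJ]
      have := quadraticChar_sq_one hb
      rw [← sq]
      exact_mod_cast this
    rw [← h3, ← mul_assoc, h4, one_mul]
    simp_rw [mul_comm b]

/-- The Gauss sum of the Jacobi symbol to an odd squarefree modulus. -/
theorem sum_jacobiFun_mul_stdAddChar (q : ℕ) [NeZero q] (hodd : Odd q) (hsq : Squarefree q)
    (b : ℤ) :
    ∑ a : ZMod q, jacobiFun q a * ZMod.stdAddChar (a * (b : ZMod q)) =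
      (jacobiSym b q : ℂ) * (gaussSign q * (Real.sqrt q : ℂ)) := by
  have aux : ∀ q : ℕ, Odd q → Squarefree q → ∀ _ : NeZero q, ∀ b : ℤ,
      ∑ a : ZMod q, jacobiFun q a * ZMod.stdAddChar (a * (b : ZMod q)) =
        (jacobiSym b q : ℂ) * (gaussSign q * (Real.sqrt q : ℂ)) := by
    intro q
    induction q using induction_on_primes with
    | zero => intro h; simp at h
    | one =>
      intro _ _ _ b
      have h1 : (Finset.univ : Finset (ZMod 1)) = {0} := rfl
      rw [h1, Finset.sum_singleton]
      simp [jacobiFun, gaussSign]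
    | prime_mul p m hp ih =>
      intro hodd hsq _ b
      have hpF : Fact p.Prime := ⟨hp⟩
      have hop : Odd p := Nat.Odd.of_mul_left hodd
      have hom : Odd m := Nat.Odd.of_mul_right hodd
      have hm : NeZero m := ⟨by rintro rfl; simp at hom⟩
      have hcop : p.Coprime m := Nat.coprime_of_squarefree_mul hsq
      -- Symbol and additive character both factor, at the price of `(m/p)(p/m)`.
      have hterm : ∀ (x : ZMod p) (y : ZMod m),
          jacobiFun (p * m) ((x.val * m + y.val * p : ℕ) : ZMod (p * m)) *
            ZMod.stdAddChar (((x.val * m + y.val * p : ℕ) : ZMod (p * m)) * (b : ZMod (p * m))) =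
          ((jacobiSym m p : ℂ) * (jacobiSym p m : ℂ)) *
            ((jacobiFun p x * ZMod.stdAddChar (x * (b : ZMod p))) *
              (jacobiFun m y * ZMod.stdAddChar (y * (b : ZMod m)))) := by
        intro x y
        have e1 : jacobiFun (p * m) ((x.val * m + y.val * p : ℕ) : ZMod (p * m)) =
            (jacobiSym m p : ℂ) * (jacobiSym p m : ℂ) * (jacobiFun p x * jacobiFun m y) := by
          rw [jacobiFun_natCast, jacobiSym.mul_right, jacobiFun, jacobiFun]
          have a1 : jacobiSym ((x.val * m + y.val * p : ℕ) : ℤ) p =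
              jacobiSym x.val p * jacobiSym m p := by
            rw [← jacobiSym.mul_left]
            refine jacobiSym.mod_left' ?_
            push_cast
            rw [Int.add_mul_emod_self_right]
          have a2 : jacobiSym ((x.val * m + y.val * p : ℕ) : ℤ) m =
              jacobiSym y.val m * jacobiSym p m := by
            rw [← jacobiSym.mul_left]
            refine jacobiSym.mod_left' ?_
            push_cast
            rw [add_comm, Int.add_mul_emod_self_right]
          rw [a1, a2]
          push_cast
          ring
        have e2 : ZMod.stdAddChar (((x.val * m + y.val * p : ℕ) : ZMod (p * m)) *
            (b : ZMod (p * m))) = ZMod.stdAddChar (x * (b : ZMod p)) *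
              ZMod.stdAddChar (y * (b : ZMod m)) := by
          have a1 : x * (b : ZMod p) = ((x.val * b : ℤ) : ZMod p) := by simp
          have a2 : y * (b : ZMod m) = ((y.val * b : ℤ) : ZMod m) := by simp
          have a3 : ((x.val * m + y.val * p : ℕ) : ZMod (p * m)) * (b : ZMod (p * m)) =
            (((x.val * m + y.val * p) * b : ℤ) : ZMod (p * m)) := by push_cast; rfl
          rw [a1, a2, a3, ZMod.stdAddChar_coe, ZMod.stdAddChar_coe, ZMod.stdAddChar_coe,
            ← Complex.exp_add]
          congr 1
          have n1 : (p : ℂ) ≠ 0 := NeZero.ne _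
          have n2 : (m : ℂ) ≠ 0 := NeZero.ne _
          push_cast
          field_simp
        rw [e1, e2]
        ring
      rw [sum_zmod_mul hcop]
      simp_rw [hterm]
      simp_rw [← Finset.mul_sum]
      rw [← Finset.sum_mul, ih hom (hsq.of_mul_right) hm b,
        sum_jacobiFun_mul_stdAddChar_prime hop, jacobiFun_intCast, ← gaussSign_mul hop hom hcop,
        jacobiSym.mul_right]
      push_cast
      rw [Real.sqrt_mul (Nat.cast_nonneg p)]
      push_cast
      ring
  exact aux q hodd hsq _ b

end JacobiGauss

/-! ### The theta series of `χ_d` and its functional equation -/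

section ThetaSeries

open Complex Filter Topology MeasureTheory

/-- The theta series `∑_{n ≥ 1} (n / d) exp (-π n² t / d)`. -/
noncomputable def thetaSeries (d : ℕ) (t : ℝ) : ℝ :=
  ∑' n : ℕ, (jacobiSym n d : ℝ) * Real.exp (-Real.pi * n ^ 2 * (t / d))

theorem abs_jacobiSym_le_one (a : ℤ) (q : ℕ) : |(jacobiSym a q : ℝ)| ≤ 1 := by
  rcases jacobiSym.trichotomy a q with h | h | h <;> simp [h]

theorem summable_exp_neg_pi_sq_nat {t : ℝ} (ht : 0 < t) :
    Summable fun n : ℕ => Real.exp (-Real.pi * n ^ 2 * t) := by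
  have := (summable_exp_neg_pi_sq ht).comp_injective (i := fun n : ℕ => (n : ℤ)) Nat.cast_injective
  simpa [Function.comp_def] using this

theorem summable_thetaSeries {d : ℕ} (hd : 0 < d) {t : ℝ} (ht : 0 < t) :
    Summable fun n : ℕ => (jacobiSym n d : ℝ) * Real.exp (-Real.pi * n ^ 2 * (t / d)) := by
  have hd' : (0 : ℝ) < d := Nat.cast_pos.2 hd
  refine Summable.of_norm_bounded (summable_exp_neg_pi_sq_nat (div_pos ht hd')) fun n => ?_
  rw [norm_mul, Real.norm_eq_abs, Real.norm_eq_abs, Real.abs_exp]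
  exact mul_le_of_le_one_left (Real.exp_pos _).le (abs_jacobiSym_le_one _ _)

theorem jacobiSym_zero_left_of_one_lt {d : ℕ} (hd : 1 < d) : jacobiSym 0 d = 0 :=
  jacobiSym.zero_left hd

theorem jacobiSym_neg_of_one_mod_four {d : ℕ} (hd : d % 4 = 1) (a : ℤ) :
    jacobiSym (-a) d = jacobiSym a d := by
  rw [jacobiSym.neg _ (Nat.odd_iff.2 (by omega)), ZMod.χ₄_nat_one_mod_four hd, one_mul]

/-- `(-1/d) = 1` makes the terms at `n` and `-n` equal, and the term at 0 vanishes because `d > 1`.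
-/
theorem tsum_int_jacobiFun_eq {d : ℕ} [NeZero d] (hd1 : 1 < d) (hd : d % 4 = 1) {t : ℝ}
    (ht : 0 < t) :
    ∑' n : ℤ, jacobiFun d n * cexp (-Real.pi * n ^ 2 * ((t / d : ℝ) : ℂ)) =
      2 * (thetaSeries d t : ℂ) := by
  have h1 : HasSum (fun n : ℕ => jacobiFun d ((n : ℤ) : ZMod d) *
      cexp (-Real.pi * ((n : ℤ) : ℂ) ^ 2 * ((t / d : ℝ) : ℂ))) (thetaSeries d t : ℂ) := by
    have := Complex.hasSum_ofReal.2 (summable_thetaSeries (NeZero.pos d) ht).hasSum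
    refine this.congr_fun ?_
    intro n
    rw [jacobiFun_intCast]
    push_cast
    rfl
  have h2 : HasSum (fun n : ℕ => jacobiFun d ((-(n : ℤ) : ℤ) : ZMod d) *
      cexp (-Real.pi * ((-(n : ℤ) : ℤ) : ℂ) ^ 2 * ((t / d : ℝ) : ℂ))) (thetaSeries d t : ℂ) := by
    refine h1.congr_fun ?_
    intro n
    rw [jacobiFun_intCast, jacobiFun_intCast, jacobiSym_neg_of_one_mod_four hd]
    push_cast
    rw [neg_sq]
  have h3 := (HasSum.of_nat_of_neg (f := fun n : ℤ => jacobiFun d n *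
    cexp (-Real.pi * n ^ 2 * ((t / d : ℝ) : ℂ))) h1 h2).tsum_eq
  rw [h3, jacobiFun_intCast, jacobiSym_zero_left_of_one_lt hd1]
  push_cast
  ring

/-- Poisson summation modulo `d`; for `d ≡ 1 (mod 4)` the Gauss sum is `√d` with sign `+1`, so no
sign appears. -/
theorem thetaSeries_functional_equation {d : ℕ} (hd1 : 1 < d) (hd : d % 4 = 1)
    (hsq : Squarefree d) {t : ℝ} (ht : 0 < t) :
    thetaSeries d t = t ^ (-(1 / 2) : ℝ) * thetaSeries d (1 / t) := by
  have : NeZero d := ⟨by omega⟩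
  have hd' : (0 : ℝ) < d := by positivity
  have hodd : Odd d := Nat.odd_iff.2 (by omega)
  have h1 := tsum_periodic_mul_exp_neg_pi_sq d (z := ((t / d : ℝ) : ℂ))
    (by rw [Complex.ofReal_re]; positivity) (jacobiFun d)
  rw [tsum_int_jacobiFun_eq hd1 hd ht] at h1
  have h2 : ∀ k : ℤ, ∑ r : ZMod d, jacobiFun d r * ZMod.stdAddChar ((k : ZMod d) * r) =
      (Real.sqrt d : ℂ) * jacobiFun d k := fun k => by
    have := sum_jacobiFun_mul_stdAddChar d hodd hsq k
    simp_rw [mul_comm _ (k : ZMod d)] at this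
    rw [this, gaussSign, if_pos hd, one_mul, jacobiFun_intCast, mul_comm]
  have h3 : (1 : ℂ) / (d ^ 2 * ((t / d : ℝ) : ℂ)) = (((1 / t) / d : ℝ) : ℂ) := by
    push_cast
    field_simp
  have h4 : (d : ℂ) ^ 2 * ((t / d : ℝ) : ℂ) = ((d * t : ℝ) : ℂ) := by
    push_cast
    field_simp
  simp_rw [h2, h3, mul_assoc, tsum_mul_left] at h1
  simp_rw [← mul_assoc] at h1
  rw [tsum_int_jacobiFun_eq hd1 hd (by positivity), h4,
    show (1 / 2 : ℂ) = ((1 / 2 : ℝ) : ℂ) by push_cast; ring,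
    ← Complex.ofReal_cpow (by positivity), ← Real.sqrt_eq_rpow, Real.sqrt_mul hd'.le] at h1
  have h5 : 2 * thetaSeries d t =
      1 / (Real.sqrt d * Real.sqrt t) * Real.sqrt d * (2 * thetaSeries d (1 / t)) := by
    exact_mod_cast h1
  have h6 : Real.sqrt d ≠ 0 := (Real.sqrt_pos.2 hd').ne'
  have h7 : Real.sqrt t ≠ 0 := (Real.sqrt_pos.2 ht).ne'
  rw [Real.rpow_neg ht.le, ← Real.sqrt_eq_rpow]
  field_simp at h5 ⊢
  linarith

theorem continuousOn_thetaSeries {d : ℕ} (hd : 0 < d) :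
    ContinuousOn (thetaSeries d) (Set.Ioi 0) := by
  intro t ht
  have ht' : 0 < t := ht
  have hd' : (0 : ℝ) < d := Nat.cast_pos.2 hd
  have h : ContinuousOn (thetaSeries d) (Set.Ioi (t / 2)) := by
    refine continuousOn_tsum (fun n => by fun_prop)
      (summable_exp_neg_pi_sq_nat (t := t / 2 / d) (by positivity)) fun n x hx => ?_
    rw [norm_mul, Real.norm_eq_abs, Real.norm_eq_abs, Real.abs_exp]
    refine (mul_le_of_le_one_left (Real.exp_pos _).le (abs_jacobiSym_le_one _ _)).trans ?_
    refine Real.exp_le_exp.2 ?_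
    have hx' : t / 2 / d ≤ x / d := by
      have : t / 2 < x := hx
      gcongr
    have : 0 ≤ Real.pi * (n : ℝ) ^ 2 := by positivity
    nlinarith
  exact (h.continuousAt (Ioi_mem_nhds (by linarith))).continuousWithinAt

theorem isBigO_thetaSeries {d : ℕ} (hd : 1 < d) :
    thetaSeries d =O[atTop] fun t => Real.exp (-(Real.pi / d / 2) * t) := by
  have hd' : (0 : ℝ) < d := by positivity
  set C := ∑' n : ℕ, Real.exp (-Real.pi * n ^ 2 * (1 / 2 / d)) with hC
  refine Asymptotics.IsBigO.of_bound C ?_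
  filter_upwards [eventually_ge_atTop 1] with t ht
  rw [Real.norm_eq_abs (Real.exp _), Real.abs_exp, hC, ← tsum_mul_right]
  have hs := (summable_exp_neg_pi_sq_nat (t := 1 / 2 / d) (by positivity)).mul_right
    (Real.exp (-(Real.pi / d / 2) * t))
  refine tsum_of_norm_bounded hs.hasSum fun n => ?_
  rw [norm_mul, Real.norm_eq_abs, Real.norm_eq_abs, Real.abs_exp]
  rcases Nat.eq_zero_or_pos n with rfl | hn
  · rw [Nat.cast_zero, jacobiSym_zero_left_of_one_lt hd]
    simp only [Int.cast_zero, abs_zero, zero_mul]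
    positivity
  · refine (mul_le_of_le_one_left (Real.exp_pos _).le (abs_jacobiSym_le_one _ _)).trans ?_
    -- For `n² ≥ 1` and `t ≥ 1` one has `n² t ≥ (n² + t) / 2`, which separates `n` from `t`.
    rw [← Real.exp_add]
    refine Real.exp_le_exp.2 ?_
    have hn1 : (1 : ℝ) ≤ (n : ℝ) ^ 2 := by
      have : (1 : ℝ) ≤ n := by exact_mod_cast hn
      nlinarith
    have h1 : -Real.pi * (n : ℝ) ^ 2 * (t / d) = -(Real.pi / d) * (n ^ 2 * t) := by ring
    have h2 : -Real.pi * (n : ℝ) ^ 2 * (1 / 2 / d) + -(Real.pi / d / 2) * t =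
      -(Real.pi / d) * ((n ^ 2 + t) / 2) := by ring
    rw [h1, h2, neg_mul, neg_mul, neg_le_neg_iff]
    refine mul_le_mul_of_nonneg_left ?_ (by positivity)
    nlinarith [mul_nonneg (sub_nonneg.2 hn1) (sub_nonneg.2 ht)]

/-- The pair of theta series entering the functional equation of `L(s, χ_d)`. -/
noncomputable def thetaFEPair (d : ℕ) (hd1 : 1 < d) (hd : d % 4 = 1) (hsq : Squarefree d) :
    WeakFEPair ℂ where
  f := fun t => (thetaSeries d t : ℂ)
  g := fun t => (thetaSeries d t : ℂ)
  k := 1 / 2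
  ε := 1
  f₀ := 0
  g₀ := 0
  hf_int := (Complex.continuous_ofReal.comp_continuousOn
    (continuousOn_thetaSeries (by omega))).locallyIntegrableOn measurableSet_Ioi
  hg_int := (Complex.continuous_ofReal.comp_continuousOn
    (continuousOn_thetaSeries (by omega))).locallyIntegrableOn measurableSet_Ioi
  hk := by norm_num
  hε := one_ne_zero
  h_feq := fun x hx => by
    have hx' : 0 < x := hx
    rw [thetaSeries_functional_equation hd1 hd hsq hx', one_mul, smul_eq_mul, ← Complex.ofReal_mul,
      ← mul_assoc, ← Real.rpow_add hx']
    norm_num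
  hf_top := fun r => by
    have hd' : (0 : ℝ) < d := by positivity
    simp_rw [sub_zero]
    refine Asymptotics.IsBigO.trans ?_
      (isLittleO_exp_neg_mul_rpow_atTop (a := Real.pi / d / 2) (by positivity) r).isBigO
    exact Complex.isBigO_ofReal_left.2 (isBigO_thetaSeries hd1)
  hg_top := fun r => by
    have hd' : (0 : ℝ) < d := by positivity
    simp_rw [sub_zero]
    refine Asymptotics.IsBigO.trans ?_
      (isLittleO_exp_neg_mul_rpow_atTop (a := Real.pi / d / 2) (by positivity) r).isBigO
    exact Complex.isBigO_ofReal_left.2 (isBigO_thetaSeries hd1)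

end ThetaSeries

/-! ### The central value as a theta integral -/

section CentralValue

open Complex Filter Topology MeasureTheory

theorem isFundamentalDiscriminant_natCast {d : ℕ} (hd : d % 4 = 1) (hsq : Squarefree d) :
    IsFundamentalDiscriminant (d : ℤ) :=
  Or.inl ⟨by omega, Int.squarefree_natCast.2 hsq⟩

theorem hasSum_mellin_thetaSeries {d : ℕ} (hd1 : 1 < d) (hd : d % 4 = 1) (hsq : Squarefree d)
    {s : ℂ} (hs : 1 < s.re) :
    mellin (fun t => (thetaSeries d t : ℂ)) s = (Real.pi : ℂ) ^ (-s) * Gamma s * (d : ℂ) ^ s *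
      quadraticLFunction d (isFundamentalDiscriminant_natCast hd hsq) (2 * s) := by
  have hd' : (0 : ℝ) < d := by positivity
  have hfd := isFundamentalDiscriminant_natCast hd hsq
  have hs0 : 0 < s.re := by linarith
  have h := hasSum_mellin_pi_mul (a := fun n : ℕ => (jacobiSym n d : ℂ))
    (q := fun n : ℕ => (n : ℝ) ^ 2 / d) (F := fun t => (thetaSeries d t : ℂ)) (s := s) ?_ hs0 ?_ ?_
  · rw [← h.tsum_eq, quadraticLFunction]
    have : NeZero (d : ℤ).natAbs := ⟨Int.natAbs_ne_zero.2 hfd.ne_zero⟩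
    rw [DirichletCharacter.LFunction_eq_LSeries _ (by simp; linarith), LSeries, ← tsum_mul_left]
    refine tsum_congr fun n => ?_
    rcases Nat.eq_zero_or_pos n with rfl | hn
    · simp [jacobiSym_zero_left_of_one_lt hd1]
    · have hn' : (0 : ℝ) < n := Nat.cast_pos.2 hn
      have hnc : (n : ℂ) ≠ 0 := Nat.cast_ne_zero.2 hn.ne'
      rw [LSeries.term_of_ne_zero hn.ne', quadraticCharacter_natCast hfd,
        kroneckerSym_of_one_mod_four (by omega), Int.natAbs_natCast]
      have e1 : (((n : ℝ) ^ 2 / d : ℝ) : ℂ) ^ s * (d : ℂ) ^ s = (n : ℂ) ^ (2 * s) := by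
        have e2 := Complex.mul_cpow_ofReal_nonneg (a := (n : ℝ) ^ 2 / d) (b := d)
          (by positivity) hd'.le s
        have e3 := Complex.mul_cpow_ofReal_nonneg (a := (n : ℝ)) (b := n)
          hn'.le hn'.le s
        rw [Complex.ofReal_natCast] at e2
        rw [← e2, two_mul, Complex.cpow_add _ _ hnc]
        rw [Complex.ofReal_natCast] at e3
        rw [← e3]
        congr 1
        have : (d : ℂ) ≠ 0 := by exact_mod_cast hd'.ne'
        push_cast
        field_simp
      rw [← e1]
      have e4 : (((n : ℝ) ^ 2 / d : ℝ) : ℂ) ^ s ≠ 0 := by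
        rw [Ne, Complex.cpow_eq_zero_iff, Complex.ofReal_eq_zero]
        have : (n : ℝ) ^ 2 / d ≠ 0 := by positivity
        simp only [this, false_and, not_false_eq_true]
      have e5 : (d : ℂ) ^ s ≠ 0 := by
        rw [Ne, Complex.cpow_eq_zero_iff]
        have : (d : ℂ) ≠ 0 := by exact_mod_cast hd'.ne'
        simp only [this, false_and, not_false_eq_true]
      field_simp
  · intro n
    rcases Nat.eq_zero_or_pos n with rfl | hn
    · left
      simp [jacobiSym_zero_left_of_one_lt hd1]
    · right
      positivity
  · intro t ht
    have := Complex.hasSum_ofReal.2 (summable_thetaSeries (d := d) (by omega) (t := t) ht).hasSum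
    refine this.congr_fun ?_
    intro n
    push_cast
    congr 2
    ring_nf
  · have h1 : Summable fun n : ℕ => (d : ℝ) ^ s.re * (1 / (n : ℝ) ^ (2 * s.re)) :=
      (Real.summable_one_div_nat_rpow.2 (by linarith)).mul_left _
    refine Summable.of_nonneg_of_le (fun n => by positivity) (fun n => ?_) h1
    rw [Real.div_rpow (by positivity) hd'.le, Real.rpow_mul (Nat.cast_nonneg n), Real.rpow_two,
      div_div_eq_mul_div, mul_one_div]
    refine div_le_div_of_nonneg_right ?_ (by positivity)
    exact mul_le_of_le_one_left (by positivity) (norm_jacobiSym_le_one _ _)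

/-- The Gauss sum formula at frequency 0 gives `∑ (a/d) = 0`, whereas for a trivial character the
sum would count the units. Nontriviality makes `L(s, χ_d)` entire. -/
theorem quadraticCharacter_ne_one {d : ℕ} (hd1 : 1 < d) (hd : d % 4 = 1) (hsq : Squarefree d) :
    quadraticCharacter d (isFundamentalDiscriminant_natCast hd hsq) ≠ 1 := by
  intro h
  have : NeZero d := ⟨by omega⟩
  have hodd : Odd d := Nat.odd_iff.2 (by omega)
  have h1 := sum_jacobiFun_mul_stdAddChar d hodd hsq 0
  rw [jacobiSym_zero_left_of_one_lt hd1] at h1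
  simp only [Int.cast_zero, mul_zero, AddChar.map_zero_eq_one, mul_one, zero_mul] at h1
  have h2 : ∀ a : ZMod d, jacobiFun d a = if a.val.Coprime d then 1 else 0 := fun a => by
    have h3 := quadraticCharacter_natCast (isFundamentalDiscriminant_natCast hd hsq) a.val
    rw [h, kroneckerSym_of_one_mod_four (by omega), Int.natAbs_natCast] at h3
    rw [jacobiFun, ← h3]
    split_ifs with hc
    · exact MulChar.one_apply ((ZMod.isUnit_iff_coprime _ _).2 hc)
    · exact MulChar.map_nonunit _ (mt (ZMod.isUnit_iff_coprime _ _).1 hc)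
  simp_rw [h2] at h1
  rw [Finset.sum_boole, Nat.cast_eq_zero, Finset.card_eq_zero] at h1
  have h4 : ((1 : ℕ) : ZMod d) ∈ (∅ : Finset (ZMod d)) := by
    rw [← h1, Finset.mem_filter]
    refine ⟨Finset.mem_univ _, ?_⟩
    rw [← ZMod.isUnit_iff_coprime, ZMod.natCast_zmod_val]
    simp
  simp at h4

/-- Both sides are entire (`1/Γ` is, and so is the Mellin transform, because neither theta series
has a constant term), and they agree near `s = 2` by termwise integration. -/
theorem mellin_thetaSeries {d : ℕ} (hd1 : 1 < d) (hd : d % 4 = 1) (hsq : Squarefree d) (s : ℂ) :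
    (Gamma s)⁻¹ * ((Real.pi : ℂ) ^ s * (d : ℂ) ^ (-s) *
      mellin (fun t => (thetaSeries d t : ℂ)) s) =
      quadraticLFunction d (isFundamentalDiscriminant_natCast hd hsq) (2 * s) := by
  have hfd := isFundamentalDiscriminant_natCast hd hsq
  have : NeZero (d : ℤ).natAbs := ⟨Int.natAbs_ne_zero.2 hfd.ne_zero⟩
  have hdc : (d : ℂ) ≠ 0 := Nat.cast_ne_zero.2 (by omega)
  have hpi : (Real.pi : ℂ) ≠ 0 := Complex.ofReal_ne_zero.2 Real.pi_ne_zero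
  have hstrong : IsStrongFEPair (thetaFEPair d hd1 hd hsq) := ⟨rfl, rfl⟩
  have hmel : mellin (fun t => (thetaSeries d t : ℂ)) = (thetaFEPair d hd1 hd hsq).Λ :=
    hstrong.Λ_eq.symm
  have hdiff : Differentiable ℂ (mellin (fun t => (thetaSeries d t : ℂ))) := by
    rw [hmel]
    exact fun s => WeakFEPair.differentiableAt_Λ _ (Or.inr rfl) (Or.inr rfl)
  have hA : Differentiable ℂ fun s : ℂ => (Gamma s)⁻¹ * ((Real.pi : ℂ) ^ s * (d : ℂ) ^ (-s) *
      mellin (fun t => (thetaSeries d t : ℂ)) s) := by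
    refine differentiable_one_div_Gamma.mul (Differentiable.mul ?_ hdiff)
    exact (differentiable_id.const_cpow (Or.inl hpi)).mul
      (differentiable_id.neg.const_cpow (Or.inl hdc))
  have hB : Differentiable ℂ fun s : ℂ => quadraticLFunction d hfd (2 * s) := by
    have h1 : Differentiable ℂ (quadraticLFunction d hfd) :=
      DirichletCharacter.differentiable_LFunction (quadraticCharacter_ne_one hd1 hd hsq)
    exact h1.comp (differentiable_id.const_mul 2)
  have h := AnalyticOnNhd.eq_of_eventuallyEq (z₀ := (2 : ℂ))
    (hA.differentiableOn.analyticOnNhd isOpen_univ) (hB.differentiableOn.analyticOnNhd isOpen_univ)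
    ?_
  · exact congrFun h s
  · have ho : IsOpen {z : ℂ | 1 < z.re} := isOpen_lt continuous_const Complex.continuous_re
    filter_upwards [ho.mem_nhds (show (2 : ℂ) ∈ {z : ℂ | 1 < z.re} by simp)] with z hz
    have hz1 : 1 < z.re := hz
    rw [hasSum_mellin_thetaSeries hd1 hd hsq hz1]
    have h1 : Gamma z ≠ 0 := Complex.Gamma_ne_zero_of_re_pos (by linarith)
    have h2 : (Real.pi : ℂ) ^ z ≠ 0 := by rw [Ne, Complex.cpow_eq_zero_iff]; simp [hpi]
    have h3 : (d : ℂ) ^ z ≠ 0 := by rw [Ne, Complex.cpow_eq_zero_iff]; simp [hdc]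
    rw [Complex.cpow_neg, Complex.cpow_neg]
    field_simp

theorem integrableOn_thetaSeries {d : ℕ} (hd1 : 1 < d) (hd : d % 4 = 1) (hsq : Squarefree d) :
    IntegrableOn (fun t : ℝ => t ^ (-(3 / 4) : ℝ) * thetaSeries d t) (Set.Ioi 0) := by
  have hstrong : IsStrongFEPair (thetaFEPair d hd1 hd hsq) := ⟨rfl, rfl⟩
  have h := (hstrong.hasMellin (1 / 4 : ℂ)).1
  have h1 := h.re
  refine (MeasureTheory.integrableOn_congr_fun (fun t ht => ?_) measurableSet_Ioi).1 h1
  have ht' : 0 < t := ht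
  simp only [thetaFEPair, smul_eq_mul]
  rw [show (1 / 4 - 1 : ℂ) = ((-(3 / 4) : ℝ) : ℂ) by push_cast; ring,
    ← Complex.ofReal_cpow ht'.le, ← Complex.ofReal_mul]
  exact Complex.ofReal_re _

/-- The substitution `t ↦ 1/t` carries `(0, 1)` to `(1, ∞)` and, by the functional equation,
preserves `t^(-3/4) θ(t) dt`: the exponent belongs to the centre of symmetry `s = 1/4`. -/
theorem integral_Ioi_zero_thetaSeries {d : ℕ} (hd1 : 1 < d) (hd : d % 4 = 1)
    (hsq : Squarefree d) :
    ∫ t in Set.Ioi (0 : ℝ), t ^ (-(3 / 4) : ℝ) * thetaSeries d t =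
      2 * ∫ t in Set.Ioi (1 : ℝ), t ^ (-(3 / 4) : ℝ) * thetaSeries d t := by
  have hint := integrableOn_thetaSeries hd1 hd hsq
  set G : ℝ → ℝ := fun t => t ^ (-(3 / 4) : ℝ) * thetaSeries d t with hG
  have hsplit : ∫ t in Set.Ioi (0 : ℝ), G t =
      (∫ t in Set.Ioc (0 : ℝ) 1, G t) + ∫ t in Set.Ioi (1 : ℝ), G t := by
    rw [← setIntegral_union (Set.Ioc_disjoint_Ioi le_rfl) measurableSet_Ioi
      (hint.mono_set Set.Ioc_subset_Ioi_self) (hint.mono_set (Set.Ioi_subset_Ioi zero_le_one)),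
      Set.Ioc_union_Ioi_eq_Ioi zero_le_one]
  have h1 : ∫ t in Set.Ioc (0 : ℝ) 1, G t = ∫ t in Set.Ioi (1 : ℝ), G t := by
    have h2 := MeasureTheory.integral_comp_rpow_Ioi ((Set.Ioo (0 : ℝ) 1).indicator G)
      (p := -1) (by norm_num)
    rw [setIntegral_indicator measurableSet_Ioo, Set.inter_eq_right.2 Set.Ioo_subset_Ioi_self,
      ← integral_Ioc_eq_integral_Ioo] at h2
    rw [← h2]
    have h3 : ∫ t in Set.Ioi (1 : ℝ), G t = ∫ t in Set.Ioi (0 : ℝ), (Set.Ioi 1).indicator G t := by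
      rw [setIntegral_indicator measurableSet_Ioi,
        Set.inter_eq_right.2 (Set.Ioi_subset_Ioi zero_le_one)]
    rw [h3]
    refine setIntegral_congr_fun measurableSet_Ioi fun t ht => ?_
    have ht' : 0 < t := ht
    simp only [Real.rpow_neg_one, abs_neg, abs_one, one_mul, smul_eq_mul]
    by_cases h4 : 1 < t
    · rw [Set.indicator_of_mem (show t⁻¹ ∈ Set.Ioo (0 : ℝ) 1 from
        ⟨inv_pos.2 ht', inv_lt_one_of_one_lt₀ h4⟩),
        Set.indicator_of_mem (show t ∈ Set.Ioi (1 : ℝ) from h4)]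
      simp only [hG]
      rw [thetaSeries_functional_equation hd1 hd hsq (inv_pos.2 ht'), one_div t⁻¹, inv_inv,
        Real.inv_rpow ht'.le, Real.inv_rpow ht'.le, ← Real.rpow_neg ht'.le, ← Real.rpow_neg ht'.le,
        ← mul_assoc, ← mul_assoc, ← Real.rpow_add ht', ← Real.rpow_add ht']
      norm_num
    · rw [Set.indicator_of_notMem, Set.indicator_of_notMem, mul_zero]
      · exact h4
      · rintro ⟨_, h5⟩
        exact h4 ((inv_lt_one₀ ht').1 h5)
  rw [hsplit, h1, two_mul]

/-- The central value as an integral of the theta series over `[1, ∞)`. -/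
theorem centralValue_eq_integral {d : ℕ} (hd1 : 1 < d) (hd : d % 4 = 1) (hsq : Squarefree d) :
    Real.Gamma (1 / 4) * (d / Real.pi) ^ (1 / 4 : ℝ) * centralValue d =
      2 * ∫ t in Set.Ioi (1 : ℝ), t ^ (-(3 / 4) : ℝ) * thetaSeries d t := by
  have hfd := isFundamentalDiscriminant_natCast hd hsq
  have hd' : (0 : ℝ) < d := by positivity
  have h := mellin_thetaSeries hd1 hd hsq (1 / 4)
  rw [show (2 : ℂ) * (1 / 4) = 1 / 2 by norm_num, ← ofReal_centralValue hfd] at h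
  have h1 : mellin (fun t => (thetaSeries d t : ℂ)) (1 / 4) =
      ((∫ t in Set.Ioi (0 : ℝ), t ^ (-(3 / 4) : ℝ) * thetaSeries d t : ℝ) : ℂ) := by
    rw [← integral_complex_ofReal, mellin]
    refine setIntegral_congr_fun measurableSet_Ioi fun t ht => ?_
    have ht' : 0 < t := ht
    simp only [smul_eq_mul]
    rw [show (1 / 4 - 1 : ℂ) = ((-(3 / 4) : ℝ) : ℂ) by push_cast; ring,
      ← Complex.ofReal_cpow ht'.le, ← Complex.ofReal_mul]
  rw [h1, integral_Ioi_zero_thetaSeries hd1 hd hsq,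
    show -(1 / 4 : ℂ) = ((-(1 / 4) : ℝ) : ℂ) by push_cast; ring,
    show (1 / 4 : ℂ) = ((1 / 4 : ℝ) : ℂ) by push_cast; ring, Complex.Gamma_ofReal,
    ← Complex.ofReal_cpow Real.pi_pos.le, ← Complex.ofReal_natCast d,
    ← Complex.ofReal_cpow hd'.le] at h
  have h2 : (Real.Gamma (1 / 4))⁻¹ * (Real.pi ^ (1 / 4 : ℝ) * (d : ℝ) ^ (-(1 / 4) : ℝ) *
      (2 * ∫ t in Set.Ioi (1 : ℝ), t ^ (-(3 / 4) : ℝ) * thetaSeries d t)) = centralValue d := by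
    exact_mod_cast h
  rw [← h2, Real.div_rpow hd'.le Real.pi_pos.le, Real.rpow_neg hd'.le]
  have h3 : Real.Gamma (1 / 4) ≠ 0 := (Real.Gamma_pos_of_pos (by norm_num)).ne'
  have h4 : Real.pi ^ (1 / 4 : ℝ) ≠ 0 := (Real.rpow_pos_of_pos Real.pi_pos _).ne'
  have h5 : (d : ℝ) ^ (1 / 4 : ℝ) ≠ 0 := (Real.rpow_pos_of_pos hd' _).ne'
  field_simp

end CentralValue

/-! ### The Pólya–Vinogradov inequality for squarefree modulus -/

section PolyaVinogradov

open Complex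

/-- The norm is `2 |sin (π b / q)|`; Jordan's inequality `sin x ≥ 2x/π` applies to `b` or to `q -
b`, whichever is at most `q / 2`. -/
theorem norm_stdAddChar_sub_one_ge {q : ℕ} [NeZero q] (b : ZMod q) :
    4 * min (b.val : ℝ) (q - b.val) / q ≤ ‖ZMod.stdAddChar b - 1‖ := by
  have hq : (0 : ℝ) < q := Nat.cast_pos.2 (NeZero.pos q)
  have h1 : ZMod.stdAddChar b = cexp (I * ((2 * Real.pi * b.val / q : ℝ) : ℂ)) := by
    conv_lhs => rw [← ZMod.natCast_zmod_val b, ← Int.cast_natCast, ZMod.stdAddChar_coe]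
    congr 1
    push_cast
    ring
  have hv : (b.val : ℝ) ≤ q := by exact_mod_cast (ZMod.val_lt b).le
  rw [h1, Complex.norm_exp_I_mul_ofReal_sub_one, Real.norm_eq_abs]
  rw [show 2 * Real.pi * b.val / q / 2 = Real.pi * b.val / q by ring]
  have key : ∀ x : ℝ, 0 ≤ x → x ≤ q / 2 → 2 * x / q ≤ Real.sin (Real.pi * x / q) := by
    intro x hx hx2
    have := Real.mul_le_sin (x := Real.pi * x / q) (by positivity) (by
      rw [div_le_div_iff₀ hq two_pos]
      nlinarith [Real.pi_pos])
    refine le_trans (le_of_eq ?_) this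
    field_simp
  rcases le_total (b.val : ℝ) (q / 2) with h | h
  · rw [min_eq_left (by linarith), abs_of_nonneg]
    · have := key _ (Nat.cast_nonneg b.val) h
      calc 4 * (b.val : ℝ) / q = 2 * (2 * b.val / q) := by ring
        _ ≤ _ := by linarith
    · have := key _ (Nat.cast_nonneg b.val) h
      have h0 : 0 ≤ 2 * (b.val : ℝ) / q := by positivity
      linarith
  · rw [min_eq_right (by linarith)]
    have := key (q - b.val) (by linarith) (by linarith)
    rw [show Real.pi * (q - (b.val : ℝ)) / q = Real.pi - Real.pi * b.val / q by field_simp,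
      Real.sin_pi_sub] at this
    have h0 : 0 ≤ 2 * ((q : ℝ) - b.val) / q := div_nonneg (by linarith) hq.le
    rw [abs_of_nonneg (by linarith)]
    calc 4 * ((q : ℝ) - b.val) / q = 2 * (2 * (q - b.val) / q) := by ring
      _ ≤ _ := by linarith

/-- Geometric series. Replacing the reciprocal of the minimum by the sum of both reciprocals makes
the bound easy to sum over `b`. -/
theorem norm_sum_range_stdAddChar_le {q : ℕ} [NeZero q] {b : ZMod q} (hb : b ≠ 0) (H : ℕ) :
    ‖∑ l ∈ Finset.range H, ZMod.stdAddChar (b * (l : ZMod q))‖ ≤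
      q / 2 * (1 / b.val + 1 / (q - b.val)) := by
  have hq : (0 : ℝ) < q := Nat.cast_pos.2 (NeZero.pos q)
  have hb0 : (0 : ℝ) < b.val := by
    exact_mod_cast Nat.pos_of_ne_zero (mt (ZMod.val_eq_zero b).1 hb)
  have hbq : (0 : ℝ) < q - b.val := by
    rw [sub_pos]; exact_mod_cast ZMod.val_lt b
  have h1 := norm_stdAddChar_sub_one_ge b
  have hmin : 0 < min (b.val : ℝ) (q - b.val) := lt_min hb0 hbq
  have hpos : 0 < 4 * min (b.val : ℝ) (q - b.val) / q := by positivity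
  have hne : ZMod.stdAddChar b ≠ 1 := by
    intro h
    rw [h, sub_self, norm_zero] at h1
    linarith
  have h2 : ∀ l : ℕ, ZMod.stdAddChar (b * (l : ZMod q)) = ZMod.stdAddChar b ^ l := fun l => by
    rw [← AddChar.map_nsmul_eq_pow, nsmul_eq_mul, mul_comm]
  simp_rw [h2]
  rw [geom_sum_eq hne, norm_div]
  have h3 : ‖ZMod.stdAddChar b ^ H - 1‖ ≤ 2 := by
    refine (norm_sub_le _ _).trans ?_
    rw [norm_pow, AddChar.norm_apply, one_pow, norm_one]
    norm_num
  calc ‖ZMod.stdAddChar b ^ H - 1‖ / ‖ZMod.stdAddChar b - 1‖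
      ≤ 2 / (4 * min (b.val : ℝ) (q - b.val) / q) := div_le_div₀ zero_le_two h3 hpos h1
    _ = q / 2 * (1 / min (b.val : ℝ) (q - b.val)) := by field_simp; norm_num
    _ ≤ _ := by
      refine mul_le_mul_of_nonneg_left ?_ (by positivity)
      rcases min_choice (b.val : ℝ) (q - b.val) with h | h <;> rw [h]
      · exact le_add_of_nonneg_right (by positivity)
      · exact le_add_of_nonneg_left (by positivity)

theorem sum_inv_val_le {q : ℕ} [NeZero q] :
    ∑ b ∈ Finset.univ.erase (0 : ZMod q), (1 / (b.val : ℝ) + 1 / (q - b.val)) ≤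
      2 * (1 + Real.log q) := by
  have h1 : ∑ b ∈ Finset.univ.erase (0 : ZMod q), (1 / (b.val : ℝ) + 1 / (q - b.val)) =
      2 * ∑ b ∈ Finset.univ.erase (0 : ZMod q), 1 / (b.val : ℝ) := by
    rw [Finset.sum_add_distrib, two_mul]
    congr 1
    refine Finset.sum_bij (fun b _ => -b) (fun b hb => ?_) (fun _ _ _ _ h => neg_injective h)
      (fun b hb => ⟨-b, ?_, neg_neg b⟩) fun b hb => ?_
    · simpa using hb
    · simpa using hb
    · have hb0 : b ≠ 0 := (Finset.mem_erase.1 hb).1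
      rw [ZMod.neg_val, if_neg hb0, Nat.cast_sub (ZMod.val_lt b).le]
  have h2 : ∑ b ∈ Finset.univ.erase (0 : ZMod q), 1 / (b.val : ℝ) ≤ (harmonic q : ℝ) := by
    rw [harmonic_eq_sum_Icc]
    push_cast
    rw [← Finset.sum_image (s := Finset.univ.erase (0 : ZMod q)) (g := fun b => b.val)
      (f := fun n : ℕ => 1 / (n : ℝ)) (fun _ _ _ _ h => ZMod.val_injective q h)]
    simp_rw [one_div]
    refine Finset.sum_le_sum_of_subset_of_nonneg (fun n hn => ?_) fun _ _ _ => by positivity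
    obtain ⟨b, hb, rfl⟩ := Finset.mem_image.1 hn
    rw [Finset.mem_Icc]
    exact ⟨Nat.pos_of_ne_zero (mt (ZMod.val_eq_zero b).1 (Finset.mem_erase.1 hb).1),
      (ZMod.val_lt b).le⟩
  rw [h1]
  have := harmonic_le_one_add_log q
  linarith

/-- The Pólya–Vinogradov inequality for the Jacobi symbol to a squarefree modulus, along an
arithmetic progression. -/
theorem abs_sum_range_jacobiSym_le_of_squarefree {q : ℕ} (hodd : Odd q) (hsq : Squarefree q)
    (hq1 : 1 < q) {u : ℕ} (hu : u.Coprime q) (v : ℤ) (H : ℕ) :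
    |∑ l ∈ Finset.range H, (jacobiSym (u * l + v) q : ℝ)| ≤ Real.sqrt q * (1 + Real.log q) := by
  have : NeZero q := ⟨by omega⟩
  have hq : (0 : ℝ) < q := by positivity
  have hsqrt : 0 < Real.sqrt q := Real.sqrt_pos.2 hq
  have uu : IsUnit (u : ZMod q) := (ZMod.isUnit_iff_coprime u q).2 hu
  -- Gauss sums expand the symbol in additive characters; after exchanging sums, the sum over `l` is
  -- geometric.
  have h1 : (gaussSign q * (Real.sqrt q : ℂ)) *
      ((∑ l ∈ Finset.range H, (jacobiSym (u * l + v) q : ℝ) : ℝ) : ℂ) =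
      ∑ a : ZMod q, jacobiFun q a * ZMod.stdAddChar (a * (v : ZMod q)) *
        ∑ l ∈ Finset.range H, ZMod.stdAddChar (a * (u : ZMod q) * (l : ZMod q)) := by
    push_cast
    rw [Finset.mul_sum]
    simp_rw [Finset.mul_sum]
    rw [Finset.sum_comm]
    refine Finset.sum_congr rfl fun l _ => ?_
    have := sum_jacobiFun_mul_stdAddChar q hodd hsq (u * l + v)
    rw [mul_comm (gaussSign q * _), ← this]
    refine Finset.sum_congr rfl fun a _ => ?_
    rw [mul_assoc, ← AddChar.map_add_eq_mul]
    congr 2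
    push_cast
    ring
  have hnorm : ‖gaussSign q * (Real.sqrt q : ℂ)‖ = Real.sqrt q := by
    rw [norm_mul, Complex.norm_real, Real.norm_eq_abs, abs_of_pos hsqrt, gaussSign]
    split_ifs <;> simp
  have h2 := congrArg norm h1
  rw [norm_mul, hnorm, Complex.norm_real, Real.norm_eq_abs] at h2
  have h3 : ‖∑ a : ZMod q, jacobiFun q a * ZMod.stdAddChar (a * (v : ZMod q)) *
        ∑ l ∈ Finset.range H, ZMod.stdAddChar (a * (u : ZMod q) * (l : ZMod q))‖ ≤ q * (1 + Real.log q) := by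
    have h0 : jacobiFun q 0 = 0 := by
      have := jacobiFun_natCast q 0
      rw [Nat.cast_zero] at this
      rw [this]
      simp [jacobiSym_zero_left_of_one_lt hq1]
    rw [← Finset.add_sum_erase _ _ (Finset.mem_univ (0 : ZMod q)), h0, zero_mul, zero_mul, zero_add]
    refine (norm_sum_le _ _).trans ?_
    have h4 : ∀ a ∈ Finset.univ.erase (0 : ZMod q),
        ‖jacobiFun q a * ZMod.stdAddChar (a * (v : ZMod q)) *
          ∑ l ∈ Finset.range H, ZMod.stdAddChar (a * (u : ZMod q) * (l : ZMod q))‖ ≤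
        q / 2 * (1 / ((a * (u : ZMod q)).val : ℝ) + 1 / (q - (a * (u : ZMod q)).val)) := fun a ha => by
      rw [norm_mul, norm_mul, AddChar.norm_apply, mul_one]
      have hau : a * (u : ZMod q) ≠ 0 := fun h => (Finset.mem_erase.1 ha).1 (by
        rwa [uu.mul_left_eq_zero] at h)
      refine (mul_le_of_le_one_left (norm_nonneg _) (norm_jacobiSym_le_one _ _)).trans ?_
      exact norm_sum_range_stdAddChar_le hau H
    refine (Finset.sum_le_sum h4).trans ?_
    rw [← Finset.mul_sum]
    -- Multiplication by the unit `u` permutes the nonzero residues.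
    have h5 : ∑ a ∈ Finset.univ.erase (0 : ZMod q),
        (1 / ((a * (u : ZMod q)).val : ℝ) + 1 / ((q : ℝ) - (a * (u : ZMod q)).val)) =
        ∑ b ∈ Finset.univ.erase (0 : ZMod q), (1 / (b.val : ℝ) + 1 / ((q : ℝ) - b.val)) := by
      refine Finset.sum_bij (fun a _ => a * (u : ZMod q)) (fun a ha => ?_)
        (fun _ _ _ _ h => uu.mul_right_cancel h) (fun b hb => ?_) fun _ _ => rfl
      · rw [Finset.mem_erase, Ne, uu.mul_left_eq_zero]
        exact ⟨(Finset.mem_erase.1 ha).1, Finset.mem_univ _⟩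
      · obtain ⟨w, hw⟩ := uu
        refine ⟨b * (w⁻¹ : (ZMod q)ˣ), ?_, ?_⟩
        · rw [Finset.mem_erase, Ne, Units.mul_left_eq_zero]
          exact ⟨(Finset.mem_erase.1 hb).1, Finset.mem_univ _⟩
        · rw [← hw, Units.inv_mul_cancel_right]
    rw [h5]
    calc _ ≤ (q : ℝ) / 2 * (2 * (1 + Real.log q)) :=
          mul_le_mul_of_nonneg_left sum_inv_val_le (by positivity)
      _ = _ := by ring
  rw [← h2] at h3
  have h4 : Real.sqrt q * Real.sqrt q = q := Real.mul_self_sqrt hq.le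
  have h5 : (q : ℝ) * (1 + Real.log q) = Real.sqrt q * (Real.sqrt q * (1 + Real.log q)) := by
    rw [← mul_assoc, h4]
  rw [h5] at h3
  exact le_of_mul_le_mul_left h3 hsqrt

end PolyaVinogradov

/-! ### Character sums to nonsquare moduli and over squarefree numbers -/

section CharacterSums

/-- The indices with `p ∣ u l + v` form a progression `l0 + p l'`, along which the value is `p (u l'
+ v')`. The new data do not depend on the summand `f`. -/
theorem sum_range_filter_dvd_linear {p u : ℕ} (hp : 0 < p) (hu : u.Coprime p) (v : ℤ) (H : ℕ) :
    ∃ (v' : ℤ) (H' : ℕ), ∀ f : ℤ → ℝ,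
      ∑ l ∈ (Finset.range H).filter (fun l : ℕ => (p : ℤ) ∣ u * l + v), f (u * l + v) =
        ∑ l ∈ Finset.range H', f (p * (u * l + v')) := by
  have : NeZero p := ⟨hp.ne'⟩
  have uu : IsUnit (u : ZMod p) := (ZMod.isUnit_iff_coprime u p).2 hu
  obtain ⟨w, hw⟩ := uu
  set x : ZMod p := (w⁻¹ : (ZMod p)ˣ) * (-(v : ZMod p)) with hx
  set l0 := x.val with hl0
  have hl0p : l0 < p := ZMod.val_lt x
  have hdvd : ∀ l : ℕ, (p : ℤ) ∣ u * l + v ↔ (l : ZMod p) = x := by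
    intro l
    rw [← ZMod.intCast_zmod_eq_zero_iff_dvd]
    push_cast
    rw [add_eq_zero_iff_eq_neg, ← hw, hx, Units.eq_inv_mul_iff_mul_eq]
  obtain ⟨v', hv'⟩ := (hdvd l0).2 (by rw [hl0, ZMod.natCast_zmod_val])
  -- The number of `l'` with `l0 + p l' < H`, a rounded-up quotient; as `l0 < p`, the subtraction
  -- does not truncate.
  refine ⟨v', (H + p - 1 - l0) / p, fun f => ?_⟩
  symm
  refine Finset.sum_bij (fun l' _ => l0 + p * l') (fun l' hl' => ?_) (fun a _ b _ h => ?_)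
    (fun l hl => ?_) fun l' _ => ?_
  · rw [Finset.mem_filter, Finset.mem_range, hdvd]
    rw [Finset.mem_range, Nat.lt_iff_add_one_le, Nat.le_div_iff_mul_le hp] at hl'
    constructor
    · have : (l' + 1) * p = p * l' + p := by ring
      omega
    · rw [Nat.cast_add, Nat.cast_mul, ZMod.natCast_self, zero_mul, add_zero, hl0,
        ZMod.natCast_zmod_val]
  · exact Nat.eq_of_mul_eq_mul_left hp (Nat.add_left_cancel h)
  · rw [Finset.mem_filter, Finset.mem_range, hdvd] at hl
    have hmod : l % p = l0 := by rw [hl0, ← hl.2, ZMod.val_natCast]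
    have hdm := Nat.div_add_mod l p
    refine ⟨l / p, ?_, ?_⟩
    · rw [Finset.mem_range, Nat.lt_iff_add_one_le, Nat.le_div_iff_mul_le hp]
      have : (l / p + 1) * p = p * (l / p) + p := by ring
      omega
    · omega
  · congr 1
    push_cast
    linear_combination -hv'

theorem jacobiSym_mul_prime_sq (n : ℤ) {m p : ℕ} (hm : m ≠ 0) (hp : p.Prime) :
    jacobiSym n (m * p ^ 2) = jacobiSym n m - if (p : ℤ) ∣ n then jacobiSym n m else 0 := by
  have : NeZero m := ⟨hm⟩
  have : NeZero (p ^ 2) := ⟨pow_ne_zero _ hp.ne_zero⟩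
  have : NeZero p := ⟨hp.ne_zero⟩
  rw [jacobiSym.mul_right, jacobiSym.pow_right]
  have hcop : Int.gcd n p = 1 ↔ ¬ (p : ℤ) ∣ n := by
    rw [Int.gcd_comm, ← Int.isCoprime_iff_gcd_eq_one,
      (Nat.prime_iff_prime_int.1 hp).coprime_iff_not_dvd]
  split_ifs with h
  · rw [jacobiSym.eq_zero_iff_not_coprime.2 (mt hcop.1 (not_not.2 h))]
    simp
  · rw [jacobiSym.sq_one (hcop.2 h)]
    simp

/-- Enlarging the modulus by `p²` only deletes the multiples of `p`, which again form a sum of the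
same kind. Each prime of `s` thus at most doubles the bound, and `2 ≤ p`. -/
theorem abs_sum_range_jacobiSym_mul_sq_le {q : ℕ} (hodd : Odd q) (hsq : Squarefree q)
    (hq1 : 1 < q) (s : ℕ) (hs : s ≠ 0) {u : ℕ} (hu : u.Coprime (q * s)) (v : ℤ) (H : ℕ) :
    |∑ l ∈ Finset.range H, (jacobiSym (u * l + v) (q * s ^ 2) : ℝ)| ≤
      s * (Real.sqrt q * (1 + Real.log q)) := by
  have hlog : 0 ≤ Real.log q := Real.log_natCast_nonneg q
  induction s using induction_on_primes generalizing v H with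
  | zero => exact absurd rfl hs
  | one =>
    simp only [one_pow, mul_one, Nat.cast_one, one_mul] at hu ⊢
    exact abs_sum_range_jacobiSym_le_of_squarefree hodd hsq hq1 hu v H
  | prime_mul p s hp ih =>
    have hs0 : s ≠ 0 := right_ne_zero_of_mul hs
    have hus : u.Coprime (q * s) :=
      Nat.Coprime.coprime_dvd_right ⟨p, by ring⟩ hu
    have hup : u.Coprime p := Nat.Coprime.coprime_dvd_right ⟨q * s, by ring⟩ hu
    have hm : q * s ^ 2 ≠ 0 := mul_ne_zero (by omega) (pow_ne_zero _ hs0)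
    have h1 : ∀ l : ℕ, (jacobiSym (u * l + v) (q * (p * s) ^ 2) : ℝ) =
        jacobiSym (u * l + v) (q * s ^ 2) -
          if (p : ℤ) ∣ u * l + v then (jacobiSym (u * l + v) (q * s ^ 2) : ℝ) else 0 := fun l => by
      rw [show q * (p * s) ^ 2 = q * s ^ 2 * p ^ 2 by ring, jacobiSym_mul_prime_sq _ hm hp]
      push_cast
      rfl
    simp_rw [h1]
    rw [Finset.sum_sub_distrib, ← Finset.sum_filter]
    obtain ⟨v', H', h2⟩ := sum_range_filter_dvd_linear hp.pos hup v H
    rw [h2 fun n => (jacobiSym n (q * s ^ 2) : ℝ)]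
    have h3 : |∑ l ∈ Finset.range H', (jacobiSym (p * (u * l + v')) (q * s ^ 2) : ℝ)| ≤
        s * (Real.sqrt q * (1 + Real.log q)) := by
      simp_rw [jacobiSym.mul_left]
      push_cast
      rw [← Finset.mul_sum, abs_mul]
      exact (mul_le_of_le_one_left (abs_nonneg _) (abs_jacobiSym_le_one _ _)).trans
        (ih hs0 hus v' H')
    refine (abs_sub _ _).trans ((add_le_add (ih hs0 hus v H) h3).trans ?_)
    have hp2 : (2 : ℝ) ≤ p := by exact_mod_cast hp.two_le
    push_cast
    have : 0 ≤ (s : ℝ) * (Real.sqrt q * (1 + Real.log q)) := by positivity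
    nlinarith

/-- The Pólya–Vinogradov inequality for the Jacobi symbol to a nonsquare modulus, along the
progression `1 mod 8`. -/
theorem abs_sum_range_jacobiSym_le {q : ℕ} (hodd : Odd q) (hq : ¬ IsSquare q) (H : ℕ) :
    |∑ l ∈ Finset.range H, (jacobiSym (8 * l + 1 : ℕ) q : ℝ)| ≤
      Real.sqrt q * (1 + Real.log q) := by
  -- With `q = b² a` and `a` squarefree, `a > 1` because `q` is not a square. The factor `b` lost in
  -- passing from `a` to `q` is absorbed by `√q = b √a`.
  obtain ⟨a, b, hab, ha⟩ := Nat.sq_mul_squarefree q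
  have hq0 : q ≠ 0 := by rintro rfl; simp at hodd
  have hb0 : b ≠ 0 := by rintro rfl; simp at hab; exact hq0 hab.symm
  have ha0 : a ≠ 0 := ha.ne_zero
  have ha1 : 1 < a := by
    rcases Nat.lt_or_ge 1 a with h | h
    · exact h
    · exact absurd ⟨b, by rw [← hab, show a = 1 by omega]; ring⟩ hq
  have hao : Odd a := by rw [← hab] at hodd; exact Nat.Odd.of_mul_right hodd
  have h8 : Nat.Coprime 8 (a * b) := by
    have : Odd (a * b) := by
      rw [← hab, Nat.odd_mul, Nat.odd_pow_iff two_ne_zero] at hodd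
      exact hodd.2.mul hodd.1
    exact (Nat.coprime_pow_left_iff (by norm_num) 2 (a * b) (n := 3)).2
      (Nat.coprime_two_left.2 this)
  have h := abs_sum_range_jacobiSym_mul_sq_le hao ha ha1 b hb0 h8 1 H
  rw [show a * b ^ 2 = q by rw [← hab]; ring] at h
  push_cast at h ⊢
  refine h.trans ?_
  have h1 : (b : ℝ) * Real.sqrt a = Real.sqrt q := by
    rw [← hab]; push_cast
    rw [Real.sqrt_mul (by positivity), Real.sqrt_sq (by positivity)]
  rw [← mul_assoc, h1]
  refine mul_le_mul_of_nonneg_left ?_ (Real.sqrt_nonneg _)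
  have : (a : ℝ) ≤ q := by
    exact_mod_cast Nat.le_of_dvd (Nat.pos_of_ne_zero hq0) ⟨b ^ 2, by rw [← hab]; ring⟩
  have := Real.log_le_log (by positivity) this
  linarith

theorem sum_Icc_filter_one_mod_eight {E : Type*} [AddCommMonoid E] (f : ℕ → E) (Z : ℕ) :
    ∑ b ∈ (Finset.Icc 1 Z).filter (fun b => b % 8 = 1), f b =
      ∑ l ∈ Finset.range ((Z + 7) / 8), f (8 * l + 1) := by
  symm
  refine Finset.sum_bij (fun l _ => 8 * l + 1) (fun l hl => ?_) (fun a _ b _ h => by omega)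
    (fun b hb => ⟨b / 8, ?_, ?_⟩) fun _ _ => rfl
  · rw [Finset.mem_range] at hl
    rw [Finset.mem_filter, Finset.mem_Icc]
    omega
  · rw [Finset.mem_filter, Finset.mem_Icc] at hb
    rw [Finset.mem_range]
    omega
  · rw [Finset.mem_filter, Finset.mem_Icc] at hb
    omega

/-- Writing `d = b² m` with `m` squarefree, `a² ∣ d` is equivalent to `a ∣ b`, and the Möbius sum
over the divisors of `b` detects `b = 1`. -/
theorem sum_moebius_filter_sq_dvd {d Y : ℕ} (hd : 0 < d) (hY : d ≤ Y) :
    ∑ a ∈ (Finset.Icc 1 Y).filter (fun a => a ^ 2 ∣ d), ArithmeticFunction.moebius a =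
      if Squarefree d then 1 else 0 := by
  obtain ⟨m, b, hmb, hm⟩ := Nat.sq_mul_squarefree d
  have hb0 : b ≠ 0 := by rintro rfl; simp at hmb; omega
  have h1 : (Finset.Icc 1 Y).filter (fun a => a ^ 2 ∣ d) = b.divisors := by
    ext a
    rw [Finset.mem_filter, Finset.mem_Icc, Nat.mem_divisors]
    constructor
    · rintro ⟨⟨h1, -⟩, h2⟩
      refine ⟨?_, hb0⟩
      rw [← Nat.pow_dvd_pow_iff two_ne_zero]
      rw [← hmb] at h2
      obtain ⟨c, hc⟩ := h2
      by_contra hnot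
      have hg : 0 < Nat.gcd a b := Nat.gcd_pos_of_pos_left _ h1
      obtain ⟨a', b', hcop, ha', hb'⟩ := Nat.exists_coprime a b
      set g := Nat.gcd a b
      have h3 : a' ^ 2 ∣ b' ^ 2 * m := by
        refine ⟨c, ?_⟩
        have : g ^ 2 * (b' ^ 2 * m) = g ^ 2 * (a' ^ 2 * c) := by
          rw [hb', ha'] at hc
          nlinarith [hc]
        exact Nat.eq_of_mul_eq_mul_left (by positivity) this
      have h4 : a' ^ 2 ∣ m := (Nat.Coprime.pow 2 2 hcop).dvd_of_dvd_mul_left h3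
      have h5 : a' = 1 := by
        have := hm a' (by rwa [← sq])
        exact Nat.isUnit_iff.1 this
      rw [h5, one_mul] at ha'
      apply hnot
      rw [Nat.pow_dvd_pow_iff two_ne_zero, ha']
      exact Nat.gcd_dvd_right a b
    · rintro ⟨h1, -⟩
      have h2 : a ^ 2 ∣ d := by rw [← hmb]; exact (pow_dvd_pow_of_dvd h1 2).mul_right m
      have h3 : 1 ≤ a := Nat.pos_of_dvd_of_pos h1 (Nat.pos_of_ne_zero hb0)
      refine ⟨⟨h3, ?_⟩, h2⟩
      have := Nat.le_of_dvd hd h2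
      nlinarith
  rw [h1]
  have h2 := congrArg (fun f : ArithmeticFunction ℤ => f b) ArithmeticFunction.coe_zeta_mul_moebius
  simp only [ArithmeticFunction.coe_zeta_mul_apply, ArithmeticFunction.one_apply] at h2
  rw [h2]
  by_cases hb1 : b = 1
  · rw [if_pos hb1, if_pos]
    rw [← hmb, hb1]
    simpa using hm
  · rw [if_neg hb1, if_neg]
    intro hsq
    refine hb1 (Nat.isUnit_iff.1 (hsq b ⟨m, ?_⟩))
    rw [← hmb]; ring

/-- Pólya–Vinogradov against the trivial count. For odd `a`, `a² ≡ 1 (mod 8)`, so `d / a²` stays in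
the class 1 modulo 8; for even `a` the sum is empty. -/
theorem abs_sum_filter_sq_dvd_le {q : ℕ} (hodd : Odd q) (hq : ¬ IsSquare q) {a : ℕ} (ha : 0 < a)
    (Y : ℕ) :
    |∑ d ∈ (Finset.Icc 1 Y).filter (fun d => d % 8 = 1 ∧ a ^ 2 ∣ d), (jacobiSym d q : ℝ)| ≤
      min (Real.sqrt q * (1 + Real.log q)) (Y / a ^ 2) := by
  have hlog : 0 ≤ Real.log q := Real.log_natCast_nonneg q
  refine le_min ?_ ?_
  · rcases Nat.even_or_odd a with he | ho
    · rw [Finset.sum_eq_zero, abs_zero]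
      · positivity
      · intro d hd
        obtain ⟨-, h1, h2⟩ := Finset.mem_filter.1 hd
        have : 2 ∣ d := ((even_iff_two_dvd.1 he).trans (dvd_pow_self a two_ne_zero)).trans h2
        omega
    · have ha8 : a ^ 2 % 8 = 1 := by
        rw [Nat.pow_mod]
        have : a % 8 = 1 ∨ a % 8 = 3 ∨ a % 8 = 5 ∨ a % 8 = 7 := by
          have := Nat.odd_iff.1 ho
          omega
        rcases this with h | h | h | h <;> rw [h]
      have h1 : ∑ d ∈ (Finset.Icc 1 Y).filter (fun d => d % 8 = 1 ∧ a ^ 2 ∣ d),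
          (jacobiSym d q : ℝ) = ∑ b ∈ (Finset.Icc 1 (Y / a ^ 2)).filter (fun b => b % 8 = 1),
            (jacobiSym ((a ^ 2 * b : ℕ) : ℤ) q : ℝ) := by
        symm
        refine Finset.sum_bij (fun b _ => a ^ 2 * b) (fun b hb => ?_)
          (fun b _ b' _ h => Nat.eq_of_mul_eq_mul_left (by positivity) h) (fun d hd => ?_)
          fun _ _ => rfl
        · rw [Finset.mem_filter, Finset.mem_Icc, Nat.le_div_iff_mul_le (by positivity)] at hb
          rw [Finset.mem_filter, Finset.mem_Icc]
          refine ⟨⟨Nat.mul_pos (by positivity) hb.1.1, by linarith [hb.1.2, mul_comm b (a ^ 2)]⟩,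
            ?_, dvd_mul_right _ _⟩
          rw [Nat.mul_mod, ha8, hb.2]
        · rw [Finset.mem_filter, Finset.mem_Icc] at hd
          obtain ⟨⟨h1, h2⟩, h3, b, rfl⟩ := hd
          refine ⟨b, ?_, rfl⟩
          rw [Finset.mem_filter, Finset.mem_Icc, Nat.le_div_iff_mul_le (by positivity)]
          refine ⟨⟨Nat.pos_of_ne_zero ?_, by linarith [mul_comm b (a ^ 2)]⟩, ?_⟩
          · rintro rfl; simp at h1
          · rw [Nat.mul_mod, ha8] at h3
            omega
      rw [h1]
      push_cast
      simp_rw [jacobiSym.mul_left]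
      push_cast
      rw [← Finset.mul_sum, abs_mul]
      refine (mul_le_of_le_one_left (abs_nonneg _) (abs_jacobiSym_le_one _ _)).trans ?_
      rw [sum_Icc_filter_one_mod_eight (fun b => (jacobiSym (b : ℤ) q : ℝ))]
      exact abs_sum_range_jacobiSym_le hodd hq _
  · refine (Finset.abs_sum_le_sum_abs _ _).trans ?_
    refine (Finset.sum_le_sum fun d _ => abs_jacobiSym_le_one _ _).trans ?_
    rw [Finset.sum_const, nsmul_eq_mul, mul_one]
    have h1 : ((Finset.Icc 1 Y).filter (fun d => d % 8 = 1 ∧ a ^ 2 ∣ d)).card ≤ Y / a ^ 2 := by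
      rw [← Nat.Ioc_filter_dvd_card_eq_div]
      refine Finset.card_le_card fun d hd => ?_
      rw [Finset.mem_filter, Finset.mem_Icc] at hd
      rw [Finset.mem_filter, Finset.mem_Ioc]
      exact ⟨⟨hd.1.1, hd.1.2⟩, hd.2.2⟩
    refine (Nat.cast_le.2 h1).trans ?_
    refine Nat.cast_div_le.trans (le_of_eq ?_)
    push_cast
    rfl

theorem min_le_rpow_mul_rpow {x y θ : ℝ} (hx : 0 ≤ x) (hy : 0 ≤ y) (hθ : 0 < θ) (hθ1 : θ < 1) :
    min x y ≤ x ^ θ * y ^ (1 - θ) := by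
  have hm : 0 ≤ min x y := le_min hx hy
  calc min x y = min x y ^ θ * min x y ^ (1 - θ) := by
        rw [← Real.rpow_add' hm (by simp), add_sub_cancel, Real.rpow_one]
    _ ≤ _ := by
      refine mul_le_mul (Real.rpow_le_rpow hm (min_le_left _ _) hθ.le)
        (Real.rpow_le_rpow hm (min_le_right _ _) (by linarith)) (by positivity) (by positivity)

theorem sqrt_mul_one_add_log_le {q : ℝ} (hq : 1 ≤ q) :
    Real.sqrt q * (1 + Real.log q) ≤ 21 * q ^ (11 / 20 : ℝ) := by
  have h1 := Real.log_le_rpow_div (x := q) (ε := 1 / 20) (by linarith) (by norm_num)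
  have h2 : (1 : ℝ) ≤ q ^ (1 / 20 : ℝ) := Real.one_le_rpow hq (by norm_num)
  have h3 : 1 + Real.log q ≤ 21 * q ^ (1 / 20 : ℝ) := by
    have : q ^ (1 / 20 : ℝ) / (1 / 20) = 20 * q ^ (1 / 20 : ℝ) := by ring
    linarith
  calc Real.sqrt q * (1 + Real.log q) ≤ q ^ (1 / 2 : ℝ) * (21 * q ^ (1 / 20 : ℝ)) := by
        rw [Real.sqrt_eq_rpow]
        exact mul_le_mul_of_nonneg_left h3 (by positivity)
    _ = 21 * (q ^ (1 / 2 : ℝ) * q ^ (1 / 20 : ℝ)) := by ring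
    _ = _ := by rw [← Real.rpow_add (by linarith)]; norm_num

/-- Cancellation in sums of the Jacobi symbol over squarefree numbers congruent to `1 mod 8`. -/
theorem exists_abs_sum_squarefree_jacobiSym_le :
    ∃ C : ℝ, 1 ≤ C ∧ ∀ q : ℕ, Odd q → ¬ IsSquare q → ∀ Y : ℕ,
      |∑ d ∈ (Finset.Icc 1 Y).filter (fun d => d % 8 = 1 ∧ Squarefree d), (jacobiSym d q : ℝ)| ≤
        C * ((Y : ℝ) ^ (7 / 12 : ℝ) * (q : ℝ) ^ (11 / 48 : ℝ)) := by
  have hsum : Summable fun a : ℕ => ((a : ℝ) ^ (7 / 6 : ℝ))⁻¹ :=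
    Real.summable_nat_rpow_inv.2 (by norm_num)
  set S := ∑' a : ℕ, ((a : ℝ) ^ (7 / 6 : ℝ))⁻¹ with hS
  have hS0 : 0 ≤ S := tsum_nonneg fun a => by positivity
  refine ⟨21 * S + 1, by linarith, fun q hodd hq Y => ?_⟩
  have hq1 : (1 : ℝ) ≤ q := by
    have : 0 < q := hodd.pos
    exact_mod_cast this
  set R := Real.sqrt q * (1 + Real.log q) with hR
  have hR0 : 0 ≤ R := by
    have := Real.log_nonneg hq1
    positivity
  have h1 : ∑ d ∈ (Finset.Icc 1 Y).filter (fun d => d % 8 = 1 ∧ Squarefree d),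
      (jacobiSym d q : ℝ) = ∑ a ∈ Finset.Icc 1 Y, (ArithmeticFunction.moebius a : ℝ) *
        ∑ d ∈ (Finset.Icc 1 Y).filter (fun d => d % 8 = 1 ∧ a ^ 2 ∣ d), (jacobiSym d q : ℝ) := by
    simp_rw [Finset.mul_sum, Finset.sum_filter]
    rw [Finset.sum_comm]
    refine Finset.sum_congr rfl fun d hd => ?_
    rw [Finset.mem_Icc] at hd
    by_cases h8 : d % 8 = 1
    · have h2 := congrArg (fun z : ℤ => (z : ℝ)) (sum_moebius_filter_sq_dvd hd.1 hd.2)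
      simp only [h8, true_and]
      rw [Finset.sum_filter] at h2
      push_cast at h2
      have h3 : ∀ a : ℕ, (if a ^ 2 ∣ d then (ArithmeticFunction.moebius a : ℝ) * jacobiSym d q
          else 0) = (if a ^ 2 ∣ d then (ArithmeticFunction.moebius a : ℝ) else 0) *
            jacobiSym d q := fun a => by split_ifs <;> simp
      simp_rw [h3]
      rw [← Finset.sum_mul, h2]
      split_ifs <;> simp
    · simp [h8]
  rw [h1]
  refine (Finset.abs_sum_le_sum_abs _ _).trans ?_
  -- Interpolation with weights 5/12 and 7/12: the trivial bound needs weight above 1/2 for the sum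
  -- over `a` to converge, here as `∑ a^(-7/6)`. The exponent of `q` becomes `(11/20)(5/12) =
  -- 11/48`.
  have h2 : ∀ a ∈ Finset.Icc 1 Y, |(ArithmeticFunction.moebius a : ℝ) *
      ∑ d ∈ (Finset.Icc 1 Y).filter (fun d => d % 8 = 1 ∧ a ^ 2 ∣ d), (jacobiSym d q : ℝ)| ≤
      R ^ (5 / 12 : ℝ) * (Y : ℝ) ^ (7 / 12 : ℝ) * ((a : ℝ) ^ (7 / 6 : ℝ))⁻¹ := fun a ha => by
    have ha1 : 0 < a := (Finset.mem_Icc.1 ha).1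
    have ha' : (0 : ℝ) < a := Nat.cast_pos.2 ha1
    have hμ : |(ArithmeticFunction.moebius a : ℝ)| ≤ 1 := by
      exact_mod_cast ArithmeticFunction.abs_moebius_le_one
    rw [abs_mul]
    refine (mul_le_of_le_one_left (abs_nonneg _) hμ).trans
      ((abs_sum_filter_sq_dvd_le hodd hq ha1 Y).trans ?_)
    refine (min_le_rpow_mul_rpow (θ := 5 / 12) hR0 (by positivity) (by norm_num)
      (by norm_num)).trans (le_of_eq ?_)
    rw [Real.div_rpow (by positivity) (by positivity), ← Real.rpow_natCast_mul ha'.le,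
      mul_assoc]
    norm_num [div_eq_mul_inv]
  refine (Finset.sum_le_sum h2).trans ?_
  rw [← Finset.mul_sum]
  have h3 : ∑ a ∈ Finset.Icc 1 Y, ((a : ℝ) ^ (7 / 6 : ℝ))⁻¹ ≤ S :=
    hsum.sum_le_tsum _ fun a _ => by positivity
  have h4 : R ^ (5 / 12 : ℝ) ≤ 21 * (q : ℝ) ^ (11 / 48 : ℝ) := by
    calc R ^ (5 / 12 : ℝ) ≤ (21 * (q : ℝ) ^ (11 / 20 : ℝ)) ^ (5 / 12 : ℝ) :=
          Real.rpow_le_rpow hR0 (sqrt_mul_one_add_log_le hq1) (by norm_num)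
      _ = 21 ^ (5 / 12 : ℝ) * (q : ℝ) ^ (11 / 48 : ℝ) := by
          rw [Real.mul_rpow (by norm_num) (by positivity), ← Real.rpow_mul (by linarith)]
          norm_num
      _ ≤ _ := by
          refine mul_le_mul_of_nonneg_right ?_ (by positivity)
          calc (21 : ℝ) ^ (5 / 12 : ℝ) ≤ 21 ^ (1 : ℝ) :=
                Real.rpow_le_rpow_of_exponent_le (by norm_num) (by norm_num)
            _ = 21 := Real.rpow_one _
  calc R ^ (5 / 12 : ℝ) * (Y : ℝ) ^ (7 / 12 : ℝ) * ∑ a ∈ Finset.Icc 1 Y, ((a : ℝ) ^ (7 / 6 : ℝ))⁻¹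
      ≤ (21 * (q : ℝ) ^ (11 / 48 : ℝ)) * (Y : ℝ) ^ (7 / 12 : ℝ) * S := by gcongr
    _ = 21 * S * ((Y : ℝ) ^ (7 / 12 : ℝ) * (q : ℝ) ^ (11 / 48 : ℝ)) := by ring
    _ ≤ _ := by
      refine mul_le_mul_of_nonneg_right (by linarith) (by positivity)

end CharacterSums

/-! ### Averages of twisted theta series over discriminants -/

section FirstMoment

open MeasureTheory

/-- The discriminants `d ≡ 1 (mod 8)`, squarefree, with `2 ≤ d ≤ N`. -/
def discs (N : ℕ) : Finset ℕ := (Finset.Icc 2 N).filter fun d => d % 8 = 1 ∧ Squarefree d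

theorem mem_discs {N d : ℕ} : d ∈ discs N ↔ (1 < d ∧ d ≤ N) ∧ d % 8 = 1 ∧ Squarefree d := by
  rw [discs, Finset.mem_filter, Finset.mem_Icc]
  rfl

theorem abs_sum_range_mul_monotone_le {c g : ℕ → ℝ} {N : ℕ} {E : ℝ}
    (hc : ∀ Y ≤ N, |∑ d ∈ Finset.range (Y + 1), c d| ≤ E) (hg : Monotone g) (hg0 : 0 ≤ g 0) :
    |∑ d ∈ Finset.range (N + 1), c d * g d| ≤ 2 * E * g N := by
  have hE : 0 ≤ E := (abs_nonneg _).trans (hc 0 (Nat.zero_le N))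
  have h1 : ∀ M : ℕ, ∑ d ∈ Finset.range (M + 1), c d * g d =
      (∑ d ∈ Finset.range (M + 1), c d) * g M -
        ∑ d ∈ Finset.range M, (∑ e ∈ Finset.range (d + 1), c e) * (g (d + 1) - g d) := by
    intro M
    induction M with
    | zero => simp
    | succ M ih =>
      rw [Finset.sum_range_succ, ih, Finset.sum_range_succ c (M + 1),
        Finset.sum_range_succ (fun d => (∑ e ∈ Finset.range (d + 1), c e) * (g (d + 1) - g d)) M]
      ring
  have h2 : |∑ d ∈ Finset.range N, (∑ e ∈ Finset.range (d + 1), c e) * (g (d + 1) - g d)| ≤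
      E * (g N - g 0) := by
    refine (Finset.abs_sum_le_sum_abs _ _).trans ?_
    rw [← Finset.sum_range_sub, Finset.mul_sum]
    refine Finset.sum_le_sum fun d hd => ?_
    have hgd : 0 ≤ g (d + 1) - g d := sub_nonneg.2 (hg (Nat.le_succ d))
    rw [abs_mul, abs_of_nonneg hgd]
    exact mul_le_mul_of_nonneg_right (hc d (Finset.mem_range.1 hd).le) hgd
  have h3 : |(∑ d ∈ Finset.range (N + 1), c d) * g N| ≤ E * g N := by
    rw [abs_mul, abs_of_nonneg (hg0.trans (hg (Nat.zero_le N)))]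
    exact mul_le_mul_of_nonneg_right (hc N le_rfl) (hg0.trans (hg (Nat.zero_le N)))
  rw [h1]
  refine (abs_sub _ _).trans ((add_le_add h3 h2).trans ?_)
  nlinarith [mul_nonneg hE hg0]

/-- The weight `exp(-y/d)` increases with `d`, so partial summation costs only its value at `N`. -/
theorem exists_abs_sum_discs_jacobiSym_mul_exp_le :
    ∃ C : ℝ, 0 < C ∧ ∀ q : ℕ, Odd q → ¬ IsSquare q → ∀ N : ℕ, ∀ y : ℝ, 0 ≤ y →
      |∑ d ∈ discs N, (jacobiSym d q : ℝ) * Real.exp (-y / d)| ≤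
        C * ((N : ℝ) ^ (7 / 12 : ℝ) * (q : ℝ) ^ (11 / 48 : ℝ)) * Real.exp (-y / N) := by
  obtain ⟨C, hC1, hC⟩ := exists_abs_sum_squarefree_jacobiSym_le
  -- One factor 2 pays for removing `d = 1` from the partial sums, the other for partial summation.
  refine ⟨4 * C, by linarith, fun q hodd hq N y hy => ?_⟩
  rcases Nat.eq_zero_or_pos N with rfl | hN
  · have : discs 0 = ∅ := rfl
    rw [this, Finset.sum_empty, abs_zero]
    positivity
  have hq1 : (1 : ℝ) ≤ q := by
    have : 0 < q := hodd.pos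
    exact_mod_cast this
  have hN1 : (1 : ℝ) ≤ N := by exact_mod_cast hN
  set E := C * ((N : ℝ) ^ (7 / 12 : ℝ) * (q : ℝ) ^ (11 / 48 : ℝ)) with hE
  have hE1 : 1 ≤ E := by
    have h1 : (1 : ℝ) ≤ (N : ℝ) ^ (7 / 12 : ℝ) := Real.one_le_rpow hN1 (by norm_num)
    have h2 : (1 : ℝ) ≤ (q : ℝ) ^ (11 / 48 : ℝ) := Real.one_le_rpow hq1 (by norm_num)
    exact one_le_mul_of_one_le_of_one_le hC1 (one_le_mul_of_one_le_of_one_le h1 h2)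
  set c : ℕ → ℝ := fun d => if 1 < d ∧ d % 8 = 1 ∧ Squarefree d then (jacobiSym d q : ℝ) else 0
    with hc
  -- The value at 0 is overridden: `-y / 0 = 0` would give the weight 1 there and destroy
  -- monotonicity.
  set g : ℕ → ℝ := fun d => if d = 0 then 0 else Real.exp (-y / d) with hg
  have hgm : Monotone g := by
    intro a b hab
    simp only [hg]
    split_ifs with h1 h2 h2
    · exact le_rfl
    · exact (Real.exp_pos _).le
    · omega
    · refine Real.exp_le_exp.2 ?_
      rw [neg_div, neg_div, neg_le_neg_iff]
      have : (0 : ℝ) < a := Nat.cast_pos.2 (Nat.pos_of_ne_zero h1)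
      gcongr
  have hrange : ∀ (Y : ℕ) (f : ℕ → ℝ), ∑ d ∈ Finset.range (Y + 1),
      (if 1 < d ∧ d % 8 = 1 ∧ Squarefree d then f d else 0) = ∑ d ∈ discs Y, f d := by
    intro Y f
    rw [← Finset.sum_filter]
    congr 1
    ext d
    rw [Finset.mem_filter, Finset.mem_range, mem_discs]
    constructor
    · rintro ⟨h1, h2, h3⟩; exact ⟨⟨h2, by omega⟩, h3⟩
    · rintro ⟨⟨h1, h2⟩, h3⟩; exact ⟨by omega, h1, h3⟩
  have hpart : ∀ Y ≤ N, |∑ d ∈ Finset.range (Y + 1), c d| ≤ 2 * E := by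
    intro Y hY
    rw [hrange]
    have h1 : (Finset.Icc 1 Y).filter (fun d => d % 8 = 1 ∧ Squarefree d) ⊆
        insert 1 (discs Y) := by
      intro d hd
      rw [Finset.mem_filter, Finset.mem_Icc] at hd
      rw [Finset.mem_insert, mem_discs]
      by_cases h : d = 1
      · exact Or.inl h
      · exact Or.inr ⟨⟨by omega, hd.1.2⟩, hd.2⟩
    rcases Nat.eq_zero_or_pos Y with rfl | hY0
    · have : discs 0 = ∅ := rfl
      rw [this, Finset.sum_empty, abs_zero]
      linarith
    · have h2 : (Finset.Icc 1 Y).filter (fun d => d % 8 = 1 ∧ Squarefree d) =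
          insert 1 (discs Y) := by
        refine Finset.Subset.antisymm h1 (Finset.insert_subset ?_ fun d hd => ?_)
        · rw [Finset.mem_filter, Finset.mem_Icc]
          exact ⟨⟨le_rfl, hY0⟩, by norm_num, squarefree_one⟩
        · rw [mem_discs] at hd
          rw [Finset.mem_filter, Finset.mem_Icc]
          exact ⟨⟨by omega, hd.1.2⟩, hd.2⟩
      have h3 := hC q hodd hq Y
      rw [h2, Finset.sum_insert (by rw [mem_discs]; simp)] at h3
      have h4 : C * ((Y : ℝ) ^ (7 / 12 : ℝ) * (q : ℝ) ^ (11 / 48 : ℝ)) ≤ E := by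
        rw [hE]
        have : (Y : ℝ) ≤ N := by exact_mod_cast hY
        gcongr
      have h5 := abs_le.1 (h3.trans h4)
      have h6 := abs_le.1 (abs_jacobiSym_le_one ((1 : ℕ) : ℤ) q)
      rw [abs_le]
      constructor <;> linarith [h5.1, h5.2, h6.1, h6.2]
  have h := abs_sum_range_mul_monotone_le hpart hgm (by simp [hg])
  have h1 : ∑ d ∈ Finset.range (N + 1), c d * g d =
      ∑ d ∈ discs N, (jacobiSym d q : ℝ) * Real.exp (-y / d) := by
    simp only [hc, ite_mul, zero_mul]
    rw [hrange N fun d => (jacobiSym d q : ℝ) * g d]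
    refine Finset.sum_congr rfl fun d hd => ?_
    rw [mem_discs] at hd
    simp only [hg]
    rw [if_neg (by omega)]
  have h2 : g N = Real.exp (-y / N) := by
    simp only [hg]
    rw [if_neg (by omega)]
  rw [h1, h2] at h
  refine h.trans (le_of_eq ?_)
  ring

theorem jacobiSym_two_of_one_mod_eight {d : ℕ} (hd : d % 8 = 1) : jacobiSym 2 d = 1 := by
  rw [jacobiSym.at_two (Nat.odd_iff.2 (by omega)), ZMod.χ₈_nat_mod_eight, hd]
  rfl

/-- This is what the class 1 modulo 8 is for: `(2/d) = 1` removes the powers of 2, and reciprocity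
holds without sign. -/
theorem jacobiSym_eq_ordCompl {d : ℕ} (hd : d % 8 = 1) {n : ℕ} (hn : n ≠ 0) :
    jacobiSym n d = jacobiSym d (ordCompl[2] n) := by
  have hodd : Odd (ordCompl[2] n) := by
    rw [← Nat.not_even_iff_odd, even_iff_two_dvd]
    exact Nat.not_dvd_ordCompl Nat.prime_two hn
  conv_lhs => rw [← Nat.ordProj_mul_ordCompl_eq_self n 2]
  rw [Nat.cast_mul, Nat.cast_pow, Nat.cast_ofNat, jacobiSym.mul_left, jacobiSym.pow_left,
    jacobiSym_two_of_one_mod_eight hd, one_pow, one_mul,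
    ← jacobiSym.quadratic_reciprocity_one_mod_four (by omega) hodd]

/-- From `exp(-u) ≤ u^(-5/8)`: the exponent of `n` becomes `11/48 - 5/4 = -49/48`, just summable,
while `7/12 + 5/8 = 29/24` remains below `5/4`. -/
theorem summable_rpow_mul_exp_neg {N : ℕ} (hN : 0 < N) {t : ℝ} (ht : 0 < t) :
    Summable (fun n : ℕ => (n : ℝ) ^ (11 / 48 : ℝ) * Real.exp (-(Real.pi * n ^ 2 * t) / N)) ∧
      ∑' n : ℕ, (n : ℝ) ^ (11 / 48 : ℝ) * Real.exp (-(Real.pi * n ^ 2 * t) / N) ≤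
        (∑' n : ℕ, ((n : ℝ) ^ (49 / 48 : ℝ))⁻¹) * ((N : ℝ) ^ (5 / 8 : ℝ) * t ^ (-(5 / 8) : ℝ)) := by
  have hN' : (0 : ℝ) < N := Nat.cast_pos.2 hN
  have hsum : Summable fun n : ℕ => ((n : ℝ) ^ (49 / 48 : ℝ))⁻¹ :=
    Real.summable_nat_rpow_inv.2 (by norm_num)
  have hexp : ∀ u : ℝ, 0 < u → Real.exp (-u) ≤ u ^ (-(5 / 8) : ℝ) := by
    intro u hu
    rw [Real.exp_neg, Real.rpow_neg hu.le]
    refine inv_anti₀ (by positivity) ?_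
    have h1 : u ^ (5 / 8 : ℝ) ≤ (1 + u) ^ (5 / 8 : ℝ) :=
      Real.rpow_le_rpow hu.le (by linarith) (by norm_num)
    have h2 : (1 + u) ^ (5 / 8 : ℝ) ≤ (1 + u) ^ (1 : ℝ) :=
      Real.rpow_le_rpow_of_exponent_le (by linarith) (by norm_num)
    rw [Real.rpow_one] at h2
    linarith [Real.add_one_le_exp u]
  have hterm : ∀ n : ℕ, (n : ℝ) ^ (11 / 48 : ℝ) * Real.exp (-(Real.pi * n ^ 2 * t) / N) ≤
      ((n : ℝ) ^ (49 / 48 : ℝ))⁻¹ * ((N : ℝ) ^ (5 / 8 : ℝ) * t ^ (-(5 / 8) : ℝ)) := by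
    intro n
    rcases Nat.eq_zero_or_pos n with rfl | hn
    · rw [Nat.cast_zero, Real.zero_rpow (by norm_num), zero_mul]
      positivity
    have hn' : (0 : ℝ) < n := Nat.cast_pos.2 hn
    have h1 : Real.exp (-(Real.pi * n ^ 2 * t) / N) ≤ (n ^ 2 * t / N) ^ (-(5 / 8) : ℝ) := by
      refine le_trans (Real.exp_le_exp.2 ?_) (hexp _ (by positivity))
      rw [neg_div, neg_le_neg_iff]
      refine div_le_div_of_nonneg_right ?_ hN'.le
      have : 0 ≤ (n : ℝ) ^ 2 * t := by positivity
      nlinarith [Real.pi_gt_three]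
    refine (mul_le_mul_of_nonneg_left h1 (by positivity)).trans (le_of_eq ?_)
    rw [Real.div_rpow (by positivity) hN'.le, Real.mul_rpow (by positivity) ht.le,
      ← Real.rpow_natCast_mul hn'.le, Real.rpow_neg hN'.le, div_inv_eq_mul, ← Real.rpow_neg hn'.le]
    rw [show (n : ℝ) ^ (11 / 48 : ℝ) * ((n : ℝ) ^ (((2 : ℕ) : ℝ) * -(5 / 8)) * t ^ (-(5 / 8) : ℝ) *
      (N : ℝ) ^ (5 / 8 : ℝ)) = ((n : ℝ) ^ (11 / 48 : ℝ) * (n : ℝ) ^ (((2 : ℕ) : ℝ) * -(5 / 8))) *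
        ((N : ℝ) ^ (5 / 8 : ℝ) * t ^ (-(5 / 8) : ℝ)) by ring, ← Real.rpow_add hn']
    norm_num
  have hs2 := hsum.mul_right ((N : ℝ) ^ (5 / 8 : ℝ) * t ^ (-(5 / 8) : ℝ))
  have hs1 : Summable (fun n : ℕ => (n : ℝ) ^ (11 / 48 : ℝ) *
      Real.exp (-(Real.pi * n ^ 2 * t) / N)) :=
    Summable.of_nonneg_of_le (fun n => by positivity) hterm hs2
  refine ⟨hs1, ?_⟩
  rw [← tsum_mul_right]
  exact hs1.tsum_le_tsum hterm hs2

/-- Lower bound for the sum of theta series twisted by `(m / d)`: the diagonal terms up to a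
power-saving error. -/
theorem exists_sum_discs_jacobiSym_mul_thetaSeries_ge :
    ∃ C : ℝ, 0 < C ∧ ∀ N : ℕ, ∀ m : ℕ, Odd m → ∀ n₀ : ℕ, ∀ t : ℝ, 0 < t →
      ∑ n ∈ (Finset.Icc 1 n₀).filter (fun n => Odd n ∧ IsSquare (n * m)),
          ∑ d ∈ (discs N).filter (fun d => d.Coprime (n * m)),
            Real.exp (-(Real.pi * n ^ 2 * t) / d) -
        C * ((N : ℝ) ^ (29 / 24 : ℝ) * (m : ℝ) ^ (11 / 48 : ℝ) * t ^ (-(5 / 8) : ℝ)) ≤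
      ∑ d ∈ discs N, (jacobiSym m d : ℝ) * thetaSeries d t := by
  obtain ⟨C, hC0, hC⟩ := exists_abs_sum_discs_jacobiSym_mul_exp_le
  set Z := ∑' n : ℕ, ((n : ℝ) ^ (49 / 48 : ℝ))⁻¹ with hZ
  have hZ0 : 0 ≤ Z := tsum_nonneg fun n => by positivity
  refine ⟨C * (Z + 1), by positivity, fun N m hm n₀ t ht => ?_⟩
  rcases Nat.eq_zero_or_pos N with rfl | hN
  · have : discs 0 = ∅ := rfl
    rw [this]
    simp only [Finset.filter_empty, Finset.sum_empty, Finset.sum_const_zero, zero_sub,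
      Left.neg_nonpos_iff]
    positivity
  have hN' : (0 : ℝ) < N := Nat.cast_pos.2 hN
  have hm0 : m ≠ 0 := hm.pos.ne'
  obtain ⟨hs, hle⟩ := summable_rpow_mul_exp_neg hN ht
  set e : ℕ → ℝ := fun n => (n : ℝ) ^ (11 / 48 : ℝ) * Real.exp (-(Real.pi * n ^ 2 * t) / N)
  set K : ℝ := C * ((N : ℝ) ^ (7 / 12 : ℝ) * (m : ℝ) ^ (11 / 48 : ℝ)) with hK
  have hK0 : 0 ≤ K := by positivity
  set b : ℕ → ℝ := fun n => ∑ d ∈ (discs N).filter (fun d => d.Coprime (n * m)),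
    Real.exp (-(Real.pi * n ^ 2 * t) / d) with hb
  set S := (Finset.Icc 1 n₀).filter (fun n => Odd n ∧ IsSquare (n * m)) with hS
  set a : ℕ → ℝ := fun n => ∑ d ∈ discs N, (jacobiSym ((n * m : ℕ) : ℤ) d : ℝ) *
    Real.exp (-(Real.pi * n ^ 2 * t) / d) with ha
  have hd0 : ∀ d ∈ discs N, 0 < d := fun d hd => by
    have := (mem_discs.1 hd).1.1
    omega
  have hsa : ∀ d ∈ discs N, Summable fun n : ℕ => (jacobiSym ((n * m : ℕ) : ℤ) d : ℝ) *
      Real.exp (-(Real.pi * n ^ 2 * t) / d) := fun d hd => by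
    refine ((summable_thetaSeries (hd0 d hd) ht).mul_left (jacobiSym m d : ℝ)).congr fun n => ?_
    push_cast
    rw [jacobiSym.mul_left]
    push_cast
    rw [show -(Real.pi * (n : ℝ) ^ 2 * t) / d = -Real.pi * n ^ 2 * (t / d) by ring]
    ring
  have hEq : ∑ d ∈ discs N, (jacobiSym m d : ℝ) * thetaSeries d t = ∑' n, a n := by
    simp only [ha]
    rw [Summable.tsum_finsetSum hsa]
    refine Finset.sum_congr rfl fun d hd => ?_
    rw [thetaSeries, ← tsum_mul_left]
    refine tsum_congr fun n => ?_
    push_cast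
    rw [jacobiSym.mul_left]
    push_cast
    rw [show -(Real.pi * (n : ℝ) ^ 2 * t) / d = -Real.pi * n ^ 2 * (t / d) by ring]
    ring
  have hsum_a : Summable a := summable_sum hsa
  have hsum_b : HasSum (fun n => if n ∈ S then b n else 0) (∑ n ∈ S, b n) := by
    have : HasSum (fun n => if n ∈ S then b n else 0) (∑ n ∈ S, if n ∈ S then b n else 0) :=
      hasSum_sum_of_ne_finset_zero fun n hn => if_neg hn
    convert this using 1
    exact Finset.sum_congr rfl fun n hn => (if_pos hn).symm
  -- If the odd part `q` of `n m` is a square, the `n`-th term is nonnegative; it is kept for `n ∈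
  -- S`, where the symbol is 1 on coprime `d`, and otherwise dropped. If `q` is not a square, the
  -- term is part of the error.
  have hpoint : ∀ n, (if n ∈ S then b n else 0) - K * e n ≤ a n := by
    intro n
    have he : 0 ≤ K * e n := by positivity
    rcases Nat.eq_zero_or_pos n with rfl | hn
    · have h1 : (0 : ℕ) ∉ S := by simp [hS]
      rw [if_neg h1]
      have h2 : a 0 = 0 := by
        simp only [ha]
        refine Finset.sum_eq_zero fun d hd => ?_
        rw [Nat.zero_mul, Nat.cast_zero, jacobiSym_zero_left_of_one_lt (mem_discs.1 hd).1.1]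
        simp
      rw [h2]
      linarith
    have hnm : n * m ≠ 0 := Nat.mul_ne_zero hn.ne' hm0
    set q := ordCompl[2] (n * m) with hq
    have hqodd : Odd q := by
      rw [← Nat.not_even_iff_odd, even_iff_two_dvd]
      exact Nat.not_dvd_ordCompl Nat.prime_two hnm
    have ha' : a n = ∑ d ∈ discs N, (jacobiSym d q : ℝ) *
        Real.exp (-(Real.pi * n ^ 2 * t) / d) := by
      simp only [ha]
      refine Finset.sum_congr rfl fun d hd => ?_
      rw [jacobiSym_eq_ordCompl (mem_discs.1 hd).2.1 hnm]
    by_cases hsq : IsSquare q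
    · have hnonneg : ∀ d ∈ discs N, 0 ≤ (jacobiSym d q : ℝ) *
          Real.exp (-(Real.pi * n ^ 2 * t) / d) := fun d _ => by
        obtain ⟨r, hr⟩ := hsq
        have hr0 : r ≠ 0 := by rintro rfl; rw [hr] at hqodd; simp at hqodd
        have : NeZero r := ⟨hr0⟩
        rw [hr, jacobiSym.mul_right]
        push_cast
        exact mul_nonneg (mul_self_nonneg _) (Real.exp_pos _).le
      split_ifs with hnS
      · have h1 : b n ≤ a n := by
          rw [ha']
          simp only [hb]
          have hodd : Odd (n * m) := by
            rw [hS, Finset.mem_filter] at hnS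
            exact hnS.2.1.mul hm
          have hqe : q = n * m := by
            rw [hq, Nat.factorization_eq_zero_of_not_dvd, pow_zero, Nat.div_one]
            rw [← even_iff_two_dvd]
            exact Nat.not_even_iff_odd.2 hodd
          rw [Finset.sum_filter]
          refine Finset.sum_le_sum fun d hd => ?_
          split_ifs with hcop
          · have h2 : jacobiSym d q = 1 := by
              obtain ⟨r, hr⟩ := hsq
              have hr0 : r ≠ 0 := by rintro rfl; rw [hr] at hqodd; simp at hqodd
              have : NeZero r := ⟨hr0⟩
              rw [hr, jacobiSym.mul_right, ← sq]
              refine jacobiSym.sq_one ?_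
              rw [← hqe, hr] at hcop
              simpa [Int.gcd] using Nat.Coprime.coprime_mul_right_right hcop
            rw [h2]
            simp
          · exact hnonneg d hd
        linarith
      · have : 0 ≤ a n := by rw [ha']; exact Finset.sum_nonneg hnonneg
        linarith
    · have hnS : n ∉ S := by
        intro h
        rw [hS, Finset.mem_filter] at h
        apply hsq
        have hodd : Odd (n * m) := h.2.1.mul hm
        have hqe : q = n * m := by
          rw [hq, Nat.factorization_eq_zero_of_not_dvd, pow_zero, Nat.div_one]
          rw [← even_iff_two_dvd]
          exact Nat.not_even_iff_odd.2 hodd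
        rw [hqe]
        exact h.2.2
      rw [if_neg hnS, zero_sub, ha']
      have h1 := hC q hqodd hsq N (Real.pi * n ^ 2 * t) (by positivity)
      refine (neg_le_neg (h1.trans ?_)).trans (neg_abs_le _)
      have h2 : (q : ℝ) ^ (11 / 48 : ℝ) ≤ (n : ℝ) ^ (11 / 48 : ℝ) * (m : ℝ) ^ (11 / 48 : ℝ) := by
        rw [← Real.mul_rpow (by positivity) (by positivity)]
        refine Real.rpow_le_rpow (by positivity) ?_ (by norm_num)
        have : q ≤ n * m := Nat.div_le_self _ _
        exact_mod_cast this
      calc C * ((N : ℝ) ^ (7 / 12 : ℝ) * (q : ℝ) ^ (11 / 48 : ℝ)) *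
            Real.exp (-(Real.pi * n ^ 2 * t) / N)
          ≤ C * ((N : ℝ) ^ (7 / 12 : ℝ) * ((n : ℝ) ^ (11 / 48 : ℝ) * (m : ℝ) ^ (11 / 48 : ℝ))) *
            Real.exp (-(Real.pi * n ^ 2 * t) / N) := by gcongr
        _ = K * e n := by simp only [hK, e]; ring
  rw [hEq]
  have h1 := (hsum_b.sub (hs.hasSum.mul_left K)).summable.tsum_le_tsum hpoint hsum_a
  rw [(hsum_b.sub (hs.hasSum.mul_left K)).tsum_eq] at h1
  refine le_trans (sub_le_sub_left ?_ _) h1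
  calc K * ∑' n, e n ≤ K * (Z * ((N : ℝ) ^ (5 / 8 : ℝ) * t ^ (-(5 / 8) : ℝ))) :=
        mul_le_mul_of_nonneg_left hle hK0
    _ = C * Z * (((N : ℝ) ^ (7 / 12 : ℝ) * (N : ℝ) ^ (5 / 8 : ℝ)) * (m : ℝ) ^ (11 / 48 : ℝ) *
          t ^ (-(5 / 8) : ℝ)) := by rw [hK]; ring
    _ = C * Z * ((N : ℝ) ^ (29 / 24 : ℝ) * (m : ℝ) ^ (11 / 48 : ℝ) * t ^ (-(5 / 8) : ℝ)) := by
        rw [← Real.rpow_add hN']; norm_num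
    _ ≤ _ := by
        refine mul_le_mul_of_nonneg_right ?_ (by positivity)
        exact mul_le_mul_of_nonneg_left (by linarith) hC0.le

end FirstMoment

/-! ### The twisted first moment of central values -/

section FirstMomentIntegrated

open MeasureTheory

theorem integrableOn_rpow_mul_exp_neg {a : ℝ} (ha : 0 < a) :
    IntegrableOn (fun t : ℝ => t ^ (-(3 / 4) : ℝ) * Real.exp (-a * t)) (Set.Ioi 1) := by
  refine Integrable.mono' (exp_neg_integrableOn_Ioi 1 ha) ?_ ?_
  · refine ContinuousOn.aestronglyMeasurable (fun t ht => ?_) measurableSet_Ioi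
    have ht' : 1 < t := ht
    have : t ≠ 0 ∨ 0 ≤ (-(3 / 4) : ℝ) := Or.inl (by linarith)
    exact ((Real.continuousAt_rpow_const _ _ this).mul (by fun_prop)).continuousWithinAt
  · refine (ae_restrict_iff' measurableSet_Ioi).2 (Filter.Eventually.of_forall fun t ht => ?_)
    have ht' : 1 < t := ht
    have h0 : 0 ≤ t ^ (-(3 / 4) : ℝ) := Real.rpow_nonneg (by linarith) _
    rw [Real.norm_eq_abs, abs_mul, Real.abs_exp, abs_of_nonneg h0]
    exact mul_le_of_le_one_left (Real.exp_pos _).le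
      (Real.rpow_le_one_of_one_le_of_nonpos ht'.le (by norm_num))

/-- On `(1, T]` with `T = d / n²` the integrand is at least `T^(-3/4) e^(-π)`. Since `T ≥ 16`, the
length `T - 1` is at least `15 T / 16`, and `T^(1/4) = d^(1/4) / √n`. -/
theorem integral_rpow_mul_exp_neg_ge {n d : ℕ} (hn : 0 < n) (hnd : 16 * n ^ 2 ≤ d) :
    15 / 16 * Real.exp (-Real.pi) * ((d : ℝ) ^ (1 / 4 : ℝ) / Real.sqrt n) ≤
      ∫ t in Set.Ioi (1 : ℝ), t ^ (-(3 / 4) : ℝ) * Real.exp (-(Real.pi * n ^ 2 / d) * t) := by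
  have hn' : (0 : ℝ) < n := Nat.cast_pos.2 hn
  have hd' : (0 : ℝ) < d := by
    have : 0 < n ^ 2 := by positivity
    exact Nat.cast_pos.2 (by omega)
  set T : ℝ := d / n ^ 2 with hT
  have hT16 : 16 ≤ T := by
    rw [hT, le_div_iff₀ (by positivity)]
    exact_mod_cast hnd
  have hint := integrableOn_rpow_mul_exp_neg (a := Real.pi * n ^ 2 / d)
    (by have := Real.pi_pos; positivity)
  have h1 : ∫ t in Set.Ioc (1 : ℝ) T, t ^ (-(3 / 4) : ℝ) * Real.exp (-(Real.pi * n ^ 2 / d) * t) ≤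
      ∫ t in Set.Ioi (1 : ℝ), t ^ (-(3 / 4) : ℝ) * Real.exp (-(Real.pi * n ^ 2 / d) * t) := by
    refine setIntegral_mono_set hint ?_ (Set.Ioc_subset_Ioi_self).eventuallyLE
    refine (ae_restrict_iff' measurableSet_Ioi).2 (Filter.Eventually.of_forall fun t ht => ?_)
    have ht' : (1 : ℝ) < t := ht
    have : 0 < t := by linarith
    change 0 ≤ _
    positivity
  refine le_trans ?_ h1
  have h2 : T ^ (-(3 / 4) : ℝ) * Real.exp (-Real.pi) * volume.real (Set.Ioc (1 : ℝ) T) ≤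
      ∫ t in Set.Ioc (1 : ℝ) T, t ^ (-(3 / 4) : ℝ) * Real.exp (-(Real.pi * n ^ 2 / d) * t) := by
    refine setIntegral_ge_of_const_le_real measurableSet_Ioc (by simp) (fun t ht => ?_)
      (hint.mono_set Set.Ioc_subset_Ioi_self)
    have ht0 : 0 < t := by linarith [ht.1]
    refine mul_le_mul (Real.rpow_le_rpow_of_nonpos ht0 ht.2 (by norm_num)) ?_
      (Real.exp_pos _).le (by positivity)
    refine Real.exp_le_exp.2 ?_
    have : Real.pi * n ^ 2 / d * t ≤ Real.pi * n ^ 2 / d * T :=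
      mul_le_mul_of_nonneg_left ht.2 (by have := Real.pi_pos; positivity)
    have h3 : Real.pi * n ^ 2 / d * T = Real.pi := by rw [hT]; field_simp
    linarith
  refine le_trans ?_ h2
  rw [Real.volume_real_Ioc_of_le (by linarith)]
  have h4 : (d : ℝ) ^ (1 / 4 : ℝ) / Real.sqrt n = T ^ (-(3 / 4) : ℝ) * T := by
    have hT0 : 0 < T := by linarith
    have e1 : T ^ (-(3 / 4) : ℝ) * T = T ^ (1 / 4 : ℝ) := by
      conv_lhs => rw [← Real.rpow_one T, ← Real.rpow_mul hT0.le, ← Real.rpow_add hT0]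
      norm_num
    rw [e1, hT, Real.div_rpow hd'.le (by positivity), Real.sqrt_eq_rpow,
      ← Real.rpow_natCast_mul hn'.le]
    norm_num
  rw [h4]
  have h5 : 0 < T ^ (-(3 / 4) : ℝ) * Real.exp (-Real.pi) := by positivity
  calc 15 / 16 * Real.exp (-Real.pi) * (T ^ (-(3 / 4) : ℝ) * T)
      = T ^ (-(3 / 4) : ℝ) * Real.exp (-Real.pi) * (15 / 16 * T) := by ring
    _ ≤ _ := mul_le_mul_of_nonneg_left (by linarith) h5.le

/-- Lower bound for the first moment of central values twisted by `(m / d)`. -/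
theorem exists_sum_discs_centralValue_mul_jacobiSym_ge :
    ∃ c C : ℝ, 0 < c ∧ 0 < C ∧ ∀ N : ℕ, ∀ m : ℕ, Odd m → ∀ n₀ : ℕ,
      c * ∑ n ∈ (Finset.Icc 1 n₀).filter (fun n => Odd n ∧ IsSquare (n * m)),
          ∑ d ∈ (discs N).filter (fun d => d.Coprime (n * m) ∧ 16 * n₀ ^ 2 ≤ d),
            (d : ℝ) ^ (1 / 4 : ℝ) / Real.sqrt n -
        C * ((N : ℝ) ^ (29 / 24 : ℝ) * (m : ℝ) ^ (11 / 48 : ℝ)) ≤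
      ∑ d ∈ discs N, (d : ℝ) ^ (1 / 4 : ℝ) * centralValue d * jacobiSym m d := by
  obtain ⟨C, hC0, hC⟩ := exists_sum_discs_jacobiSym_mul_thetaSeries_ge
  set G : ℝ := Real.Gamma (1 / 4) * (1 / Real.pi) ^ (1 / 4 : ℝ) / 2 with hG
  have hG0 : 0 < G := by
    have := Real.Gamma_pos_of_pos (show (0 : ℝ) < 1 / 4 by norm_num)
    positivity
  set κ : ℝ := 15 / 16 * Real.exp (-Real.pi) with hκ
  -- `8/3` is the integral of `t^(-11/8)` over `(1, ∞)`, with `11/8 = 3/4 + 5/8`; `G` is the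
  -- archimedean factor of `centralValue_eq_integral` without `d^(1/4)`, halved.
  refine ⟨κ / G, C * (8 / 3) / G, by positivity, by positivity, fun N m hm n₀ => ?_⟩
  set S := (Finset.Icc 1 n₀).filter (fun n => Odd n ∧ IsSquare (n * m)) with hS
  have hSpos : ∀ n ∈ S, 0 < n := fun n hn => by
    rw [hS, Finset.mem_filter, Finset.mem_Icc] at hn
    exact hn.1.1
  have hSle : ∀ n ∈ S, n ≤ n₀ := fun n hn => by
    rw [hS, Finset.mem_filter, Finset.mem_Icc] at hn
    exact hn.1.2
  have hd1 : ∀ d ∈ discs N, 1 < d ∧ d % 4 = 1 ∧ Squarefree d := fun d hd => by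
    obtain ⟨⟨h1, -⟩, h2, h3⟩ := mem_discs.1 hd
    exact ⟨h1, by omega, h3⟩
  have hd0 : ∀ d ∈ discs N, (0 : ℝ) < d := fun d hd => by
    have := (hd1 d hd).1
    positivity
  have hmain_int : ∀ n ∈ S, ∀ d ∈ discs N, IntegrableOn
      (fun t : ℝ => t ^ (-(3 / 4) : ℝ) * Real.exp (-(Real.pi * n ^ 2 / d) * t)) (Set.Ioi 1) :=
    fun n hn d hd => integrableOn_rpow_mul_exp_neg (by
      have h1 := hd0 d hd
      have h2 : (0 : ℝ) < n := Nat.cast_pos.2 (hSpos n hn)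
      have := Real.pi_pos
      positivity)
  have hcv : ∀ d ∈ discs N, (d : ℝ) ^ (1 / 4 : ℝ) * centralValue d =
      (1 / G) * ∫ t in Set.Ioi (1 : ℝ), t ^ (-(3 / 4) : ℝ) * thetaSeries d t := fun d hd => by
    obtain ⟨h1, h2, h3⟩ := hd1 d hd
    have h4 := centralValue_eq_integral h1 h2 h3
    rw [div_eq_mul_one_div (d : ℝ), Real.mul_rpow (hd0 d hd).le (by positivity)] at h4
    rw [one_div_mul_eq_div, eq_div_iff hG0.ne', hG]
    linarith
  set F1 : ℝ → ℝ := fun t => ∑ n ∈ S, ∑ d ∈ (discs N).filter (fun d => d.Coprime (n * m)),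
    t ^ (-(3 / 4) : ℝ) * Real.exp (-(Real.pi * n ^ 2 / d) * t) with hF1
  set F2 : ℝ → ℝ := fun t => C * ((N : ℝ) ^ (29 / 24 : ℝ) * (m : ℝ) ^ (11 / 48 : ℝ)) *
    t ^ (-(11 / 8) : ℝ) with hF2
  set F3 : ℝ → ℝ := fun t => ∑ d ∈ discs N, (jacobiSym m d : ℝ) *
    (t ^ (-(3 / 4) : ℝ) * thetaSeries d t) with hF3
  have hF1i : IntegrableOn F1 (Set.Ioi 1) :=
    integrable_finsetSum _ fun n hn => integrable_finsetSum _ fun d hd =>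
      hmain_int n hn d (Finset.mem_filter.1 hd).1
  have hF2i : IntegrableOn F2 (Set.Ioi 1) :=
    (integrableOn_Ioi_rpow_of_lt (by norm_num) one_pos).const_mul _
  have hF3i' : ∀ d ∈ discs N, IntegrableOn (fun t : ℝ => (jacobiSym m d : ℝ) *
      (t ^ (-(3 / 4) : ℝ) * thetaSeries d t)) (Set.Ioi 1) := fun d hd => by
    obtain ⟨h1, h2, h3⟩ := hd1 d hd
    exact ((integrableOn_thetaSeries h1 h2 h3).mono_set
      (Set.Ioi_subset_Ioi zero_le_one)).const_mul _
  have hF3i : IntegrableOn F3 (Set.Ioi 1) := integrable_finsetSum _ fun d hd => hF3i' d hd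
  -- The lower bound for the twisted theta sums, integrated against `t^(-3/4)`.
  have hle : ∫ t in Set.Ioi (1 : ℝ), (F1 t - F2 t) ≤ ∫ t in Set.Ioi (1 : ℝ), F3 t := by
    refine setIntegral_mono_on (hF1i.sub hF2i) hF3i measurableSet_Ioi fun t ht => ?_
    have ht0 : 0 < t := lt_trans one_pos ht
    have h1 := mul_le_mul_of_nonneg_left (hC N m hm n₀ t ht0)
      (show 0 ≤ t ^ (-(3 / 4) : ℝ) by positivity)
    have e1 : F1 t - F2 t = t ^ (-(3 / 4) : ℝ) *
        (∑ n ∈ S, ∑ d ∈ (discs N).filter (fun d => d.Coprime (n * m)),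
            Real.exp (-(Real.pi * n ^ 2 * t) / d) -
        C * ((N : ℝ) ^ (29 / 24 : ℝ) * (m : ℝ) ^ (11 / 48 : ℝ) * t ^ (-(5 / 8) : ℝ))) := by
      rw [mul_sub, Finset.mul_sum]
      simp_rw [Finset.mul_sum]
      congr 1
      · refine Finset.sum_congr rfl fun n _ => Finset.sum_congr rfl fun d _ => ?_
        rw [show -(Real.pi * (n : ℝ) ^ 2 / d) * t = -(Real.pi * n ^ 2 * t) / d by ring]
      · rw [hF2, show (-(11 / 8) : ℝ) = -(3 / 4) + -(5 / 8) by norm_num]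
        simp only
        rw [Real.rpow_add ht0]
        ring
    have e2 : F3 t = t ^ (-(3 / 4) : ℝ) *
        ∑ d ∈ discs N, (jacobiSym m d : ℝ) * thetaSeries d t := by
      rw [hF3, Finset.mul_sum]
      refine Finset.sum_congr rfl fun d _ => by ring
    rw [e1, e2]
    exact h1
  rw [integral_sub hF1i hF2i] at hle
  have hI2 : ∫ t in Set.Ioi (1 : ℝ), F2 t =
      C * ((N : ℝ) ^ (29 / 24 : ℝ) * (m : ℝ) ^ (11 / 48 : ℝ)) * (8 / 3) := by
    rw [hF2, integral_const_mul, integral_Ioi_rpow_of_lt (by norm_num) one_pos]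
    norm_num
  have hI3 : ∫ t in Set.Ioi (1 : ℝ), F3 t =
      G * ∑ d ∈ discs N, (d : ℝ) ^ (1 / 4 : ℝ) * centralValue d * jacobiSym m d := by
    rw [hF3, integral_finsetSum _ hF3i', Finset.mul_sum]
    refine Finset.sum_congr rfl fun d hd => ?_
    rw [integral_const_mul, hcv d hd]
    field_simp
  have hI1 : κ * ∑ n ∈ S, ∑ d ∈ (discs N).filter (fun d => d.Coprime (n * m) ∧ 16 * n₀ ^ 2 ≤ d),
      (d : ℝ) ^ (1 / 4 : ℝ) / Real.sqrt n ≤ ∫ t in Set.Ioi (1 : ℝ), F1 t := by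
    rw [hF1, integral_finsetSum _ fun n hn => integrable_finsetSum _ fun d hd =>
      hmain_int n hn d (Finset.mem_filter.1 hd).1, Finset.mul_sum]
    refine Finset.sum_le_sum fun n hn => ?_
    rw [integral_finsetSum _ fun d hd => hmain_int n hn d (Finset.mem_filter.1 hd).1,
      Finset.mul_sum]
    refine (Finset.sum_le_sum fun d hd => ?_).trans
      (Finset.sum_le_sum_of_subset_of_nonneg (s := (discs N).filter
        (fun d => d.Coprime (n * m) ∧ 16 * n₀ ^ 2 ≤ d)) (fun d hd => ?_) fun d hd _ => ?_)
    · rw [Finset.mem_filter] at hd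
      refine integral_rpow_mul_exp_neg_ge (hSpos n hn) (le_trans ?_ hd.2.2)
      exact Nat.mul_le_mul_left _ (Nat.pow_le_pow_left (hSle n hn) 2)
    · rw [Finset.mem_filter] at hd ⊢
      exact ⟨hd.1, hd.2.1⟩
    · refine setIntegral_nonneg measurableSet_Ioi fun t ht => ?_
      have : 0 < t := lt_trans one_pos ht
      positivity
  rw [hI2, hI3] at hle
  rw [div_mul_eq_mul_div, div_mul_eq_mul_div, ← sub_div, div_le_iff₀ hG0, mul_comm _ G]
  linarith

end FirstMomentIntegrated

/-! ### Counting squarefree `d ≡ 1 (mod 8)` coprime to `q` -/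

section CountingDiscriminants

/-- An affine map with unit slope permutes the residues, so the count does not depend on `u` and
`v`; comparison with `u = 1`, `v = 0` identifies it with `φ(q)`. -/
theorem card_range_filter_coprime_linear {q u : ℕ} [NeZero q] (hu : u.Coprime q) (v : ℕ) :
    ((Finset.range q).filter fun h => (u * h + v).Coprime q).card =
      Nat.card {x : ZMod q // IsUnit x} := by
  classical
  have uu : IsUnit (u : ZMod q) := (ZMod.isUnit_iff_coprime u q).2 hu
  rw [Nat.card_eq_fintype_card, Fintype.card_subtype]
  refine Finset.card_bij (fun h _ => ((u * h + v : ℕ) : ZMod q)) (fun h hh => ?_)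
    (fun a ha b hb hab => ?_) fun x hx => ?_
  · rw [Finset.mem_filter] at hh ⊢
    exact ⟨Finset.mem_univ _, (ZMod.isUnit_iff_coprime _ _).2 hh.2⟩
  · rw [Finset.mem_filter, Finset.mem_range] at ha hb
    push_cast at hab
    have h1 := uu.mul_left_cancel (add_right_cancel hab)
    rw [ZMod.natCast_eq_natCast_iff'] at h1
    rwa [Nat.mod_eq_of_lt ha.1, Nat.mod_eq_of_lt hb.1] at h1
  · obtain ⟨w, hw⟩ := uu
    have h1 : ((u * ((w⁻¹ : (ZMod q)ˣ) * (x - v) : ZMod q).val + v : ℕ) : ZMod q) = x := by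
      push_cast
      rw [ZMod.natCast_zmod_val, ← hw, Units.mul_inv_cancel_left, sub_add_cancel]
    refine ⟨((w⁻¹ : (ZMod q)ˣ) * (x - v) : ZMod q).val, ?_, h1⟩
    rw [Finset.mem_filter, Finset.mem_range]
    refine ⟨ZMod.val_lt _, ?_⟩
    rw [← ZMod.isUnit_iff_coprime, h1]
    exact (Finset.mem_filter.1 hx).2

theorem count_coprime_eq_totient {q : ℕ} (hodd : Odd q) :
    Nat.count (fun h => (8 * h + 1).Coprime q) q = q.totient := by
  have : NeZero q := ⟨hodd.pos.ne'⟩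
  rw [Nat.count_eq_card_filter_range, card_range_filter_coprime_linear
    (Nat.Coprime.pow_left 3 (Nat.coprime_two_left.2 hodd)), ← card_range_filter_coprime_linear
    (Nat.coprime_one_left q) 0, Nat.totient_eq_card_coprime]
  simp_rw [one_mul, add_zero, Nat.coprime_comm]

theorem count_coprime_add_mul {q : ℕ} (hodd : Odd q) (j r : ℕ) :
    Nat.count (fun h => (8 * h + 1).Coprime q) (q * j + r) =
      j * q.totient + Nat.count (fun h => (8 * h + 1).Coprime q) r := by
  induction j with
  | zero => simp
  | succ j ih =>
    rw [show q * (j + 1) + r = q + (q * j + r) by ring, Nat.count_add,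
      count_coprime_eq_totient hodd]
    have : (fun h => (8 * (q + h) + 1).Coprime q) = fun h => (8 * h + 1).Coprime q := by
      funext h
      rw [show 8 * (q + h) + 1 = 8 * h + 1 + 8 * q by ring, Nat.coprime_add_mul_right_left]
    simp_rw [this]
    rw [ih]
    ring

/-- The number of `b ≤ Z` with `b ≡ 1 (mod 8)` that are coprime to `q`. -/
def countCoprime (q Z : ℕ) : ℕ :=
  ((Finset.Icc 1 Z).filter fun b => b % 8 = 1 ∧ b.Coprime q).card

theorem abs_countCoprime_sub_le {q : ℕ} (hodd : Odd q) (Z : ℕ) :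
    |(countCoprime q Z : ℝ) - Z * (q.totient / (8 * q))| ≤ 2 * q := by
  have hq : 0 < q := hodd.pos
  have hq' : (0 : ℝ) < q := Nat.cast_pos.2 hq
  have h1 : countCoprime q Z =
      Nat.count (fun h => (8 * h + 1).Coprime q) ((Z + 7) / 8) := by
    rw [countCoprime, Nat.count_eq_card_filter_range, ← Finset.filter_filter, Finset.card_filter,
      Finset.card_filter, sum_Icc_filter_one_mod_eight]
  set H := (Z + 7) / 8 with hH
  have h2 := count_coprime_add_mul hodd (H / q) (H % q)
  rw [Nat.div_add_mod, ← h1] at h2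
  have h3 : Nat.count (fun h => (8 * h + 1).Coprime q) (H % q) ≤ q.totient := by
    rw [← count_coprime_eq_totient hodd]
    exact Nat.count_monotone _ (Nat.mod_lt _ hq).le
  have hφ : q.totient ≤ q := Nat.totient_le q
  have hH1 : (Z : ℝ) / 8 ≤ H := by
    rw [div_le_iff₀ (by norm_num)]
    have : Z ≤ H * 8 := by omega
    exact_mod_cast this
  have hH2 : (H : ℝ) ≤ Z / 8 + 1 := by
    have : H * 8 ≤ Z + 8 := by omega
    have : (H : ℝ) * 8 ≤ Z + 8 := by exact_mod_cast this
    linarith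
  have hd1 : ((H / q : ℕ) : ℝ) ≤ H / q := Nat.cast_div_le
  have hd2 : (H : ℝ) / q ≤ ((H / q : ℕ) : ℝ) + 1 := by
    rw [div_le_iff₀ hq']
    have h4 := Nat.div_add_mod H q
    have h5 := Nat.mod_lt H hq
    have : H ≤ (H / q + 1) * q := by
      rw [add_mul, mul_comm (H / q)]; omega
    exact_mod_cast this
  have hφ' : (q.totient : ℝ) ≤ q := by exact_mod_cast hφ
  have hφ0 : (0 : ℝ) ≤ q.totient := by positivity
  have h3' : (Nat.count (fun h => (8 * h + 1).Coprime q) (H % q) : ℝ) ≤ q.totient := by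
    exact_mod_cast h3
  have hc0 : (0 : ℝ) ≤ Nat.count (fun h => (8 * h + 1).Coprime q) (H % q) := by positivity
  have h2' : (countCoprime q Z : ℝ) = ((H / q : ℕ) : ℝ) * q.totient +
      Nat.count (fun h => (8 * h + 1).Coprime q) (H % q) := by exact_mod_cast h2
  have e1 : (Z : ℝ) * (q.totient / (8 * q)) = Z / 8 / q * q.totient := by
    field_simp
  have l1 : (Z : ℝ) / 8 / q ≤ H / q := div_le_div_of_nonneg_right hH1 hq'.le
  have l2 : (H : ℝ) / q ≤ Z / 8 / q + 1 / q := by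
    rw [← add_div]
    exact div_le_div_of_nonneg_right hH2 hq'.le
  have l3 : 1 / (q : ℝ) ≤ 1 := by
    rw [div_le_one hq']
    exact_mod_cast hq
  rw [h2', e1, abs_le]
  constructor
  · have : ((Z : ℝ) / 8 / q - ((H / q : ℕ) : ℝ)) * q.totient ≤ 1 * q.totient :=
      mul_le_mul_of_nonneg_right (by linarith) hφ0
    nlinarith
  · have : (((H / q : ℕ) : ℝ) - (Z : ℝ) / 8 / q) * q.totient ≤ 1 * q.totient :=
      mul_le_mul_of_nonneg_right (by linarith) hφ0
    nlinarith

/-- Divide by `a² ≡ 1 (mod 8)` and take the difference of two counts. Each count costs `2q`, and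
rounding `M / a²` at most one more `q`. -/
theorem card_filter_sq_dvd_le {q : ℕ} (hodd : Odd q) {a : ℕ} (ha : Odd a) {M N : ℕ} (hMN : M ≤ N) :
    (((Finset.Icc 1 N).filter fun d => d % 8 = 1 ∧ d.Coprime q ∧ M < d ∧ a ^ 2 ∣ d).card : ℝ) ≤
      (N - M) * (q.totient / (8 * q)) / a ^ 2 + 5 * q := by
  have ha0 : 0 < a ^ 2 := pow_pos ha.pos 2
  have hq' : (0 : ℝ) < q := Nat.cast_pos.2 hodd.pos
  have ha8 : a ^ 2 % 8 = 1 := by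
    rw [Nat.pow_mod]
    have : a % 8 = 1 ∨ a % 8 = 3 ∨ a % 8 = 5 ∨ a % 8 = 7 := by
      have := Nat.odd_iff.1 ha
      omega
    rcases this with h | h | h | h <;> rw [h]
  have hdiv : M / a ^ 2 ≤ N / a ^ 2 := Nat.div_le_div_right hMN
  have h1 : ((Finset.Icc 1 N).filter fun d => d % 8 = 1 ∧ d.Coprime q ∧ M < d ∧ a ^ 2 ∣ d).card +
      countCoprime q (M / a ^ 2) ≤ countCoprime q (N / a ^ 2) := by
    rw [countCoprime, countCoprime, ← Finset.card_image_of_injective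
      ((Finset.Icc 1 (M / a ^ 2)).filter fun b => b % 8 = 1 ∧ b.Coprime q)
      (f := fun b => a ^ 2 * b) fun x y h => Nat.eq_of_mul_eq_mul_left ha0 h,
      ← Finset.card_image_of_injective
      ((Finset.Icc 1 (N / a ^ 2)).filter fun b => b % 8 = 1 ∧ b.Coprime q)
      (f := fun b => a ^ 2 * b) fun x y h => Nat.eq_of_mul_eq_mul_left ha0 h,
      ← Finset.card_union_of_disjoint]
    · refine Finset.card_le_card (Finset.union_subset (fun d hd => ?_) (Finset.image_subset_image
        fun b hb => ?_))
      · rw [Finset.mem_filter, Finset.mem_Icc] at hd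
        obtain ⟨⟨h1, h2⟩, h3, h4, h5, b, rfl⟩ := hd
        refine Finset.mem_image.2 ⟨b, ?_, rfl⟩
        rw [Finset.mem_filter, Finset.mem_Icc, Nat.le_div_iff_mul_le ha0]
        refine ⟨⟨Nat.pos_of_ne_zero ?_, by linarith [mul_comm b (a ^ 2)]⟩, ?_,
          Nat.Coprime.coprime_mul_left h4⟩
        · rintro rfl; simp at h1
        · rw [Nat.mul_mod, ha8] at h3
          omega
      · rw [Finset.mem_filter, Finset.mem_Icc] at hb ⊢
        exact ⟨⟨hb.1.1, hb.1.2.trans hdiv⟩, hb.2⟩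
    · rw [Finset.disjoint_left]
      intro d hd hd'
      obtain ⟨b, hb, rfl⟩ := Finset.mem_image.1 hd'
      rw [Finset.mem_filter] at hd hb
      rw [Finset.mem_Icc, Nat.le_div_iff_mul_le ha0] at hb
      have := hd.2.2.2.1
      linarith [hb.1.2, mul_comm b (a ^ 2)]
  have h1' : (((Finset.Icc 1 N).filter
      fun d => d % 8 = 1 ∧ d.Coprime q ∧ M < d ∧ a ^ 2 ∣ d).card : ℝ) +
      countCoprime q (M / a ^ 2) ≤ countCoprime q (N / a ^ 2) := by exact_mod_cast h1
  have h2 := abs_le.1 (abs_countCoprime_sub_le hodd (M / a ^ 2))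
  have h3 := abs_le.1 (abs_countCoprime_sub_le hodd (N / a ^ 2))
  set δ : ℝ := q.totient / (8 * q) with hδ
  have hδ0 : 0 ≤ δ := by positivity
  have hδ1 : δ ≤ 1 := by
    rw [hδ, div_le_one (by positivity)]
    have : (q.totient : ℝ) ≤ q := by exact_mod_cast Nat.totient_le q
    linarith
  have ha' : (0 : ℝ) < (a : ℝ) ^ 2 := by exact_mod_cast ha0
  have h4 : ((N / a ^ 2 : ℕ) : ℝ) ≤ N / (a : ℝ) ^ 2 := by
    refine Nat.cast_div_le.trans (le_of_eq ?_)
    push_cast; rfl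
  have h5 : (M : ℝ) / (a : ℝ) ^ 2 ≤ ((M / a ^ 2 : ℕ) : ℝ) + 1 := by
    rw [div_le_iff₀ ha']
    have h4 := Nat.div_add_mod M (a ^ 2)
    have h5 := Nat.mod_lt M ha0
    have : M ≤ (M / a ^ 2 + 1) * a ^ 2 := by
      rw [add_mul, mul_comm (M / a ^ 2)]; omega
    exact_mod_cast this
  have hq1 : (1 : ℝ) ≤ q := by exact_mod_cast hodd.pos
  have h6 : (((N / a ^ 2 : ℕ) : ℝ) - ((M / a ^ 2 : ℕ) : ℝ)) * δ ≤
      (N / (a : ℝ) ^ 2 - M / (a : ℝ) ^ 2 + 1) * δ :=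
    mul_le_mul_of_nonneg_right (by linarith) hδ0
  have h7 : ((N : ℝ) - M) * δ / (a : ℝ) ^ 2 = (N / (a : ℝ) ^ 2 - M / (a : ℝ) ^ 2) * δ := by
    ring
  rw [h7]
  nlinarith [h2.1, h3.2]

/-- Telescoping against `1 / (4(j+1))`. Hence sieving out the squares of odd numbers from 3 on
removes at most a quarter of the candidates. -/
theorem sum_range_inv_odd_sq_le (J : ℕ) :
    ∑ j ∈ Finset.range J, 1 / ((2 * (j + 1) + 1 : ℕ) : ℝ) ^ 2 ≤ 1 / 4 := by
  have h : ∀ J : ℕ, ∑ j ∈ Finset.range J, 1 / ((2 * (j + 1) + 1 : ℕ) : ℝ) ^ 2 ≤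
      1 / 4 - 1 / (4 * ((J : ℝ) + 1)) := by
    intro J
    induction J with
    | zero => simp
    | succ J ih =>
      rw [Finset.sum_range_succ]
      have h1 : 1 / ((2 * (J + 1) + 1 : ℕ) : ℝ) ^ 2 ≤
          1 / (4 * ((J : ℝ) + 1)) - 1 / (4 * (((J + 1 : ℕ) : ℝ) + 1)) := by
        push_cast
        rw [div_sub_div _ _ (by positivity) (by positivity),
          div_le_div_iff₀ (by positivity) (by positivity)]
        have : (0 : ℝ) ≤ J := Nat.cast_nonneg J
        nlinarith
      linarith
  refine (h J).trans ?_
  have : (0 : ℝ) ≤ 1 / (4 * ((J : ℝ) + 1)) := by positivity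
  linarith

/-- Lower bound for the number of discriminants in `(N / 2, N]` coprime to `q`. -/
theorem card_discs_filter_coprime_ge {q : ℕ} (hodd : Odd q) (N : ℕ) :
    3 / 64 * (N * (q.totient / q : ℝ)) - 20 * (q * (Real.sqrt N + 1)) ≤
      (((discs N).filter fun d => d.Coprime q ∧ N / 2 < d).card : ℝ) := by
  have hq1 : (1 : ℝ) ≤ q := by exact_mod_cast hodd.pos
  have hφ : (q.totient : ℝ) ≤ q := by exact_mod_cast Nat.totient_le q
  have hφ0 : (0 : ℝ) ≤ q.totient := by positivity
  set M := N / 2 with hM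
  have hMN : M ≤ N := Nat.div_le_self _ _
  set δ : ℝ := q.totient / (8 * q) with hδ
  have hδ0 : 0 ≤ δ := by positivity
  have hδ8 : (q.totient : ℝ) / q = 8 * δ := by rw [hδ]; field_simp
  have hδ1 : δ ≤ 1 := by
    rw [hδ, div_le_one (by positivity)]
    linarith
  -- For `N ≥ 2`, `d > N / 2` forces `d > 1` as `discs` requires; for smaller `N` the error term
  -- exceeds the main term.
  rcases Nat.lt_or_ge N 2 with hN | hN
  · have h1 : (N : ℝ) ≤ 1 := by exact_mod_cast (by omega : N ≤ 1)
    have h2 : 0 ≤ Real.sqrt N := Real.sqrt_nonneg _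
    have h3 : (0 : ℝ) ≤ (((discs N).filter fun d => d.Coprime q ∧ M < d).card : ℝ) := by positivity
    have h4 : (0 : ℝ) ≤ N := Nat.cast_nonneg N
    rw [hδ8]
    nlinarith [mul_le_mul h1 hδ1 hδ0 zero_le_one, mul_nonneg (by linarith : (0 : ℝ) ≤ q) h2]
  set J := Nat.sqrt N with hJ
  set A := (Finset.Icc 1 N).filter fun d => d % 8 = 1 ∧ d.Coprime q ∧ M < d with hA
  -- Union bound over odd `a ≥ 3` with `a² ∣ d`. The constant `3/64` is `(3/4)(1/2)(1/8)`: sieve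
  -- loss, half interval, residue class.
  set B : ℕ → Finset ℕ := fun j => (Finset.Icc 1 N).filter
    fun d => d % 8 = 1 ∧ d.Coprime q ∧ M < d ∧ (2 * (j + 1) + 1) ^ 2 ∣ d with hB
  have hcover : A ⊆ ((discs N).filter fun d => d.Coprime q ∧ M < d) ∪
      (Finset.range J).biUnion B := by
    intro d hd
    rw [hA, Finset.mem_filter, Finset.mem_Icc] at hd
    obtain ⟨⟨h1, h2⟩, h3, h4, h5⟩ := hd
    rw [Finset.mem_union]
    by_cases hsq : Squarefree d
    · left
      rw [Finset.mem_filter, mem_discs]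
      exact ⟨⟨⟨by omega, h2⟩, h3, hsq⟩, h4, h5⟩
    · right
      rw [Nat.squarefree_iff_prime_squarefree] at hsq
      push Not at hsq
      obtain ⟨p, hp, hpd⟩ := hsq
      have hp2 : p ≠ 2 := by
        rintro rfl
        have : 2 ∣ d := (dvd_mul_right 2 2).trans hpd
        omega
      have hpo : Odd p := hp.odd_of_ne_two hp2
      have hp3 : 3 ≤ p := by
        have := hp.two_le
        omega
      obtain ⟨i, hi⟩ := hpo
      have hpN : p ≤ J := by
        rw [hJ, Nat.le_sqrt]
        exact (Nat.le_of_dvd (by omega) hpd).trans h2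
      rw [Finset.mem_biUnion]
      refine ⟨i - 1, Finset.mem_range.2 (by omega), ?_⟩
      rw [hB, Finset.mem_filter, Finset.mem_Icc]
      refine ⟨⟨h1, h2⟩, h3, h4, h5, ?_⟩
      rw [show 2 * (i - 1 + 1) + 1 = p by omega, sq]
      exact hpd
  have hcard := (Finset.card_le_card hcover).trans ((Finset.card_union_le _ _).trans
    (Nat.add_le_add_left Finset.card_biUnion_le _))
  have hcard' : (A.card : ℝ) ≤ (((discs N).filter fun d => d.Coprime q ∧ M < d).card : ℝ) +
      ∑ j ∈ Finset.range J, ((B j).card : ℝ) := by exact_mod_cast hcard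
  have hBle : ∀ j, ((B j).card : ℝ) ≤
      (N - M) * δ * (1 / ((2 * (j + 1) + 1 : ℕ) : ℝ) ^ 2) + 5 * q := fun j => by
    refine (card_filter_sq_dvd_le hodd (a := 2 * (j + 1) + 1) ⟨j + 1, rfl⟩ hMN).trans
      (le_of_eq ?_)
    rw [mul_one_div]
  have hBsum : ∑ j ∈ Finset.range J, ((B j).card : ℝ) ≤ (N - M) * δ * (1 / 4) + J * (5 * q) := by
    refine (Finset.sum_le_sum fun j _ => hBle j).trans ?_
    rw [Finset.sum_add_distrib, ← Finset.mul_sum, Finset.sum_const, Finset.card_range,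
      nsmul_eq_mul]
    have : 0 ≤ ((N : ℝ) - M) * δ := mul_nonneg (sub_nonneg.2 (by exact_mod_cast hMN)) hδ0
    have := mul_le_mul_of_nonneg_left (sum_range_inv_odd_sq_le J) this
    linarith
  have hAge : ((N : ℝ) - M) * δ - 4 * q ≤ A.card := by
    have h1 : countCoprime q N ≤ A.card + countCoprime q M := by
      rw [countCoprime, countCoprime]
      refine le_trans (Finset.card_le_card fun d hd => ?_) (Finset.card_union_le _ _)
      rw [Finset.mem_union, hA, Finset.mem_filter, Finset.mem_filter]
      rw [Finset.mem_filter] at hd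
      rcases Nat.lt_or_ge M d with h | h
      · exact Or.inl ⟨hd.1, hd.2.1, hd.2.2, h⟩
      · exact Or.inr ⟨Finset.mem_Icc.2 ⟨(Finset.mem_Icc.1 hd.1).1, h⟩, hd.2⟩
    have h1' : (countCoprime q N : ℝ) ≤ A.card + countCoprime q M := by exact_mod_cast h1
    have h2 := abs_le.1 (abs_countCoprime_sub_le hodd M)
    have h3 := abs_le.1 (abs_countCoprime_sub_le hodd N)
    linarith [h2.2, h3.1]
  have hJle : (J : ℝ) ≤ Real.sqrt N := Real.nat_sqrt_le_real_sqrt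
  have hMle : (M : ℝ) ≤ N / 2 := by
    rw [hM]; exact Nat.cast_div_le
  rw [hδ8]
  have h1 : (N : ℝ) / 2 * δ ≤ (N - M) * δ := mul_le_mul_of_nonneg_right (by linarith) hδ0
  have h2 : (J : ℝ) * (5 * q) ≤ Real.sqrt N * (5 * q) :=
    mul_le_mul_of_nonneg_right hJle (by linarith)
  have h3 : 0 ≤ Real.sqrt N * q := by positivity
  nlinarith

end CountingDiscriminants

/-! ### The divisor functions `τ_k = ζ ^ k` -/

section DivisorFunctions

open ArithmeticFunction
open scoped ArithmeticFunction.zeta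

/-- Compare `v + 1` with `p^(ε v)` prime by prime. Once `p ≥ 2^(1/ε)` the inequality holds with
constant 1; the finitely many smaller primes cost a factor `C₀` each. -/
theorem exists_card_divisors_le {ε : ℝ} (hε : 0 < ε) :
    ∃ C : ℝ, 1 ≤ C ∧ ∀ n : ℕ, n ≠ 0 → (n.divisors.card : ℝ) ≤ C * (n : ℝ) ^ ε := by
  have hl2 : 0 < Real.log 2 := Real.log_pos (by norm_num)
  set C₀ : ℝ := max 1 (1 / (ε * Real.log 2)) with hC₀
  have hC₀1 : 1 ≤ C₀ := le_max_left _ _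
  obtain ⟨P, hP⟩ := exists_nat_ge ((2 : ℝ) ^ (1 / ε))
  refine ⟨C₀ ^ P, one_le_pow₀ hC₀1, fun n hn => ?_⟩
  have hpow : (n : ℝ) ^ ε = ∏ p ∈ n.primeFactors, ((p : ℝ) ^ ε) ^ n.factorization p := by
    conv_lhs => rw [← Nat.prod_factorization_pow_eq_self hn, Finsupp.prod, Nat.support_factorization]
    push_cast
    rw [← Real.finsetProd_rpow _ _ fun p _ => by positivity]
    refine Finset.prod_congr rfl fun p _ => ?_
    rw [← Real.rpow_natCast_mul (by positivity), ← Real.rpow_mul_natCast (by positivity), mul_comm]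
  have hfac : ∀ p ∈ n.primeFactors, ((n.factorization p + 1 : ℕ) : ℝ) ≤
      (if p < P then C₀ else 1) * ((p : ℝ) ^ ε) ^ n.factorization p := by
    intro p hp
    have hp2 : (2 : ℝ) ≤ p := by exact_mod_cast (Nat.prime_of_mem_primeFactors hp).two_le
    set v := n.factorization p
    split_ifs with h
    · have h1 : 1 + ε * Real.log 2 ≤ (p : ℝ) ^ ε := by
        have h2 : (2 : ℝ) ^ ε ≤ (p : ℝ) ^ ε := Real.rpow_le_rpow (by norm_num) hp2 hε.le
        have h3 : (2 : ℝ) ^ ε = Real.exp (Real.log 2 * ε) := Real.rpow_def_of_pos (by norm_num) _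
        have := Real.add_one_le_exp (Real.log 2 * ε)
        linarith
      have h4 : 1 + (v : ℝ) * (ε * Real.log 2) ≤ ((p : ℝ) ^ ε) ^ v :=
        (one_add_mul_le_pow (by nlinarith [mul_pos hε hl2]) v).trans
          (pow_le_pow_left₀ (by positivity) h1 v)
      have h5 : 1 ≤ C₀ * (ε * Real.log 2) := by
        have : 1 / (ε * Real.log 2) ≤ C₀ := le_max_right _ _
        rwa [div_le_iff₀ (by positivity)] at this
      have hv : (0 : ℝ) ≤ v := Nat.cast_nonneg v
      push_cast
      calc (v : ℝ) + 1 ≤ v * (C₀ * (ε * Real.log 2)) + C₀ := by nlinarith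
        _ = C₀ * (1 + (v : ℝ) * (ε * Real.log 2)) := by ring
        _ ≤ _ := mul_le_mul_of_nonneg_left h4 (by linarith)
    · have h1 : (2 : ℝ) ≤ (p : ℝ) ^ ε := by
        have h2 : (2 : ℝ) ^ (1 / ε) ≤ p := hP.trans (by exact_mod_cast not_lt.1 h)
        calc (2 : ℝ) = ((2 : ℝ) ^ (1 / ε)) ^ ε := by
              rw [← Real.rpow_mul (by norm_num), one_div_mul_cancel hε.ne', Real.rpow_one]
          _ ≤ _ := Real.rpow_le_rpow (by positivity) h2 hε.le
      rw [one_mul]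
      have h2 : ((v + 1 : ℕ) : ℝ) ≤ 2 ^ v := by exact_mod_cast (Nat.lt_two_pow_self (n := v))
      exact h2.trans (pow_le_pow_left₀ (by norm_num) h1 v)
  rw [Nat.card_divisors hn, hpow]
  push_cast
  calc ∏ p ∈ n.primeFactors, ((n.factorization p : ℝ) + 1)
      ≤ ∏ p ∈ n.primeFactors, (if p < P then C₀ else 1) * ((p : ℝ) ^ ε) ^ n.factorization p :=
        Finset.prod_le_prod (fun p _ => by positivity) fun p hp => by
          have := hfac p hp
          push_cast at this
          exact this
    _ = (∏ p ∈ n.primeFactors, if p < P then C₀ else 1) *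
          ∏ p ∈ n.primeFactors, ((p : ℝ) ^ ε) ^ n.factorization p := Finset.prod_mul_distrib
    _ ≤ _ := by
      refine mul_le_mul_of_nonneg_right ?_ (Finset.prod_nonneg fun p _ => by positivity)
      rw [Finset.prod_ite, Finset.prod_const, Finset.prod_const_one, mul_one]
      refine pow_le_pow_right₀ hC₀1 ?_
      refine (Finset.card_le_card (t := Finset.range P) fun p hp => ?_).trans
        (Finset.card_range P).le
      exact Finset.mem_range.2 (Finset.mem_filter.1 hp).2

theorem card_finMulAntidiag_eq_zeta_pow (k : ℕ) {n : ℕ} (hn : n ≠ 0) :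
    (Nat.finMulAntidiag k n).card = (ζ ^ k : ArithmeticFunction ℕ) n := by
  induction k generalizing n with
  | zero =>
    rw [pow_zero, one_apply]
    split_ifs with h
    · subst h; rw [Nat.finMulAntidiag_one, Finset.card_singleton]
    · rw [Nat.finMulAntidiag_zero_left h, Finset.card_empty]
  | succ k ih =>
    rw [pow_succ', mul_apply]
    have h1 : ∀ x ∈ n.divisorsAntidiagonal, ζ x.1 * (ζ ^ k : ArithmeticFunction ℕ) x.2 =
        (Nat.finMulAntidiag k x.2).card := fun x hx => by
      rw [Nat.mem_divisorsAntidiagonal] at hx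
      have h1 : x.1 ≠ 0 := left_ne_zero_of_mul (hx.1 ▸ hn)
      have h2 : x.2 ≠ 0 := right_ne_zero_of_mul (hx.1 ▸ hn)
      rw [ih h2, zeta_apply_ne h1, one_mul]
    rw [Finset.sum_congr rfl h1, ← Finset.card_sigma]
    refine (Finset.card_bij (fun y _ => Fin.cons y.1.1 y.2) (fun y hy => ?_) (fun y hy z hz h => ?_)
      fun v hv => ?_).symm
    · rw [Finset.mem_sigma, Nat.mem_divisorsAntidiagonal, Nat.mem_finMulAntidiag] at hy
      rw [Nat.mem_finMulAntidiag, Fin.prod_univ_succ]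
      simp only [Fin.cons_zero, Fin.cons_succ]
      rw [hy.2.1]
      exact ⟨hy.1.1, hn⟩
    · rw [Finset.mem_sigma, Nat.mem_divisorsAntidiagonal, Nat.mem_finMulAntidiag] at hy hz
      obtain ⟨⟨a, b⟩, v⟩ := y
      obtain ⟨⟨a', b'⟩, v'⟩ := z
      obtain ⟨h1, h2⟩ := Fin.cons_injective2 h
      simp only at h1 h2 hy hz
      subst h1 h2
      have : b = b' := by rw [← hy.2.1, ← hz.2.1]
      subst this
      rfl
    · rw [Nat.mem_finMulAntidiag, Fin.prod_univ_succ] at hv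
      refine ⟨⟨(v 0, ∏ i : Fin k, v i.succ), Fin.tail v⟩, ?_, ?_⟩
      · rw [Finset.mem_sigma, Nat.mem_divisorsAntidiagonal, Nat.mem_finMulAntidiag]
        exact ⟨hv, rfl, right_ne_zero_of_mul (hv.1 ▸ hn)⟩
      · exact Fin.cons_self_tail v

theorem zeta_pow_apply_one (k : ℕ) : (ζ ^ k : ArithmeticFunction ℕ) 1 = 1 := by
  rw [← card_finMulAntidiag_eq_zeta_pow k one_ne_zero, Nat.finMulAntidiag_one,
    Finset.card_singleton]

theorem isMultiplicative_zeta_pow (k : ℕ) : (ζ ^ k : ArithmeticFunction ℕ).IsMultiplicative := by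
  induction k with
  | zero => rw [pow_zero]; exact isMultiplicative_one
  | succ k ih => rw [pow_succ]; exact ih.mul isMultiplicative_zeta

theorem zeta_pow_succ_apply (k n : ℕ) : (ζ ^ (k + 1) : ArithmeticFunction ℕ) n =
    ∑ d ∈ n.divisors, (ζ ^ k : ArithmeticFunction ℕ) d := by
  rw [pow_succ, mul_zeta_apply]

theorem zeta_pow_apply_prime (k : ℕ) {p : ℕ} (hp : p.Prime) :
    (ζ ^ k : ArithmeticFunction ℕ) p = k := by
  induction k with
  | zero => rw [pow_zero, one_apply_ne hp.ne_one]
  | succ k ih => rw [zeta_pow_succ_apply, hp.sum_divisors, ih, zeta_pow_apply_one]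

theorem zeta_pow_apply_prime_sq (k : ℕ) {p : ℕ} (hp : p.Prime) :
    (ζ ^ k : ArithmeticFunction ℕ) (p ^ 2) = k * (k + 1) / 2 := by
  induction k with
  | zero => rw [pow_zero, one_apply_ne (by simpa using hp.ne_one), zero_mul, Nat.zero_div]
  | succ k ih =>
    rw [zeta_pow_succ_apply, Nat.sum_divisors_prime_pow hp, Finset.sum_range_succ,
      Finset.sum_range_succ, Finset.sum_range_one, ih, pow_zero, pow_one, zeta_pow_apply_one,
      zeta_pow_apply_prime k hp, show (k + 1) * (k + 1 + 1) = k * (k + 1) + 2 * (k + 1) by ring,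
      Nat.add_mul_div_left _ _ two_pos]
    ring

/-- The source of the exponent `k(k+1)/2`: with that number as `K`, `τ_k(p²) = K = τ_K(p)`, and both
sides are multiplicative. -/
theorem zeta_pow_apply_sq_of_squarefree (k : ℕ) {s : ℕ} (hs : Squarefree s) :
    (ζ ^ k : ArithmeticFunction ℕ) (s ^ 2) = (ζ ^ (k * (k + 1) / 2) : ArithmeticFunction ℕ) s := by
  induction s using induction_on_primes with
  | zero => simp at hs
  | one => rw [one_pow, zeta_pow_apply_one, zeta_pow_apply_one]
  | prime_mul p s hp ih =>
    have hcop : p.Coprime s := Nat.coprime_of_squarefree_mul hs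
    rw [mul_pow, (isMultiplicative_zeta_pow k).map_mul_of_coprime (hcop.pow 2 2),
      (isMultiplicative_zeta_pow _).map_mul_of_coprime hcop, ih (hs.of_mul_right),
      zeta_pow_apply_prime_sq k hp, zeta_pow_apply_prime _ hp]

theorem exists_zeta_pow_apply_le (k : ℕ) {ε : ℝ} (hε : 0 < ε) :
    ∃ C : ℝ, 1 ≤ C ∧ ∀ n : ℕ, n ≠ 0 → ((ζ ^ k : ArithmeticFunction ℕ) n : ℝ) ≤ C * (n : ℝ) ^ ε := by
  obtain ⟨C, hC1, hC⟩ := exists_card_divisors_le (ε := ε / (k + 1)) (by positivity)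
  refine ⟨C ^ k, one_le_pow₀ hC1, fun n hn => ?_⟩
  have hn1 : (1 : ℝ) ≤ n := by exact_mod_cast Nat.pos_of_ne_zero hn
  have h1 : (Nat.finMulAntidiag k n).card ≤ n.divisors.card ^ k := by
    rw [Nat.finMulAntidiag_eq_piFinset_divisors_filter dvd_rfl hn]
    refine (Finset.card_filter_le _ _).trans (le_of_eq ?_)
    rw [Fintype.card_piFinset_const]
  rw [card_finMulAntidiag_eq_zeta_pow k hn] at h1
  calc ((ζ ^ k : ArithmeticFunction ℕ) n : ℝ) ≤ (n.divisors.card : ℝ) ^ k := by exact_mod_cast h1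
    _ ≤ (C * (n : ℝ) ^ (ε / (k + 1))) ^ k := pow_le_pow_left₀ (by positivity) (hC n hn) k
    _ = C ^ k * (n : ℝ) ^ (ε / (k + 1) * k) := by
        rw [mul_pow, Real.rpow_mul_natCast (by positivity)]
    _ ≤ _ := by
        refine mul_le_mul_of_nonneg_left (Real.rpow_le_rpow_of_exponent_le hn1 ?_) (by positivity)
        rw [div_mul_eq_mul_div, div_le_iff₀ (by positivity)]
        nlinarith

end DivisorFunctions

/-! ### Splitting off the powerful part -/

section PowerfulDecomposition

/-- On prime powers: exponent 1 goes to `s`, even exponents to `a²`, and odd exponents `2j + 3` to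
`a² b³`. -/
theorem exists_squarefree_mul_sq_mul_cube {m : ℕ} (hm : m ≠ 0) :
    ∃ s a b : ℕ, m = s * (a ^ 2 * b ^ 3) ∧ Squarefree s ∧ s.Coprime (a ^ 2 * b ^ 3) := by
  induction m using Nat.recOnPosPrimePosCoprime with
  | zero => exact absurd rfl hm
  | one => exact ⟨1, 1, 1, by norm_num, squarefree_one, by norm_num⟩
  | prime_pow p n hp hn =>
    rcases Nat.even_or_odd' n with ⟨i, rfl | rfl⟩
    · exact ⟨1, p ^ i, 1, by ring, squarefree_one, Nat.coprime_one_left _⟩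
    · rcases Nat.eq_zero_or_pos i with rfl | hi
      · exact ⟨p, 1, 1, by ring, hp.squarefree, by norm_num⟩
      · obtain ⟨j, rfl⟩ := Nat.exists_eq_succ_of_ne_zero hi.ne'
        exact ⟨1, p ^ j, p, by rw [Nat.succ_eq_add_one]; ring, squarefree_one,
          Nat.coprime_one_left _⟩
  | coprime m n hm1 hn1 hmn ihm ihn =>
    obtain ⟨s, a, b, rfl, hs, hc⟩ := ihm (by omega)
    obtain ⟨s', a', b', rfl, hs', hc'⟩ := ihn (by omega)
    have h1 : s.Coprime s' := (Nat.Coprime.coprime_mul_right hmn).coprime_mul_right_right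
    have h2 : s.Coprime (a' ^ 2 * b' ^ 3) :=
      (Nat.Coprime.coprime_mul_right hmn).coprime_mul_left_right
    have h3 : (a ^ 2 * b ^ 3).Coprime s' :=
      (Nat.Coprime.coprime_mul_left hmn).coprime_mul_right_right
    refine ⟨s * s', a * a', b * b', by ring, (Nat.squarefree_mul h1).2 ⟨hs, hs'⟩, ?_⟩
    rw [show (a * a') ^ 2 * (b * b') ^ 3 = (a ^ 2 * b ^ 3) * (a' ^ 2 * b' ^ 3) by ring]
    exact Nat.Coprime.mul_left (hc.mul_right h2) (h3.symm.mul_right hc')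

/-- A sum of a function that is submultiplicative along the decomposition into a squarefree and a
powerful part is dominated by its squarefree part. -/
theorem exists_sum_Icc_le_sum_squarefree :
    ∃ W : ℝ, 0 < W ∧ ∀ (F G H : ℕ → ℝ) (C : ℝ), (∀ s, 0 ≤ G s) → 0 ≤ C →
      (∀ s c, s ≠ 0 → c ≠ 0 → Squarefree s → s.Coprime c → F (s * c) ≤ G s * H c) →
      (∀ c : ℕ, c ≠ 0 → H c ≤ C * (c : ℝ) ^ (-(3 / 4) : ℝ)) → ∀ Z : ℕ,
      ∑ m ∈ Finset.Icc 1 Z, F m ≤ C * W * ∑ s ∈ (Finset.Icc 1 Z).filter Squarefree, G s := by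
  have h1 : Summable fun a : ℕ => (a : ℝ) ^ (-(3 / 2) : ℝ) :=
    Real.summable_nat_rpow.2 (by norm_num)
  have h2 : Summable fun a : ℕ => (a : ℝ) ^ (-(9 / 4) : ℝ) :=
    Real.summable_nat_rpow.2 (by norm_num)
  have hp1 : 0 < ∑' a : ℕ, (a : ℝ) ^ (-(3 / 2) : ℝ) :=
    h1.tsum_pos (fun a => by positivity) 1 (by simp)
  have hp2 : 0 < ∑' a : ℕ, (a : ℝ) ^ (-(9 / 4) : ℝ) :=
    h2.tsum_pos (fun a => by positivity) 1 (by simp)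
  refine ⟨(∑' a : ℕ, (a : ℝ) ^ (-(3 / 2) : ℝ)) * ∑' a : ℕ, (a : ℝ) ^ (-(9 / 4) : ℝ),
    mul_pos hp1 hp2, fun F G H C hG hC hF hH Z => ?_⟩
  choose! s a b hm hs hc using fun m : ℕ => exists_squarefree_mul_sq_mul_cube (m := m)
  set I := Finset.Icc 1 Z with hI
  -- The map `m ↦ (s, a, b)` is injective, so the sum is at most one over all triples. The
  -- hypothesis on `H` turns into `a^(-3/2) b^(-9/4)`, both factors summable.
  set g : ℕ × ℕ × ℕ → ℝ := fun t =>
    G t.1 * (C * ((t.2.1 : ℝ) ^ (-(3 / 2) : ℝ) * (t.2.2 : ℝ) ^ (-(9 / 4) : ℝ))) with hg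
  have hg0 : ∀ t, 0 ≤ g t := fun t => mul_nonneg (hG _) (by positivity)
  have hI0 : ∀ m ∈ I, m ≠ 0 := fun m h => by rw [hI, Finset.mem_Icc] at h; omega
  have hle : ∀ m ∈ I, F m ≤ g (s m, a m, b m) := fun m hmI => by
    have h0 := hI0 m hmI
    have h3 := hm m h0
    have hs0 : s m ≠ 0 := (hs m h0).ne_zero
    have hc0 : a m ^ 2 * b m ^ 3 ≠ 0 := right_ne_zero_of_mul (h3 ▸ h0)
    conv_lhs => rw [h3]
    refine (hF _ _ hs0 hc0 (hs m h0) (hc m h0)).trans (mul_le_mul_of_nonneg_left ?_ (hG _))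
    refine (hH _ hc0).trans (le_of_eq ?_)
    push_cast
    rw [Real.mul_rpow (by positivity) (by positivity), ← Real.rpow_natCast_mul (by positivity),
      ← Real.rpow_natCast_mul (by positivity)]
    norm_num
  have hinj : Set.InjOn (fun m => (s m, a m, b m)) (I : Set ℕ) := fun m hmI m' hmI' h => by
    simp only [Prod.mk.injEq] at h
    rw [hm m (hI0 m hmI), hm m' (hI0 m' hmI'), h.1, h.2.1, h.2.2]
  have hsub : I.image (fun m => (s m, a m, b m)) ⊆ (I.filter Squarefree) ×ˢ (I ×ˢ I) := by
    intro t ht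
    obtain ⟨m, hmI, rfl⟩ := Finset.mem_image.1 ht
    have h0 := hI0 m hmI
    have h3 := hm m h0
    have hmZ : m ≤ Z := (Finset.mem_Icc.1 hmI).2
    have hpos : 0 < m := Nat.pos_of_ne_zero h0
    have hdiv : ∀ u, u ∣ m → u ∈ I := fun u hu =>
      Finset.mem_Icc.2 ⟨Nat.pos_of_dvd_of_pos hu hpos, (Nat.le_of_dvd hpos hu).trans hmZ⟩
    rw [Finset.mem_product, Finset.mem_product, Finset.mem_filter]
    refine ⟨⟨hdiv _ ⟨_, h3⟩, hs m h0⟩, hdiv _ ⟨s m * (a m * b m ^ 3), ?_⟩,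
      hdiv _ ⟨s m * (a m ^ 2 * b m ^ 2), ?_⟩⟩
    · dsimp only; conv_lhs => rw [h3]
      ring
    · dsimp only; conv_lhs => rw [h3]
      ring
  have hfin : ∀ f : ℕ → ℝ, (∀ n, 0 ≤ f n) → Summable f → ∑ n ∈ I, f n ≤ ∑' n, f n :=
    fun f hf hs => hs.sum_le_tsum _ fun n _ => hf n
  have hGs : 0 ≤ ∑ s ∈ I.filter Squarefree, G s := Finset.sum_nonneg fun s _ => hG s
  calc ∑ m ∈ I, F m ≤ ∑ m ∈ I, g (s m, a m, b m) := Finset.sum_le_sum hle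
    _ = ∑ t ∈ I.image (fun m => (s m, a m, b m)), g t := (Finset.sum_image hinj).symm
    _ ≤ ∑ t ∈ (I.filter Squarefree) ×ˢ (I ×ˢ I), g t :=
        Finset.sum_le_sum_of_subset_of_nonneg hsub fun t _ _ => hg0 t
    _ = (∑ s ∈ I.filter Squarefree, G s) * (C * ((∑ a ∈ I, (a : ℝ) ^ (-(3 / 2) : ℝ)) *
          ∑ b ∈ I, (b : ℝ) ^ (-(9 / 4) : ℝ))) := by
        rw [Finset.sum_mul_sum, ← Finset.sum_product', Finset.mul_sum, Finset.sum_mul_sum,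
          ← Finset.sum_product']
    _ ≤ (∑ s ∈ I.filter Squarefree, G s) * (C * ((∑' a : ℕ, (a : ℝ) ^ (-(3 / 2) : ℝ)) *
          ∑' a : ℕ, (a : ℝ) ^ (-(9 / 4) : ℝ))) := by
        refine mul_le_mul_of_nonneg_left (mul_le_mul_of_nonneg_left (mul_le_mul
          (hfin _ (fun n => by positivity) h1) (hfin _ (fun n => by positivity) h2)
          (Finset.sum_nonneg fun n _ => by positivity) hp1.le) hC) hGs
    _ = _ := by ring

end PowerfulDecomposition

/-! ### Sums over tuples with square product -/

section TupleSums

open ArithmeticFunction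
open scoped ArithmeticFunction.zeta

/-- Grouping tuples by their product, each fibre has at most `τ_k(m)` elements. -/
theorem sum_piFinset_prod_le {k : ℕ} {S T : Finset ℕ} {h : ℕ → ℝ} (hh : ∀ n, 0 ≤ h n)
    (hS : ∀ v ∈ Fintype.piFinset (fun _ : Fin k => S), ∏ i, v i ∈ T) (hT : ∀ m ∈ T, m ≠ 0) :
    ∑ v ∈ Fintype.piFinset (fun _ : Fin k => S), h (∏ i, v i) ≤
      ∑ m ∈ T, ((ζ ^ k : ArithmeticFunction ℕ) m : ℝ) * h m := by
  rw [← Finset.sum_fiberwise_of_maps_to hS]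
  refine Finset.sum_le_sum fun m hm => ?_
  rw [Finset.sum_congr rfl fun v hv => by rw [(Finset.mem_filter.1 hv).2], Finset.sum_const,
    nsmul_eq_mul]
  refine mul_le_mul_of_nonneg_right ?_ (hh m)
  rw [← card_finMulAntidiag_eq_zeta_pow k (hT m hm)]
  refine Nat.cast_le.2 (Finset.card_le_card fun v hv => ?_)
  exact Nat.mem_finMulAntidiag.2 ⟨(Finset.mem_filter.1 hv).2, hT m hm⟩

/-- The reverse comparison: as `S` contains all divisors of `m`, every factorisation of `m` occurs
as a tuple. -/
theorem sum_zeta_pow_mul_le {k : ℕ} {S T : Finset ℕ} {h : ℕ → ℝ} (hh : ∀ n, 0 ≤ h n)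
    (hT : ∀ m ∈ T, m ≠ 0 ∧ ∀ u, u ∣ m → u ∈ S) :
    ∑ m ∈ T, ((ζ ^ k : ArithmeticFunction ℕ) m : ℝ) * h m ≤
      ∑ v ∈ Fintype.piFinset (fun _ : Fin k => S), h (∏ i, v i) := by
  refine le_trans ?_ (Finset.sum_le_sum_of_subset_of_nonneg
    (Finset.filter_subset (fun v => ∏ i, v i ∈ T) _) fun v _ _ => hh _)
  rw [← Finset.sum_fiberwise_of_maps_to (t := T) fun v hv => (Finset.mem_filter.1 hv).2]
  refine Finset.sum_le_sum fun m hm => ?_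
  rw [Finset.sum_congr rfl fun v hv => by rw [(Finset.mem_filter.1 hv).2], Finset.sum_const,
    nsmul_eq_mul]
  refine mul_le_mul_of_nonneg_right ?_ (hh m)
  rw [← card_finMulAntidiag_eq_zeta_pow k (hT m hm).1]
  refine Nat.cast_le.2 (Finset.card_le_card fun v hv => ?_)
  have h1 := Nat.prod_eq_of_mem_finMulAntidiag hv
  rw [Finset.mem_filter, Finset.mem_filter, Fintype.mem_piFinset]
  exact ⟨⟨fun i => (hT m hm).2 _ (Nat.dvd_of_mem_finMulAntidiag hv i), h1 ▸ hm⟩, h1⟩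

theorem sum_pow_eq_sum_piFinset (K : ℕ) (S : Finset ℕ) (g : ℕ → ℝ) :
    (∑ a ∈ S, g a) ^ K = ∑ v ∈ Fintype.piFinset (fun _ : Fin K => S), ∏ i, g (v i) := by
  rw [← Finset.prod_univ_sum, Finset.prod_const, Finset.card_univ, Fintype.card_fin]

theorem sum_zeta_pow_div_le (K Z : ℕ) :
    ∑ s ∈ Finset.Icc 1 Z, ((ζ ^ K : ArithmeticFunction ℕ) s : ℝ) * (1 / (s : ℝ)) ≤
      (1 + Real.log Z) ^ K := by
  have h1 : ∑ a ∈ Finset.Icc 1 Z, 1 / (a : ℝ) ≤ 1 + Real.log Z := by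
    have := harmonic_le_one_add_log Z
    rw [harmonic_eq_sum_Icc] at this
    push_cast at this
    simpa using this
  refine (sum_zeta_pow_mul_le (S := Finset.Icc 1 Z) (fun n => by positivity) fun m hm => ?_).trans
    (le_trans (le_of_eq ?_) (pow_le_pow_left₀ (Finset.sum_nonneg fun a _ => by positivity) h1 K))
  · rw [Finset.mem_Icc] at hm
    refine ⟨by omega, fun u hu => Finset.mem_Icc.2 ⟨Nat.pos_of_dvd_of_pos hu hm.1, ?_⟩⟩
    exact (Nat.le_of_dvd hm.1 hu).trans hm.2
  · rw [sum_pow_eq_sum_piFinset]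
    refine Finset.sum_congr rfl fun v _ => ?_
    push_cast
    simp

/-- Upper bound for `∑ τ_k(m²) / m`. -/
theorem exists_sum_zeta_pow_sq_div_le (k : ℕ) :
    ∃ C : ℝ, 0 < C ∧ ∀ Z : ℕ, ∑ m ∈ Finset.Icc 1 Z,
      ((ζ ^ k : ArithmeticFunction ℕ) (m ^ 2) : ℝ) * (1 / (m : ℝ)) ≤
        C * (1 + Real.log Z) ^ (k * (k + 1) / 2) := by
  obtain ⟨W, hW, hsum⟩ := exists_sum_Icc_le_sum_squarefree
  -- The argument is `c²`, so `τ_k(c²) / c ≪ c^(1/4 - 1) = c^(-3/4)`.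
  obtain ⟨C, hC1, hC⟩ := exists_zeta_pow_apply_le k (ε := 1 / 8) (by norm_num)
  set K := k * (k + 1) / 2 with hK
  refine ⟨C * W, by positivity, fun Z => ?_⟩
  refine (hsum _ (fun s => ((ζ ^ K : ArithmeticFunction ℕ) s : ℝ) * (1 / (s : ℝ)))
    (fun c => ((ζ ^ k : ArithmeticFunction ℕ) (c ^ 2) : ℝ) * (1 / (c : ℝ))) C
    (fun s => by positivity) (by linarith) (fun s c hs hc hsq hcop => le_of_eq ?_)
    (fun c hc => ?_) Z).trans ?_
  · rw [mul_pow, (isMultiplicative_zeta_pow k).map_mul_of_coprime (hcop.pow 2 2),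
      zeta_pow_apply_sq_of_squarefree k hsq]
    push_cast
    rw [← one_div_mul_one_div, hK]
    ring
  · have hc0 : (0 : ℝ) < c := Nat.cast_pos.2 (Nat.pos_of_ne_zero hc)
    have h1 := hC (c ^ 2) (pow_ne_zero 2 hc)
    push_cast at h1
    rw [← Real.rpow_natCast_mul hc0.le] at h1
    refine (mul_le_mul_of_nonneg_right h1 (by positivity)).trans (le_of_eq ?_)
    rw [show (1 : ℝ) / c = (c : ℝ) ^ (-1 : ℝ) by rw [Real.rpow_neg_one, one_div], mul_assoc,
      ← Real.rpow_add hc0]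
    norm_num
  · refine mul_le_mul_of_nonneg_left ?_ (by positivity)
    exact (Finset.sum_le_sum_of_subset_of_nonneg (Finset.filter_subset _ _)
      fun s _ _ => by positivity).trans (sum_zeta_pow_div_le K Z)

/-- The diagonal contribution to the `k`-th moment of the character sum of length `x`. -/
theorem exists_sum_piFinset_isSquare_le (k : ℕ) :
    ∃ C : ℝ, 0 < C ∧ ∀ x : ℕ, 1 ≤ x →
      ∑ v ∈ (Fintype.piFinset fun _ : Fin k => (Finset.Icc 1 x).filter Odd).filter
        (fun v => IsSquare (∏ i, v i)), 1 / Real.sqrt ((∏ i, v i : ℕ) : ℝ) ≤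
        C * (1 + k * Real.log x) ^ (k * (k + 1) / 2) := by
  obtain ⟨C, hC, h⟩ := exists_sum_zeta_pow_sq_div_le k
  refine ⟨C, hC, fun x hx => ?_⟩
  have h1 := h (x ^ k)
  rw [Nat.cast_pow, Real.log_pow] at h1
  refine le_trans ?_ h1
  rw [Finset.sum_filter]
  refine (sum_piFinset_prod_le (T := Finset.Icc 1 (x ^ k))
    (h := fun P => if IsSquare P then 1 / Real.sqrt (P : ℝ) else 0)
    (fun n => by split_ifs <;> positivity) (fun v hv => ?_) fun m hm => ?_).trans ?_
  · rw [Fintype.mem_piFinset] at hv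
    rw [Finset.mem_Icc]
    have hv' : ∀ i, 1 ≤ v i ∧ v i ≤ x := fun i =>
      Finset.mem_Icc.1 (Finset.mem_filter.1 (hv i)).1
    refine ⟨Finset.one_le_prod' fun i _ => (hv' i).1, ?_⟩
    refine (Finset.prod_le_pow_card _ _ x fun i _ => (hv' i).2).trans ?_
    rw [Finset.card_univ, Fintype.card_fin]
  · rw [Finset.mem_Icc] at hm; omega
  · simp_rw [mul_ite, mul_zero]
    rw [← Finset.sum_filter]
    have hinj : Set.InjOn (fun m : ℕ => m ^ 2) (Finset.Icc 1 (x ^ k) : Set ℕ) :=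
      fun a _ b _ hab => Nat.pow_left_injective two_ne_zero hab
    have h2 : ∀ m : ℕ, ((ζ ^ k : ArithmeticFunction ℕ) (m ^ 2) : ℝ) * (1 / (m : ℝ)) =
        ((ζ ^ k : ArithmeticFunction ℕ) (m ^ 2) : ℝ) * (1 / Real.sqrt ((m ^ 2 : ℕ) : ℝ)) :=
      fun m => by rw [Nat.cast_pow, Real.sqrt_sq (Nat.cast_nonneg m)]
    simp_rw [h2]
    rw [← Finset.sum_image (g := fun m : ℕ => m ^ 2)
      (f := fun n => ((ζ ^ k : ArithmeticFunction ℕ) n : ℝ) * (1 / Real.sqrt (n : ℝ))) hinj]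
    refine Finset.sum_le_sum_of_subset_of_nonneg (fun n hn => ?_) fun n _ _ => by positivity
    rw [Finset.mem_filter, Finset.mem_Icc] at hn
    obtain ⟨⟨h3, h4⟩, r, rfl⟩ := hn
    refine Finset.mem_image.2 ⟨r, Finset.mem_Icc.2 ⟨?_, ?_⟩, sq r⟩
    · exact Nat.pos_of_ne_zero (by rintro rfl; simp at h3)
    · nlinarith

/-- Each even `a` is charged to the odd number `a - 1`, whose reciprocal is larger. -/
theorem log_le_two_mul_sum_odd_inv (z : ℕ) :
    Real.log z ≤ 2 * ∑ a ∈ (Finset.Icc 1 z).filter Odd, 1 / (a : ℝ) := by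
  have h1 : Real.log z ≤ ∑ a ∈ Finset.Icc 1 z, 1 / (a : ℝ) := by
    have := log_add_one_le_harmonic z
    rw [harmonic_eq_sum_Icc] at this
    push_cast at this
    have h2 : Real.log z ≤ Real.log (z + 1) := by
      rcases Nat.eq_zero_or_pos z with rfl | hz
      · simp
      · exact Real.log_le_log (Nat.cast_pos.2 hz) (by linarith)
    simpa using h2.trans this
  rw [← Finset.sum_filter_add_sum_filter_not _ Odd] at h1
  have h2 : ∑ a ∈ (Finset.Icc 1 z).filter (fun a => ¬ Odd a), 1 / (a : ℝ) ≤
      ∑ a ∈ (Finset.Icc 1 z).filter Odd, 1 / (a : ℝ) := by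
    have hpos : ∀ a ∈ (Finset.Icc 1 z).filter (fun a => ¬ Odd a), 2 ≤ a ∧ a % 2 = 0 ∧ a ≤ z :=
      fun a ha => by
        rw [Finset.mem_filter, Finset.mem_Icc, Nat.odd_iff] at ha
        omega
    have hinj : Set.InjOn (fun a : ℕ => a - 1)
        ((Finset.Icc 1 z).filter (fun a => ¬ Odd a) : Set ℕ) := fun a ha b hb hab => by
      have := hpos a ha
      have := hpos b hb
      simp only at hab
      omega
    calc _ ≤ ∑ a ∈ (Finset.Icc 1 z).filter (fun a => ¬ Odd a), 1 / ((a - 1 : ℕ) : ℝ) := by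
          refine Finset.sum_le_sum fun a ha => ?_
          have := hpos a ha
          refine one_div_le_one_div_of_le (Nat.cast_pos.2 (by omega)) ?_
          exact_mod_cast Nat.sub_le a 1
      _ = ∑ a ∈ ((Finset.Icc 1 z).filter (fun a => ¬ Odd a)).image (fun a : ℕ => a - 1),
            1 / ((a : ℕ) : ℝ) := (Finset.sum_image (f := fun a : ℕ => 1 / (a : ℝ)) hinj).symm
      _ ≤ _ := by
        refine Finset.sum_le_sum_of_subset_of_nonneg (fun b hb => ?_) fun b _ _ => by positivity
        obtain ⟨a, ha, rfl⟩ := Finset.mem_image.1 hb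
        have := hpos a ha
        rw [Finset.mem_filter, Finset.mem_Icc, Nat.odd_iff]
        omega
  linarith

/-- From `a = ∑ φ(g)` over `g ∣ a`: with `a = g b`, `1/a` is a sum of `φ(g)/g² · 1/b²`, and `∑ 1/b²
≤ 2`. So the weight `φ(g)/g` costs only a constant. -/
theorem sum_odd_inv_le_sum_totient (z : ℕ) :
    ∑ a ∈ (Finset.Icc 1 z).filter Odd, 1 / (a : ℝ) ≤
      2 * ∑ g ∈ (Finset.Icc 1 z).filter Odd, (g.totient : ℝ) / (g : ℝ) ^ 2 := by
  have h1 : ∀ a ∈ (Finset.Icc 1 z).filter Odd, 1 / (a : ℝ) =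
      ∑ g ∈ a.divisors, (g.totient : ℝ) / (a : ℝ) ^ 2 := fun a ha => by
    have ha0 : (a : ℝ) ≠ 0 := by
      rw [Finset.mem_filter, Finset.mem_Icc] at ha
      exact Nat.cast_ne_zero.2 (by omega)
    rw [← Finset.sum_div, ← Nat.cast_sum, Nat.sum_totient]
    field_simp
  have h2 : ∑ b ∈ Finset.Icc 1 z, 1 / (b : ℝ) ^ 2 ≤ 2 := by
    rcases Nat.eq_zero_or_pos z with rfl | hz
    · simp
    · have h := sum_Ioo_inv_sq_le (α := ℝ) 0 (z + 1)
      have he : Finset.Ioo 0 (z + 1) = Finset.Icc 1 z := by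
        ext; simp only [Finset.mem_Ioo, Finset.mem_Icc]; omega
      rw [he] at h
      simpa using h
  rw [Finset.sum_congr rfl h1, Finset.sum_sigma']
  have hinj : Set.InjOn (fun t : (_ : ℕ) × ℕ => (t.2, t.1 / t.2))
      (((Finset.Icc 1 z).filter Odd).sigma fun a => a.divisors : Set ((_ : ℕ) × ℕ)) := by
    rintro ⟨a, g⟩ ht ⟨a', g'⟩ ht' h
    rw [Finset.mem_coe, Finset.mem_sigma, Nat.mem_divisors] at ht ht'
    simp only [Prod.mk.injEq] at h ht ht'
    obtain ⟨rfl, h⟩ := h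
    have : a = a' := by
      rw [← Nat.mul_div_cancel' ht.2.1, ← Nat.mul_div_cancel' ht'.2.1, h]
    rw [this]
  set f : ℕ × ℕ → ℝ := fun t => (t.1.totient : ℝ) / (t.1 : ℝ) ^ 2 * (1 / (t.2 : ℝ) ^ 2) with hf
  calc _ = ∑ t ∈ ((Finset.Icc 1 z).filter Odd).sigma fun a => a.divisors,
        f ((fun t : (_ : ℕ) × ℕ => (t.2, t.1 / t.2)) t) := by
        refine Finset.sum_congr rfl fun t ht => ?_
        obtain ⟨a, g⟩ := t
        rw [Finset.mem_sigma, Nat.mem_divisors] at ht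
        simp only at ht
        obtain ⟨-, ⟨b, rfl⟩, h0⟩ := ht
        have hg0 : 0 < g := Nat.pos_of_ne_zero (left_ne_zero_of_mul h0)
        have hg' : (g : ℝ) ≠ 0 := Nat.cast_ne_zero.2 hg0.ne'
        have hb' : (b : ℝ) ≠ 0 := Nat.cast_ne_zero.2 (right_ne_zero_of_mul h0)
        simp only [hf]
        rw [Nat.mul_div_cancel_left _ hg0]
        push_cast
        field_simp
    _ = ∑ t ∈ (((Finset.Icc 1 z).filter Odd).sigma fun a => a.divisors).image
          (fun t : (_ : ℕ) × ℕ => (t.2, t.1 / t.2)), f t := (Finset.sum_image hinj).symm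
    _ ≤ ∑ t ∈ ((Finset.Icc 1 z).filter Odd) ×ˢ Finset.Icc 1 z, f t := by
        refine Finset.sum_le_sum_of_subset_of_nonneg (fun t ht => ?_) fun t _ _ => by positivity
        obtain ⟨⟨a, g⟩, hag, rfl⟩ := Finset.mem_image.1 ht
        rw [Finset.mem_sigma, Finset.mem_filter, Finset.mem_Icc, Nat.mem_divisors] at hag
        obtain ⟨⟨⟨h3, h4⟩, h5⟩, h6, h7⟩ := hag
        simp only at h3 h4 h5 h6 h7
        have hg0 := Nat.pos_of_dvd_of_pos h6 h3
        rw [Finset.mem_product, Finset.mem_filter, Finset.mem_Icc, Finset.mem_Icc]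
        exact ⟨⟨⟨hg0, (Nat.le_of_dvd h3 h6).trans h4⟩, h5.of_dvd_nat h6⟩,
          Nat.div_pos (Nat.le_of_dvd h3 h6) hg0, (Nat.div_le_self _ _).trans h4⟩
    _ = (∑ g ∈ (Finset.Icc 1 z).filter Odd, (g.totient : ℝ) / (g : ℝ) ^ 2) *
          ∑ b ∈ Finset.Icc 1 z, 1 / (b : ℝ) ^ 2 := by
        rw [Finset.sum_mul_sum, ← Finset.sum_product']
    _ ≤ _ := by
        rw [mul_comm]
        exact mul_le_mul_of_nonneg_right h2 (Finset.sum_nonneg fun g _ => by positivity)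

theorem prod_totient_div_le {K : ℕ} (v : Fin K → ℕ) :
    ∏ i, ((v i).totient : ℝ) / (v i : ℝ) ^ 2 ≤
      ((∏ i, v i).totient : ℝ) / ((∏ i, v i : ℕ) : ℝ) ^ 2 := by
  rw [Finset.prod_div_distrib, Finset.prod_pow, Nat.cast_prod]
  refine div_le_div_of_nonneg_right ?_ (by positivity)
  rw [← Nat.cast_prod]
  refine Nat.cast_le.2 ?_
  induction K with
  | zero => simp
  | succ K ih =>
    rw [Fin.prod_univ_succ, Fin.prod_univ_succ]
    exact (Nat.mul_le_mul_left _ (ih fun i => v i.succ)).trans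
      (Nat.totient_super_multiplicative _ _)

/-- The `K`-th power of the odd totient sum expands into tuples of product at most `z^K`.
Supermultiplicativity of `φ` allows grouping by the product, and the powerful parts cost only a
constant. -/
theorem exists_log_pow_le_sum_squarefree (K : ℕ) :
    ∃ c : ℝ, 0 < c ∧ ∀ z : ℕ, 1 ≤ z → c * Real.log z ^ K ≤
      ∑ s ∈ ((Finset.Icc 1 (z ^ K)).filter Squarefree).filter Odd,
        ((ζ ^ K : ArithmeticFunction ℕ) s : ℝ) * ((s.totient : ℝ) / (s : ℝ) ^ 2) := by
  obtain ⟨W, hW, hsum⟩ := exists_sum_Icc_le_sum_squarefree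
  obtain ⟨C, hC1, hC⟩ := exists_zeta_pow_apply_le K (ε := 1 / 4) (by norm_num)
  refine ⟨1 / (C * W * 4 ^ K), by positivity, fun z hz => ?_⟩
  have hlog : 0 ≤ Real.log z := Real.log_natCast_nonneg z
  have h1 : Real.log z ^ K ≤ 4 ^ K *
      (∑ g ∈ (Finset.Icc 1 z).filter Odd, (g.totient : ℝ) / (g : ℝ) ^ 2) ^ K := by
    rw [← mul_pow]
    refine pow_le_pow_left₀ hlog ?_ K
    linarith [log_le_two_mul_sum_odd_inv z, sum_odd_inv_le_sum_totient z]
  have h2 : (∑ g ∈ (Finset.Icc 1 z).filter Odd, (g.totient : ℝ) / (g : ℝ) ^ 2) ^ K ≤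
      ∑ m ∈ (Finset.Icc 1 (z ^ K)).filter Odd,
        ((ζ ^ K : ArithmeticFunction ℕ) m : ℝ) * ((m.totient : ℝ) / (m : ℝ) ^ 2) := by
    rw [sum_pow_eq_sum_piFinset]
    refine (Finset.sum_le_sum fun v _ => prod_totient_div_le v).trans
      (sum_piFinset_prod_le (h := fun m => (m.totient : ℝ) / (m : ℝ) ^ 2)
        (fun n => by positivity) (fun v hv => ?_) fun m hm => ?_)
    · rw [Fintype.mem_piFinset] at hv
      have hv' : ∀ i, (1 ≤ v i ∧ v i ≤ z) ∧ Odd (v i) := fun i => by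
        have := Finset.mem_filter.1 (hv i)
        exact ⟨Finset.mem_Icc.1 this.1, this.2⟩
      rw [Finset.mem_filter, Finset.mem_Icc]
      refine ⟨⟨Finset.one_le_prod' fun i _ => (hv' i).1.1, ?_⟩, ?_⟩
      · refine (Finset.prod_le_pow_card _ _ z fun i _ => (hv' i).1.2).trans ?_
        rw [Finset.card_univ, Fintype.card_fin]
      · exact Finset.prod_induction _ Odd (fun a b => Odd.mul) odd_one fun i _ => (hv' i).2
    · rw [Finset.mem_filter, Finset.mem_Icc] at hm; omega
  have h3 := hsum (fun m => if Odd m then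
      ((ζ ^ K : ArithmeticFunction ℕ) m : ℝ) * ((m.totient : ℝ) / (m : ℝ) ^ 2) else 0)
    (fun m => if Odd m then
      ((ζ ^ K : ArithmeticFunction ℕ) m : ℝ) * ((m.totient : ℝ) / (m : ℝ) ^ 2) else 0)
    (fun m => ((ζ ^ K : ArithmeticFunction ℕ) m : ℝ) * ((m.totient : ℝ) / (m : ℝ) ^ 2)) C
    (fun s => by split_ifs <;> positivity) (by linarith) (fun s c hs hc hsq hcop => ?_)
    (fun c hc => ?_) (z ^ K)
  · rw [← Finset.sum_filter, ← Finset.sum_filter] at h3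
    rw [div_mul_eq_mul_div, one_mul, div_le_iff₀ (by positivity)]
    calc Real.log z ^ K ≤ 4 ^ K * _ := h1
      _ ≤ 4 ^ K * _ := mul_le_mul_of_nonneg_left (h2.trans h3) (by positivity)
      _ = _ := by ring
  · by_cases hso : Odd s
    · have h5 : ((ζ ^ K : ArithmeticFunction ℕ) (s * c) : ℝ) *
          (((s * c).totient : ℝ) / ((s * c : ℕ) : ℝ) ^ 2) =
          (((ζ ^ K : ArithmeticFunction ℕ) s : ℝ) * ((s.totient : ℝ) / (s : ℝ) ^ 2)) *
          (((ζ ^ K : ArithmeticFunction ℕ) c : ℝ) * ((c.totient : ℝ) / (c : ℝ) ^ 2)) := by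
        rw [(isMultiplicative_zeta_pow K).map_mul_of_coprime hcop, Nat.totient_mul hcop]
        push_cast
        rw [mul_pow, mul_div_mul_comm]
        ring
      rw [if_pos hso, h5]
      split_ifs
      · exact le_rfl
      · positivity
    · rw [if_neg hso, if_neg (fun h => hso (Nat.Odd.of_mul_left h)), zero_mul]
  · have hc0 : (0 : ℝ) < c := Nat.cast_pos.2 (Nat.pos_of_ne_zero hc)
    have h5 : (c.totient : ℝ) / (c : ℝ) ^ 2 ≤ (c : ℝ) ^ (-1 : ℝ) := by
      rw [Real.rpow_neg_one, div_le_iff₀ (by positivity), sq, inv_mul_cancel_left₀ hc0.ne']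
      exact_mod_cast Nat.totient_le c
    refine (mul_le_mul (hC c hc) h5 (by positivity) (by positivity)).trans (le_of_eq ?_)
    rw [mul_assoc, ← Real.rpow_add hc0]
    norm_num

/-- The main term of the mixed moment, restricted to tuples with small entries. -/
theorem exists_log_pow_le_sum_piFinset_isSquare (k : ℕ) :
    ∃ c : ℝ, 0 < c ∧ ∀ z : ℕ, 1 ≤ z → c * Real.log z ^ (k * (k + 1) / 2) ≤
      ∑ v ∈ (Fintype.piFinset fun _ : Fin k =>
          (Finset.Icc 1 (z ^ (2 * (k * (k + 1) / 2)))).filter Odd).filter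
        (fun v => IsSquare (∏ i, v i)),
        ((∏ i, v i).totient : ℝ) / ((∏ i, v i : ℕ) : ℝ) *
          (1 / Real.sqrt ((∏ i, v i : ℕ) : ℝ)) := by
  set K := k * (k + 1) / 2 with hK
  obtain ⟨c, hc, h⟩ := exists_log_pow_le_sum_squarefree K
  refine ⟨c, hc, fun z hz => (h z hz).trans ?_⟩
  set A := ((Finset.Icc 1 (z ^ K)).filter Squarefree).filter Odd with hA
  have hAmem : ∀ s ∈ A, ((1 ≤ s ∧ s ≤ z ^ K) ∧ Squarefree s) ∧ Odd s := fun s hs => by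
    rwa [hA, Finset.mem_filter, Finset.mem_filter, Finset.mem_Icc] at hs
  have hinj : Set.InjOn (fun m : ℕ => m ^ 2) (A : Set ℕ) :=
    fun a _ b _ hab => Nat.pow_left_injective two_ne_zero hab
  set w : ℕ → ℝ := fun P => if IsSquare P then
    (P.totient : ℝ) / (P : ℝ) * (1 / Real.sqrt (P : ℝ)) else 0 with hw
  -- Products `s²` with `s` odd and squarefree suffice: `τ_k(s²) = τ_K(s)` and `φ(s²) = s φ(s)`. As
  -- `s ≤ z^K`, every divisor of `s²` is at most `z^(2K)`.
  have h1 : ∀ s ∈ A, ((ζ ^ K : ArithmeticFunction ℕ) s : ℝ) * ((s.totient : ℝ) / (s : ℝ) ^ 2) =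
      ((ζ ^ k : ArithmeticFunction ℕ) (s ^ 2) : ℝ) * w (s ^ 2) := fun s hs => by
    obtain ⟨⟨⟨hs1, -⟩, hsq⟩, -⟩ := hAmem s hs
    have hs0 : (s : ℝ) ≠ 0 := Nat.cast_ne_zero.2 (by omega)
    have hφ : ((s ^ 2).totient : ℝ) = s.totient * s := by
      have h5 := Nat.totient_gcd_mul_totient_mul s s
      rw [Nat.gcd_self, mul_assoc] at h5
      have h6 := Nat.eq_of_mul_eq_mul_left (Nat.totient_pos.2 hs1) h5
      rw [sq, h6]
      push_cast
      ring
    rw [zeta_pow_apply_sq_of_squarefree k hsq, ← hK, hw]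
    simp only
    rw [if_pos ⟨s, sq s⟩, hφ, Nat.cast_pow, Real.sqrt_sq (Nat.cast_nonneg s)]
    congr 1
    field_simp
  rw [Finset.sum_congr rfl h1, ← Finset.sum_image (g := fun m : ℕ => m ^ 2)
    (f := fun n => ((ζ ^ k : ArithmeticFunction ℕ) n : ℝ) * w n) hinj, Finset.sum_filter]
  refine sum_zeta_pow_mul_le (fun n => ?_) fun m hm => ?_
  · rw [hw]
    simp only
    split_ifs <;> positivity
  · obtain ⟨s, hs, rfl⟩ := Finset.mem_image.1 hm
    obtain ⟨⟨⟨hs1, hs2⟩, -⟩, hso⟩ := hAmem s hs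
    have hpos : 0 < s ^ 2 := pow_pos hs1 2
    refine ⟨hpos.ne', fun u hu => ?_⟩
    rw [Finset.mem_filter, Finset.mem_Icc]
    refine ⟨⟨Nat.pos_of_dvd_of_pos hu hpos, (Nat.le_of_dvd hpos hu).trans ?_⟩,
      (hso.pow (n := 2)).of_dvd_nat hu⟩
    rw [mul_comm 2, pow_mul]
    exact Nat.pow_le_pow_left hs2 2

end TupleSums

/-! ### Moments involving the short Dirichlet polynomial -/

section Mollifier

/-- A Dirichlet polynomial approximating `L(1/2, χ_d)` for `d ≡ 1 (mod 8)`, without its even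
terms. -/
noncomputable def oddPartialSum (x d : ℕ) : ℝ :=
  ∑ n ∈ (Finset.Icc 1 x).filter Odd, (jacobiSym n d : ℝ) * (1 / Real.sqrt n)

/-- The tuples of `k` odd natural numbers in `[1, x]`. -/
def oddTuples (k x : ℕ) : Finset (Fin k → ℕ) :=
  Fintype.piFinset fun _ : Fin k => (Finset.Icc 1 x).filter Odd

theorem odd_prod_of_mem_oddTuples {k x : ℕ} {v : Fin k → ℕ} (hv : v ∈ oddTuples k x) :
    Odd (∏ i, v i) := by
  rw [oddTuples, Fintype.mem_piFinset] at hv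
  exact Finset.prod_induction _ Odd (fun a b => Odd.mul) odd_one
    fun i _ => (Finset.mem_filter.1 (hv i)).2

theorem prod_le_of_mem_oddTuples {k x : ℕ} {v : Fin k → ℕ} (hv : v ∈ oddTuples k x) :
    ∏ i, v i ≤ x ^ k := by
  rw [oddTuples, Fintype.mem_piFinset] at hv
  refine (Finset.prod_le_pow_card _ _ x fun i _ =>
    (Finset.mem_Icc.1 (Finset.mem_filter.1 (hv i)).1).2).trans ?_
  rw [Finset.card_univ, Fintype.card_fin]

theorem card_oddTuples_le (k x : ℕ) : (oddTuples k x).card ≤ x ^ k := by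
  rw [oddTuples, Fintype.card_piFinset_const]
  refine Nat.pow_le_pow_left ?_ k
  refine (Finset.card_filter_le _ _).trans ?_
  rw [Nat.card_Icc]
  omega

theorem one_div_sqrt_prod_le_one {k x : ℕ} {v : Fin k → ℕ} (hv : v ∈ oddTuples k x) :
    1 / Real.sqrt ((∏ i, v i : ℕ) : ℝ) ≤ 1 := by
  have h : 1 ≤ ∏ i, v i := (odd_prod_of_mem_oddTuples hv).pos
  rw [div_le_one (Real.sqrt_pos.2 (by exact_mod_cast h)), Real.one_le_sqrt]
  exact_mod_cast h

theorem sum_oddTuples_succ (k x : ℕ) (F : (Fin (k + 1) → ℕ) → ℝ) :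
    ∑ w ∈ oddTuples (k + 1) x, F w =
      ∑ v ∈ oddTuples k x, ∑ n ∈ (Finset.Icc 1 x).filter Odd, F (Fin.cons n v) := by
  rw [← Finset.sum_product']
  refine Finset.sum_nbij' (fun w => (Fin.tail w, w 0)) (fun t => Fin.cons t.2 t.1)
    (fun w hw => ?_) (fun t ht => ?_) (fun w _ => Fin.cons_self_tail w) (fun t _ => by simp)
    fun w _ => by rw [Fin.cons_self_tail w]
  · rw [oddTuples, Fintype.mem_piFinset] at hw
    rw [Finset.mem_product, oddTuples, Fintype.mem_piFinset]
    exact ⟨fun i => hw i.succ, hw 0⟩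
  · rw [Finset.mem_product, oddTuples, Fintype.mem_piFinset] at ht
    rw [oddTuples, Fintype.mem_piFinset]
    refine Fin.cases ?_ fun i => ?_
    · simpa using ht.2
    · simpa using ht.1 i

theorem jacobiSym_prod_left {k : ℕ} (v : Fin k → ℕ) (d : ℕ) :
    jacobiSym ((∏ i, v i : ℕ) : ℤ) d = ∏ i, jacobiSym (v i) d := by
  induction k with
  | zero => simp
  | succ k ih =>
    rw [Fin.prod_univ_succ, Fin.prod_univ_succ, Nat.cast_mul, jacobiSym.mul_left, ih]

theorem oddPartialSum_pow (k x d : ℕ) :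
    oddPartialSum x d ^ k = ∑ v ∈ oddTuples k x,
      (jacobiSym ((∏ i, v i : ℕ) : ℤ) d : ℝ) * (1 / Real.sqrt ((∏ i, v i : ℕ) : ℝ)) := by
  rw [oddPartialSum, sum_pow_eq_sum_piFinset, oddTuples]
  refine Finset.sum_congr rfl fun v _ => ?_
  rw [Finset.prod_mul_distrib, jacobiSym_prod_left, Nat.cast_prod,
    Real.sqrt_prod _ fun i _ => Nat.cast_nonneg (v i), Finset.prod_div_distrib]
  simp

theorem abs_sum_one_mod_eight_jacobiSym_le {P : ℕ} (hodd : Odd P) (hP : ¬ IsSquare P) (N : ℕ) :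
    |∑ d ∈ (Finset.Icc 1 N).filter (fun d => d % 8 = 1), (jacobiSym P d : ℝ)| ≤ 21 * P := by
  have h1 : ∑ d ∈ (Finset.Icc 1 N).filter (fun d => d % 8 = 1), (jacobiSym P d : ℝ) =
      ∑ d ∈ (Finset.Icc 1 N).filter (fun d => d % 8 = 1), (jacobiSym d P : ℝ) := by
    refine Finset.sum_congr rfl fun d hd => ?_
    rw [Finset.mem_filter] at hd
    rw [jacobiSym.quadratic_reciprocity_one_mod_four (a := d) (by omega) hodd]
  have hP1 : (1 : ℝ) ≤ P := by exact_mod_cast hodd.pos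
  rw [h1, sum_Icc_filter_one_mod_eight (fun d => (jacobiSym (d : ℤ) P : ℝ))]
  refine (abs_sum_range_jacobiSym_le hodd hP _).trans ((sqrt_mul_one_add_log_le hP1).trans ?_)
  refine mul_le_mul_of_nonneg_left ?_ (by norm_num)
  calc (P : ℝ) ^ (11 / 20 : ℝ) ≤ (P : ℝ) ^ (1 : ℝ) :=
        Real.rpow_le_rpow_of_exponent_le hP1 (by norm_num)
    _ = P := Real.rpow_one _

/-- As `k` is even, positivity allows summing over all `d ≡ 1 (mod 8)`, so no squarefree sieve is
needed. Products that are not squares cancel by Pólya–Vinogradov. -/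
theorem sum_discs_oddPartialSum_pow_le {k : ℕ} (hk : Even k) (x N : ℕ) :
    ∑ d ∈ discs N, oddPartialSum x d ^ k ≤
      N * (∑ v ∈ (oddTuples k x).filter (fun v => IsSquare (∏ i, v i)),
        1 / Real.sqrt ((∏ i, v i : ℕ) : ℝ)) + 21 * (x : ℝ) ^ (2 * k) := by
  set E := (Finset.Icc 1 N).filter (fun d => d % 8 = 1) with hE
  have hsub : discs N ⊆ E := fun d hd => by
    rw [mem_discs] at hd
    rw [hE, Finset.mem_filter, Finset.mem_Icc]
    exact ⟨⟨hd.1.1.le, hd.1.2⟩, hd.2.1⟩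
  have hEcard : (E.card : ℝ) ≤ N := by
    have : E.card ≤ N := (Finset.card_filter_le _ _).trans (by rw [Nat.card_Icc]; omega)
    exact_mod_cast this
  refine (Finset.sum_le_sum_of_subset_of_nonneg hsub fun d _ _ => hk.pow_nonneg _).trans ?_
  simp_rw [oddPartialSum_pow]
  rw [Finset.sum_comm]
  have hterm : ∀ v ∈ oddTuples k x, ∑ d ∈ E, (jacobiSym ((∏ i, v i : ℕ) : ℤ) d : ℝ) *
      (1 / Real.sqrt ((∏ i, v i : ℕ) : ℝ)) ≤
      (if IsSquare (∏ i, v i) then N * (1 / Real.sqrt ((∏ i, v i : ℕ) : ℝ)) else 0) +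
        21 * (x : ℝ) ^ k := fun v hv => by
    rw [← Finset.sum_mul]
    split_ifs with hsq
    · have h1 : ∑ d ∈ E, (jacobiSym ((∏ i, v i : ℕ) : ℤ) d : ℝ) ≤ N := by
        refine (Finset.sum_le_sum fun d _ => (le_abs_self _).trans
          (abs_jacobiSym_le_one _ d)).trans ?_
        rwa [Finset.sum_const, nsmul_eq_mul, mul_one]
      have := mul_le_mul_of_nonneg_right h1
        (show 0 ≤ 1 / Real.sqrt ((∏ i, v i : ℕ) : ℝ) by positivity)
      have h2 : (0 : ℝ) ≤ 21 * (x : ℝ) ^ k := by positivity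
      linarith
    · rw [zero_add]
      have h1 := abs_sum_one_mod_eight_jacobiSym_le (odd_prod_of_mem_oddTuples hv) hsq N
      have h2 : ((∏ i, v i : ℕ) : ℝ) ≤ (x : ℝ) ^ k := by
        exact_mod_cast prod_le_of_mem_oddTuples hv
      refine (le_abs_self _).trans ?_
      rw [abs_mul, abs_of_nonneg (show 0 ≤ 1 / Real.sqrt ((∏ i, v i : ℕ) : ℝ) by positivity)]
      refine (mul_le_of_le_one_right (abs_nonneg _) (one_div_sqrt_prod_le_one hv)).trans ?_
      linarith
  refine (Finset.sum_le_sum hterm).trans ?_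
  rw [Finset.sum_add_distrib, ← Finset.sum_filter, ← Finset.mul_sum, Finset.sum_const,
    nsmul_eq_mul]
  refine add_le_add_right ?_ _
  have h3 : ((oddTuples k x).card : ℝ) ≤ (x : ℝ) ^ k := by exact_mod_cast card_oddTuples_le k x
  calc _ ≤ (x : ℝ) ^ k * (21 * (x : ℝ) ^ k) := mul_le_mul_of_nonneg_right h3 (by positivity)
    _ = _ := by ring

/-- Only `d > N / 2` is used: there `d^(1/4) ≥ N^(1/4) / 2`, and `64 x² ≤ N` gives the required `16
x² ≤ d`. -/
theorem sum_discs_filter_rpow_ge {q x N : ℕ} (hodd : Odd q) (hN : 64 * x ^ 2 ≤ N) (hN1 : 1 ≤ N) :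
    3 / 128 * ((N : ℝ) ^ (5 / 4 : ℝ) * (q.totient / q : ℝ)) - 40 * ((N : ℝ) ^ (29 / 24 : ℝ) * q) ≤
      ∑ d ∈ (discs N).filter (fun d => d.Coprime q ∧ 16 * x ^ 2 ≤ d), (d : ℝ) ^ (1 / 4 : ℝ) := by
  have hN0 : (1 : ℝ) ≤ N := by exact_mod_cast hN1
  set B := (discs N).filter fun d => d.Coprime q ∧ N / 2 < d with hB
  have hsub : B ⊆ (discs N).filter (fun d => d.Coprime q ∧ 16 * x ^ 2 ≤ d) := fun d hd => by
    rw [hB, Finset.mem_filter] at hd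
    rw [Finset.mem_filter]
    exact ⟨hd.1, hd.2.1, by omega⟩
  refine le_trans ?_ (Finset.sum_le_sum_of_subset_of_nonneg hsub fun d _ _ => by positivity)
  have hd : ∀ d ∈ B, (N : ℝ) ^ (1 / 4 : ℝ) / 2 ≤ (d : ℝ) ^ (1 / 4 : ℝ) := fun d hd => by
    rw [hB, Finset.mem_filter] at hd
    have h1 : (N : ℝ) / 2 ≤ d := by
      rw [div_le_iff₀ two_pos]
      exact_mod_cast (by omega : N ≤ d * 2)
    refine le_trans ?_ (Real.rpow_le_rpow (by positivity) h1 (by norm_num))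
    rw [Real.div_rpow (by positivity) (by norm_num)]
    refine div_le_div_of_nonneg_left (by positivity) (by positivity) ?_
    calc (2 : ℝ) ^ (1 / 4 : ℝ) ≤ 2 ^ (1 : ℝ) :=
          Real.rpow_le_rpow_of_exponent_le (by norm_num) (by norm_num)
      _ = 2 := Real.rpow_one _
  have hcard := card_discs_filter_coprime_ge hodd N
  have h1 : (B.card : ℝ) * ((N : ℝ) ^ (1 / 4 : ℝ) / 2) ≤ ∑ d ∈ B, (d : ℝ) ^ (1 / 4 : ℝ) := by
    rw [← nsmul_eq_mul]
    exact Finset.card_nsmul_le_sum _ _ _ hd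
  refine le_trans ?_ h1
  refine le_trans ?_ (mul_le_mul_of_nonneg_right hcard (by positivity))
  have e1 : (N : ℝ) ^ (5 / 4 : ℝ) = N * (N : ℝ) ^ (1 / 4 : ℝ) := by
    rw [show (5 / 4 : ℝ) = 1 + 1 / 4 by norm_num, Real.rpow_add (by linarith), Real.rpow_one]
  have h2 : (Real.sqrt N + 1) * (N : ℝ) ^ (1 / 4 : ℝ) ≤ 2 * (N : ℝ) ^ (29 / 24 : ℝ) := by
    have h3 : Real.sqrt N + 1 ≤ 2 * (N : ℝ) ^ (1 / 2 : ℝ) := by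
      rw [← Real.sqrt_eq_rpow]
      have := Real.one_le_sqrt.2 hN0
      linarith
    have h4 : (N : ℝ) ^ (1 / 2 : ℝ) * (N : ℝ) ^ (1 / 4 : ℝ) ≤ (N : ℝ) ^ (29 / 24 : ℝ) := by
      rw [← Real.rpow_add (by linarith)]
      exact Real.rpow_le_rpow_of_exponent_le hN0 (by norm_num)
    have := mul_le_mul_of_nonneg_right h3 (show 0 ≤ (N : ℝ) ^ (1 / 4 : ℝ) by positivity)
    linarith
  have h3 := mul_le_mul_of_nonneg_left h2 (show (0 : ℝ) ≤ q by positivity)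
  have h4 : (0 : ℝ) ≤ (N : ℝ) ^ (29 / 24 : ℝ) * q := by positivity
  rw [e1]
  nlinarith

/-- Expand the `j`-th power and apply the twisted first moment to each product `m`, with `n₀ = x`.
The diagonal variable `n` becomes a further coordinate, so the tuples of length `j + 1` with square
product appear. -/
theorem exists_sum_discs_centralValue_mul_oddPartialSum_pow_ge (j : ℕ) :
    ∃ c C : ℝ, 0 < c ∧ 0 < C ∧ ∀ N x : ℕ, 64 * x ^ 2 ≤ N → 1 ≤ N → 1 ≤ x →
      c * ((N : ℝ) ^ (5 / 4 : ℝ) *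
        ∑ v ∈ (oddTuples (j + 1) x).filter (fun v => IsSquare (∏ i, v i)),
          ((∏ i, v i).totient : ℝ) / ((∏ i, v i : ℕ) : ℝ) *
            (1 / Real.sqrt ((∏ i, v i : ℕ) : ℝ))) -
        C * ((N : ℝ) ^ (29 / 24 : ℝ) * (x : ℝ) ^ (2 * (j + 1))) ≤
      ∑ d ∈ discs N, (d : ℝ) ^ (1 / 4 : ℝ) * centralValue d * oddPartialSum x d ^ j := by
  obtain ⟨c, C, hc, hC, hfirst⟩ := exists_sum_discs_centralValue_mul_jacobiSym_ge
  refine ⟨c * (3 / 128), C + 40 * c, by positivity, by positivity, fun N x hNx hN1 hx => ?_⟩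
  have hx1 : (1 : ℝ) ≤ x := by exact_mod_cast hx
  set O := (Finset.Icc 1 x).filter Odd with hO
  set R : ℝ := (N : ℝ) ^ (29 / 24 : ℝ) with hR
  set T : ℝ := (N : ℝ) ^ (5 / 4 : ℝ) with hT
  have hR0 : 0 ≤ R := by positivity
  have hexp : ∑ d ∈ discs N, (d : ℝ) ^ (1 / 4 : ℝ) * centralValue d * oddPartialSum x d ^ j =
      ∑ v ∈ oddTuples j x, 1 / Real.sqrt ((∏ i, v i : ℕ) : ℝ) *
        ∑ d ∈ discs N, (d : ℝ) ^ (1 / 4 : ℝ) * centralValue d *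
          jacobiSym ((∏ i, v i : ℕ) : ℤ) d := by
    simp_rw [oddPartialSum_pow, Finset.mul_sum]
    rw [Finset.sum_comm]
    refine Finset.sum_congr rfl fun v _ => Finset.sum_congr rfl fun d _ => by ring
  set g : ℕ → ℝ := fun P => if IsSquare P then 1 / Real.sqrt (P : ℝ) *
    (3 / 128 * (T * (P.totient / P : ℝ)) - 40 * (R * P)) else 0 with hg
  have hterm : ∀ v ∈ oddTuples j x, c * ∑ n ∈ O, g (∏ i, (Fin.cons n v : Fin (j + 1) → ℕ) i) -
      C * R ≤ 1 / Real.sqrt ((∏ i, v i : ℕ) : ℝ) *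
        ∑ d ∈ discs N, (d : ℝ) ^ (1 / 4 : ℝ) * centralValue d *
          jacobiSym ((∏ i, v i : ℕ) : ℤ) d := fun v hv => by
    set m := ∏ i, v i with hm
    have hmo : Odd m := odd_prod_of_mem_oddTuples hv
    have hm1 : (1 : ℝ) ≤ m := by exact_mod_cast hmo.pos
    have hs0 : 0 ≤ 1 / Real.sqrt (m : ℝ) := by positivity
    refine le_trans ?_ (mul_le_mul_of_nonneg_left (hfirst N m hmo x) hs0)
    rw [mul_sub]
    refine sub_le_sub ?_ ?_
    · rw [mul_left_comm]
      refine mul_le_mul_of_nonneg_left ?_ hc.le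
      rw [Finset.mul_sum, ← Finset.filter_filter, Finset.sum_filter (fun n => IsSquare (n * m))]
      refine Finset.sum_le_sum fun n hn => ?_
      rw [hO, Finset.mem_filter] at hn
      rw [Fin.prod_univ_succ]
      simp only [Fin.cons_zero, Fin.cons_succ]
      rw [← hm, hg]
      simp only
      split_ifs with hsq
      · rw [← Finset.sum_div, Nat.cast_mul, Real.sqrt_mul (Nat.cast_nonneg n)]
        have h1 := sum_discs_filter_rpow_ge (hn.2.mul hmo) hNx hN1
        rw [Nat.cast_mul] at h1
        have h2 := mul_le_mul_of_nonneg_left h1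
          (show 0 ≤ 1 / (Real.sqrt n * Real.sqrt m) by positivity)
        refine h2.trans (le_of_eq ?_)
        rw [← one_div_mul_one_div]
        ring
      · exact le_rfl
    · rw [mul_left_comm]
      refine mul_le_mul_of_nonneg_left ?_ hC.le
      rw [← hR, mul_left_comm]
      refine mul_le_of_le_one_right hR0 ?_
      rw [one_div_mul_eq_div, div_le_one (by positivity), Real.sqrt_eq_rpow]
      exact Real.rpow_le_rpow_of_exponent_le hm1 (by norm_num)
  rw [hexp]
  refine le_trans ?_ (Finset.sum_le_sum hterm)
  rw [Finset.sum_sub_distrib, ← Finset.mul_sum, Finset.sum_const, nsmul_eq_mul,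
    ← sum_oddTuples_succ j x fun w => g (∏ i, w i)]
  have hcard : ((oddTuples j x).card : ℝ) ≤ (x : ℝ) ^ (2 * (j + 1)) := by
    have h1 : ((oddTuples j x).card : ℝ) ≤ (x : ℝ) ^ j := by exact_mod_cast card_oddTuples_le j x
    exact h1.trans (pow_le_pow_right₀ hx1 (by omega))
  have hgsum : 3 / 128 * (T *
      ∑ v ∈ (oddTuples (j + 1) x).filter (fun v => IsSquare (∏ i, v i)),
          ((∏ i, v i).totient : ℝ) / ((∏ i, v i : ℕ) : ℝ) *
            (1 / Real.sqrt ((∏ i, v i : ℕ) : ℝ))) - 40 * (R * (x : ℝ) ^ (2 * (j + 1))) ≤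
      ∑ w ∈ oddTuples (j + 1) x, g (∏ i, w i) := by
    rw [Finset.sum_filter, Finset.mul_sum, Finset.mul_sum]
    have h1 : 40 * (R * (x : ℝ) ^ (2 * (j + 1))) ≥
        ∑ w ∈ oddTuples (j + 1) x, 40 * (R * (x : ℝ) ^ (j + 1)) := by
      rw [Finset.sum_const, nsmul_eq_mul]
      have h2 : ((oddTuples (j + 1) x).card : ℝ) ≤ (x : ℝ) ^ (j + 1) := by
        exact_mod_cast card_oddTuples_le (j + 1) x
      calc _ ≤ (x : ℝ) ^ (j + 1) * (40 * (R * (x : ℝ) ^ (j + 1))) :=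
            mul_le_mul_of_nonneg_right h2 (by positivity)
        _ = _ := by ring
    refine (sub_le_sub_left h1 _).trans ?_
    rw [← Finset.sum_sub_distrib]
    refine Finset.sum_le_sum fun w hw => ?_
    rw [hg]
    simp only
    split_ifs with hsq
    · have h2 : ((∏ i, w i : ℕ) : ℝ) ≤ (x : ℝ) ^ (j + 1) := by
        exact_mod_cast prod_le_of_mem_oddTuples hw
      have h3 : 1 / Real.sqrt ((∏ i, w i : ℕ) : ℝ) * (R * ((∏ i, w i : ℕ) : ℝ)) ≤
          R * (x : ℝ) ^ (j + 1) :=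
        (mul_le_of_le_one_left (by positivity) (one_div_sqrt_prod_le_one hw)).trans
          (mul_le_mul_of_nonneg_left h2 hR0)
      linarith
    · have : 0 ≤ 40 * (R * (x : ℝ) ^ (j + 1)) := by positivity
      simpa using this
  have h2 := mul_le_mul_of_nonneg_left hgsum hc.le
  have h3 := mul_le_mul_of_nonneg_right hcard (show 0 ≤ C * R by positivity)
  linarith

end Mollifier

/-! ### Comparison of moments and conclusion -/

section MomentLowerBound

open Filter

/-- A form of Young's inequality, used in place of Hölder: when `ε v ≤ u` the first term dominates,
otherwise the second. -/
theorem abs_mul_pow_le {u v ε : ℝ} (hu : 0 ≤ u) (hv : 0 ≤ v) (hε : 0 < ε) (j : ℕ) :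
    u * v ^ j ≤ (1 / ε) ^ j * u ^ (j + 1) + ε * v ^ (j + 1) := by
  rcases le_total (ε * v) u with h | h
  · have h1 : v ≤ 1 / ε * u := by
      rw [div_mul_eq_mul_div, one_mul, le_div_iff₀ hε]
      linarith
    have h2 := mul_le_mul_of_nonneg_left (pow_le_pow_left₀ hv h1 j) hu
    have h3 : 0 ≤ ε * v ^ (j + 1) := by positivity
    calc u * v ^ j ≤ u * (1 / ε * u) ^ j := h2
      _ = (1 / ε) ^ j * u ^ (j + 1) := by rw [mul_pow]; ring
      _ ≤ _ := by linarith
  · have h2 := mul_le_mul_of_nonneg_right h (pow_nonneg hv j)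
    have h3 : 0 ≤ (1 / ε) ^ j * u ^ (j + 1) := by positivity
    calc u * v ^ j ≤ ε * v * v ^ j := h2
      _ = ε * v ^ (j + 1) := by ring
      _ ≤ _ := by linarith

theorem sum_discs_mul_oddPartialSum_pow_le {j : ℕ} (hj : Even (j + 1)) {ε : ℝ} (hε : 0 < ε)
    (x N : ℕ) :
    ∑ d ∈ discs N, (d : ℝ) ^ (1 / 4 : ℝ) * centralValue d * oddPartialSum x d ^ j ≤
      (N : ℝ) ^ (1 / 4 : ℝ) * ((1 / ε) ^ j * ∑ d ∈ discs N, centralValue d ^ (j + 1) +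
        ε * ∑ d ∈ discs N, oddPartialSum x d ^ (j + 1)) := by
  rw [Finset.mul_sum, Finset.mul_sum, ← Finset.sum_add_distrib, Finset.mul_sum]
  refine Finset.sum_le_sum fun d hd => ?_
  rw [mem_discs] at hd
  have h1 := abs_mul_pow_le (abs_nonneg (centralValue d)) (abs_nonneg (oddPartialSum x d)) hε j
  rw [hj.pow_abs, hj.pow_abs] at h1
  have h2 : (d : ℝ) ^ (1 / 4 : ℝ) ≤ (N : ℝ) ^ (1 / 4 : ℝ) :=
    Real.rpow_le_rpow (by positivity) (by exact_mod_cast hd.1.2) (by norm_num)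
  refine (le_abs_self _).trans ?_
  rw [mul_assoc, abs_mul, abs_mul, abs_pow, abs_of_nonneg (show 0 ≤ (d : ℝ) ^ (1 / 4 : ℝ) by
    positivity)]
  exact mul_le_mul h2 h1 (by positivity) (by positivity)

set_option maxHeartbeats 1000000 in
theorem exists_eventually_le_sum_discs_centralValue_pow_succ {j : ℕ} (hj : Even (j + 1)) :
    ∃ c : ℝ, 0 < c ∧ ∀ᶠ N : ℕ in atTop,
      c * (N * Real.log N ^ ((j + 1) * (j + 1 + 1) / 2)) ≤
        ∑ d ∈ discs N, centralValue d ^ (j + 1) := by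
  obtain ⟨c₁, C₁, hc₁, hC₁, hmixed⟩ := exists_sum_discs_centralValue_mul_oddPartialSum_pow_ge j
  obtain ⟨C₂, hC₂, hdiag⟩ := exists_sum_piFinset_isSquare_le (j + 1)
  obtain ⟨c₂, hc₂, hmain⟩ := exists_log_pow_le_sum_piFinset_isSquare (j + 1)
  set k := j + 1 with hk
  set K := k * (k + 1) / 2 with hK
  have hK1 : 1 ≤ K := by
    rw [hK, Nat.le_div_iff_mul_le two_pos]
    nlinarith
  -- With `z ≤ N^θ` and `x = z^(2K)`, this gives `x^(2k) ≤ N^(4Kkθ) = N^(1/48)`, half of the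
  -- available saving `5/4 - 29/24 = 1/24`.
  set θ : ℝ := 1 / (192 * (K * k)) with hθ
  have hKk : (0 : ℝ) < K * k := by
    have : 0 < K * k := Nat.mul_pos hK1 (by omega)
    exact_mod_cast this
  have hθ0 : 0 < θ := by positivity
  have hk0 : (k : ℝ) ≠ 0 := right_ne_zero_of_mul hKk.ne'
  have hK0 : (K : ℝ) ≠ 0 := left_ne_zero_of_mul hKk.ne'
  set D : ℝ := C₂ * (1 + 2 * k * K) ^ K with hD
  have hD0 : 0 < D := by positivity
  -- Chosen so that the `ε`-term of Young's inequality takes at most a quarter of the main term, up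
  -- to the power-saving error.
  set ε : ℝ := min 1 (c₁ * c₂ / (4 * D)) with hε
  have hε0 : 0 < ε := lt_min one_pos (by positivity)
  have hε1 : ε ≤ 1 := min_le_left _ _
  have hεD : ε * D ≤ c₁ * c₂ / 4 := by
    have : ε ≤ c₁ * c₂ / (4 * D) := min_le_right _ _
    rw [le_div_iff₀ (by positivity)] at this
    linarith
  refine ⟨ε ^ j * (c₁ * c₂ / 2) * (θ / 2) ^ K, by positivity, ?_⟩
  have ht1 : Tendsto (fun N : ℕ => (N : ℝ) ^ θ) atTop atTop :=
    (tendsto_rpow_atTop hθ0).comp tendsto_natCast_atTop_atTop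
  have ht2 : Tendsto (fun N : ℕ => (N : ℝ) ^ (1 / 48 : ℝ)) atTop atTop :=
    (tendsto_rpow_atTop (by norm_num)).comp tendsto_natCast_atTop_atTop
  -- `9` gives `z ≥ 8`, hence `log z ≥ 1`, and `z ≥ N^(θ/2)` despite the floor; `64` gives `64 x² ≤
  -- N`; the third bound absorbs the power-saving errors.
  filter_upwards [ht1.eventually_ge_atTop 9, ht2.eventually_ge_atTop 64,
    ht2.eventually_ge_atTop ((C₁ + 21) * 4 / (c₁ * c₂)), eventually_ge_atTop 1] with N h9 h64 hB hN1
  have hN0 : (0 : ℝ) < N := Nat.cast_pos.2 hN1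
  have hN1' : (1 : ℝ) ≤ N := by exact_mod_cast hN1
  set z := ⌊(N : ℝ) ^ θ⌋₊ with hz
  have hzle : (z : ℝ) ≤ (N : ℝ) ^ θ := Nat.floor_le (by positivity)
  have hzge : (N : ℝ) ^ (θ / 2) ≤ z := by
    have h1 : (N : ℝ) ^ θ = ((N : ℝ) ^ (θ / 2)) ^ 2 := by
      rw [← Real.rpow_mul_natCast hN0.le]
      congr 1
      push_cast
      ring
    have h2 : (N : ℝ) ^ θ < z + 1 := Nat.lt_floor_add_one _
    have h3 : 0 ≤ (N : ℝ) ^ (θ / 2) := by positivity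
    have h4 : 3 ≤ (N : ℝ) ^ (θ / 2) := by nlinarith
    nlinarith
  have hz8 : (8 : ℝ) ≤ z := by
    have h2 : (N : ℝ) ^ θ < z + 1 := Nat.lt_floor_add_one _
    linarith
  have hz1 : 1 ≤ z := by
    have : (0 : ℝ) < z := by linarith
    exact_mod_cast this
  set l := Real.log z with hl
  have hl1 : 1 ≤ l := by
    rw [hl, Real.le_log_iff_exp_le (by linarith)]
    linarith [Real.exp_one_lt_d9]
  have hlN : θ / 2 * Real.log N ≤ l := by
    rw [← Real.log_rpow hN0]
    exact Real.log_le_log (by positivity) hzge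
  set x := z ^ (2 * K) with hx
  have hx1 : 1 ≤ x := Nat.one_le_pow _ _ hz1
  have hxpow : (x : ℝ) ^ (2 * k) ≤ (N : ℝ) ^ (1 / 48 : ℝ) := by
    rw [hx, Nat.cast_pow, ← pow_mul]
    refine (pow_le_pow_left₀ (by positivity) hzle _).trans (le_of_eq ?_)
    rw [← Real.rpow_mul_natCast hN0.le]
    congr 1
    rw [hθ]
    push_cast
    field_simp
    norm_num
  have hxN : 64 * x ^ 2 ≤ N := by
    have h1 : (x : ℝ) ^ 2 ≤ (x : ℝ) ^ (2 * k) :=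
      pow_le_pow_right₀ (by exact_mod_cast hx1) (by omega)
    have h2 : (N : ℝ) ^ (1 / 48 : ℝ) * (N : ℝ) ^ (1 / 48 : ℝ) ≤ N := by
      rw [← Real.rpow_add hN0]
      calc (N : ℝ) ^ (1 / 48 + 1 / 48 : ℝ) ≤ (N : ℝ) ^ (1 : ℝ) :=
            Real.rpow_le_rpow_of_exponent_le hN1' (by norm_num)
        _ = N := Real.rpow_one _
    have h3 : (64 : ℝ) * (x : ℝ) ^ 2 ≤ N := by nlinarith
    exact_mod_cast h3
  have hdiag' := hdiag x hx1
  have hmain' := hmain z hz1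
  have hS2 := sum_discs_oddPartialSum_pow_le hj x N
  have hS1 := (hmixed N x hxN hN1 hx1).trans (sum_discs_mul_oddPartialSum_pow_le hj hε0 x N)
  rw [← hk] at hS1
  rw [← hx, ← hl] at hmain'
  set M := ∑ v ∈ (oddTuples k x).filter (fun v => IsSquare (∏ i, v i)),
    ((∏ i, v i).totient : ℝ) / ((∏ i, v i : ℕ) : ℝ) * (1 / Real.sqrt ((∏ i, v i : ℕ) : ℝ)) with hM
  set E := ∑ v ∈ (oddTuples k x).filter (fun v => IsSquare (∏ i, v i)),
    1 / Real.sqrt ((∏ i, v i : ℕ) : ℝ) with hE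
  have hMl : c₂ * l ^ K ≤ M := hmain'
  -- `log x = 2K l`, and `l ≥ 1` allows `1 + 2kK l ≤ (1 + 2kK) l`.
  have hEl : E ≤ D * l ^ K := by
    refine le_trans hdiag' ?_
    rw [hD, mul_assoc, ← mul_pow, hx, Nat.cast_pow, Real.log_pow, ← hl]
    refine mul_le_mul_of_nonneg_left (pow_le_pow_left₀ (by positivity) ?_ K) hC₂.le
    push_cast
    linarith
  set Q := ∑ d ∈ discs N, centralValue d ^ k with hQ
  set A := ∑ d ∈ discs N, oddPartialSum x d ^ k with hA
  set P : ℝ := (N : ℝ) ^ (1 / 48 : ℝ) with hP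
  set X : ℝ := (x : ℝ) ^ (2 * k) with hX
  set U : ℝ := (N : ℝ) ^ (1 / 4 : ℝ) with hU
  have hU0 : 0 < U := by positivity
  have hP0 : 0 < P := by positivity
  have e1 : (N : ℝ) ^ (5 / 4 : ℝ) = U * N := by
    rw [show (5 / 4 : ℝ) = 1 / 4 + 1 by norm_num, Real.rpow_add hN0, Real.rpow_one]
  have e2 : (N : ℝ) ^ (29 / 24 : ℝ) * P * P = U * N := by
    rw [← e1, hP, mul_assoc, ← Real.rpow_add hN0, ← Real.rpow_add hN0]
    norm_num
  have hPN : P * P ≤ N := by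
    rw [hP, ← Real.rpow_add hN0]
    calc (N : ℝ) ^ (1 / 48 + 1 / 48 : ℝ) ≤ (N : ℝ) ^ (1 : ℝ) :=
          Real.rpow_le_rpow_of_exponent_le hN1' (by norm_num)
      _ = N := Real.rpow_one _
  have e3 : (N : ℝ) ^ (29 / 24 : ℝ) * X ≤ U * (N / P) := by
    refine (mul_le_mul_of_nonneg_left hxpow (by positivity)).trans (le_of_eq ?_)
    rw [mul_div_assoc', ← e2]
    field_simp
  have hXP : X ≤ N / P := by
    rw [le_div_iff₀ hP0]
    exact (mul_le_mul_of_nonneg_right hxpow hP0.le).trans hPN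
  have hmain2 : c₁ * (N * M) - C₁ * (N / P) ≤ (1 / ε) ^ j * Q + ε * A := by
    refine le_of_mul_le_mul_left ?_ hU0
    refine le_trans ?_ hS1
    rw [e1]
    have := mul_le_mul_of_nonneg_left e3 hC₁.le
    linarith
  have hA2 : ε * A ≤ ε * D * (N * l ^ K) + 21 * (N / P) := by
    have h1 : A ≤ N * (D * l ^ K) + 21 * (N / P) := by
      have := mul_le_mul_of_nonneg_left hEl hN0.le
      linarith
    have h2 := mul_le_mul_of_nonneg_left h1 hε0.le
    have h3 : ε * (21 * (N / P)) ≤ 1 * (21 * (N / P)) :=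
      mul_le_mul_of_nonneg_right hε1 (by positivity)
    linarith
  have hlK : 1 ≤ l ^ K := one_le_pow₀ hl1
  have hNl : (0 : ℝ) ≤ N * l ^ K := by positivity
  have hNP : (C₁ + 21) * (N / P) ≤ c₁ * c₂ / 4 * (N * l ^ K) := by
    rw [div_le_iff₀ (by positivity)] at hB
    have h1 : (C₁ + 21) * (N / P) ≤ c₁ * c₂ / 4 * N := by
      rw [mul_div_assoc', div_le_iff₀ hP0]
      have := mul_le_mul_of_nonneg_right hB hN0.le
      linarith
    refine h1.trans (mul_le_mul_of_nonneg_left ?_ (by positivity))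
    exact le_mul_of_one_le_right hN0.le hlK
  -- One quarter of the main term goes to `ε A`, another to the error terms; half remains.
  have hQ2 : c₁ * c₂ / 2 * (N * l ^ K) ≤ (1 / ε) ^ j * Q := by
    have h1 : c₁ * c₂ * (N * l ^ K) ≤ c₁ * (N * M) := by
      have := mul_le_mul_of_nonneg_left hMl (by positivity : 0 ≤ c₁ * N)
      linarith
    have h2 := mul_le_mul_of_nonneg_right hεD hNl
    linarith
  have hQ3 : ε ^ j * (c₁ * c₂ / 2) * (N * l ^ K) ≤ Q := by
    have h1 := mul_le_mul_of_nonneg_left hQ2 (pow_nonneg hε0.le j)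
    rw [← mul_assoc (ε ^ j) ((1 / ε) ^ j), ← mul_pow, mul_one_div_cancel hε0.ne', one_pow,
      one_mul] at h1
    linarith
  refine le_trans ?_ hQ3
  have h5 : (θ / 2 * Real.log N) ^ K ≤ l ^ K :=
    pow_le_pow_left₀ (mul_nonneg (by positivity) (Real.log_nonneg hN1')) hlN K
  rw [mul_pow] at h5
  have h6 := mul_le_mul_of_nonneg_left h5
    (show 0 ≤ ε ^ j * (c₁ * c₂ / 2) * N by positivity)
  linarith

/-- The case `k = 0`, where the moment is just the number of discriminants. -/
theorem eventually_le_card_discs :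
    ∀ᶠ N : ℕ in atTop, 1 / 64 * (N : ℝ) ≤ (discs N).card := by
  filter_upwards [eventually_ge_atTop 10000000] with N hN
  have h1 := card_discs_filter_coprime_ge odd_one N
  have h2 : (((discs N).filter fun d => d.Coprime 1 ∧ N / 2 < d).card : ℝ) ≤ (discs N).card :=
    Nat.cast_le.2 (Finset.card_filter_le _ _)
  have hN' : (10000000 : ℝ) ≤ N := by exact_mod_cast hN
  have h3 : Real.sqrt N ≤ N / 2000 := by
    rw [Real.sqrt_le_left (by positivity)]
    nlinarith
  simp only [Nat.totient_one, Nat.cast_one, div_one, mul_one, one_mul] at h1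
  linarith

theorem exists_eventually_le_sum_discs_centralValue_pow {k : ℕ} (hk : Even k) :
    ∃ c : ℝ, 0 < c ∧ ∀ᶠ N : ℕ in atTop,
      c * (N * Real.log N ^ (k * (k + 1) / 2)) ≤ ∑ d ∈ discs N, centralValue d ^ k := by
  cases k with
  | zero => exact ⟨1 / 64, by norm_num, by simpa using eventually_le_card_discs⟩
  | succ j => exact exists_eventually_le_sum_discs_centralValue_pow_succ hk

theorem sum_discs_le_sum_fundamentalDiscriminants {k : ℕ} (hk : Even k) {X : ℝ} (hX : 0 ≤ X) :
    ∑ d ∈ discs ⌊X⌋₊, centralValue d ^ k ≤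
      ∑ d ∈ fundamentalDiscriminants X, centralValue d ^ k := by
  rw [← Finset.sum_image (f := fun d : ℤ => centralValue d ^ k) (g := fun d : ℕ => (d : ℤ))
    fun a _ b _ h => Nat.cast_injective h]
  refine Finset.sum_le_sum_of_subset_of_nonneg (fun d hd => ?_) fun d _ _ => hk.pow_nonneg _
  obtain ⟨n, hn, rfl⟩ := Finset.mem_image.1 hd
  rw [mem_discs] at hn
  rw [mem_fundamentalDiscriminants]
  refine ⟨isFundamentalDiscriminant_natCast (by omega) hn.2.2, ?_⟩
  rw [Int.cast_natCast, Nat.abs_cast]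
  exact (Nat.le_floor_iff hX).1 hn.1.2

end MomentLowerBound

theorem theorem2 (k : ℕ) (hk : Even k) :
    ∃ c : ℝ, 0 < c ∧ ∃ X₀ : ℝ, ∀ X : ℝ, X₀ ≤ X →
      c * (X * Real.log X ^ (k * (k + 1) / 2)) ≤
        ∑ d ∈ fundamentalDiscriminants X, centralValue d ^ k := by
  obtain ⟨c, hc, h⟩ := exists_eventually_le_sum_discs_centralValue_pow hk
  obtain ⟨N₀, hN₀⟩ := Filter.eventually_atTop.1 h
  set K := k * (k + 1) / 2
  -- For `X ≥ 2`, `X ≤ 2⌊X⌋` and `X ≤ ⌊X⌋²`, so replacing `X` by its floor costs 2 in the linear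
  -- factor and 2 in each logarithm.
  refine ⟨c / (2 * 2 ^ K), by positivity, max 2 N₀, fun X hX => ?_⟩
  have hX2 : 2 ≤ X := (le_max_left _ _).trans hX
  have hXN : N₀ ≤ ⌊X⌋₊ := Nat.le_floor ((le_max_right _ _).trans hX)
  refine le_trans ?_ ((hN₀ _ hXN).trans
    (sum_discs_le_sum_fundamentalDiscriminants hk (by linarith)))
  have hN2 : (2 : ℝ) ≤ ⌊X⌋₊ := by exact_mod_cast Nat.le_floor (by exact_mod_cast hX2)
  have hlt : X < ⌊X⌋₊ + 1 := Nat.lt_floor_add_one X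
  have h1 : X ≤ 2 * ⌊X⌋₊ := by linarith
  have h2 : Real.log X ≤ 2 * Real.log ⌊X⌋₊ := by
    have h3 : X ≤ (⌊X⌋₊ : ℝ) ^ 2 := by nlinarith
    have h4 := Real.log_le_log (by linarith) h3
    rwa [Real.log_pow, Nat.cast_ofNat] at h4
  have h3 : Real.log X ^ K ≤ 2 ^ K * Real.log ⌊X⌋₊ ^ K := by
    rw [← mul_pow]
    exact pow_le_pow_left₀ (Real.log_nonneg (by linarith)) h2 K
  have h4 : X * Real.log X ^ K ≤ 2 * ⌊X⌋₊ * (2 ^ K * Real.log ⌊X⌋₊ ^ K) :=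
    mul_le_mul h1 h3 (pow_nonneg (Real.log_nonneg (by linarith)) K) (by positivity)
  rw [div_mul_eq_mul_div, div_le_iff₀ (by positivity)]
  have h5 := mul_le_mul_of_nonneg_left h4 hc.le
  linarith
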